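/- Let $\Bbbk$ be a field. All operads are non-symmetric; $\circ_i$ denotes insertion into the $i$-th input, with the Koszul sign rule, $\mathrm{id}$ the identity operation, and differentials have degree $+1$. Let $\mathcal{O}$ be the non-symmetric dg operad over $\Bbbk$ generated by a binary operation $m$ of degree $0$, a $0$-ary operation $j$ of degree $0$, and, for $n\ge 1$, $0\le k\le n$ and $1\le i_1<\dots<i_k\le n$, an $(n-k)$-ary operation $p_{n;i_1,\dots,i_k}$ of degree $1-n$, subject to the following relations. (i) $m$ is associative and $dm=0$. (ii) $m\circ(j,j)=j$ and $dj=0$. (iii) $p_{n;i_1,\dots,i_k}=0$ if $n\ge 2$ and $k=0$ or $k=n$. (iv) $p_{1;1}=j$ and $p_{1;-}=\mathrm{id}$. (v) For $n\ge 1$ write $p_{n;i_1,\dots,i_k}$ as $p_n(w_1,\dots,w_n)$, where $w_i$ is a formal unit $1$ if $i\in\{i_1,\dots,i_k\}$ and is an input otherwise; then $$d\,p_n(w_1,\dots,w_n)=\sum_{l=1}^{n-1}(-1)^{l}\,m\circ\big(p_l(w_1,\dots,w_l),\,p_{n-l}(w_{l+1},\dots,w_n)\big)+\sum_{r=1}^{n-1}(-1)^{r-1}\,p_{n-1}(w_1,\dots,w_{r-1},\,w_r\cdot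 w_{r+1},\,w_{r+2},\dots,w_n),$$ where $1\cdot 1=1$ is again a formal unit; if exactly one of $w_r,w_{r+1}$ is an input, then $w_r\cdot w_{r+1}$ is that input; and if both are inputs, then $w_r\cdot w_{r+1}$ means that $m$ is inserted into the corresponding input of $p_{n-1}(w_1,\dots,w_{r-1},\ast,w_{r+2},\dots,w_n)$, with $\ast$ an input. (Thus the $p_n$ are the Taylor components of an $A_\infty$ functor $C\oplus\Bbbk_C\to C$, and $\mathcal{O}$ is the operad governing weakly unital dg categories in the sense of Kontsevich and Soibelman.) Let $\mathcal{A}ssoc_+$ be the operad of strictly unital associative algebras: $\mathcal{A}ssoc_+(N)=\Bbbk$ in degree $0$ for every $N\ge 0$, with zero differential, and with all compositions given by the multiplication of $\Bbbk$. **Theorem.** There is a unique morphism of dg operads $P\colon\mathcal{O}\to\mathcal{A}ssoc_+$ that sends $m$ to $m$, $j$ to the unit $1$, and $p_{n;i_1,\dots,i_k}$ to $0$ for all $n\ge 2$. It is a quasi-isomorphism of dg operads, that is, $P(N)\colon\mathcal{O}(N)\to\mathcal{A}ssoc_+(N)$ is a quasi-isomorphism of complexes for every $N\ge 0$. -/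

import Mathlib

open CategoryTheory

universe u

/-- The sign `(-1) ^ a`, for an integer `a`, as a scalar. -/
def koszulSign (k : Type u) [Field k] (a : ℤ) : k := ((a.negOnePow : ℤ) : k)

/-- A non-symmetric dg operad over `k`, in partial-composition form. `obj n a` is the space of
operations of arity `n` and (cohomological) degree `a`; `comp i x y` is the partial composition
`x ∘_{i+1} y` (inputs are counted from `0`), and the differential `d` has degree `+1`.
Arities and degrees are related by equations, so that no casts are needed. -/
structure DgOperad (k : Type u) [Field k] where
  obj : ℕ → ℤ → Type u
  [addCommGroup : ∀ n a, AddCommGroup (obj n a)]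
  [module : ∀ n a, Module k (obj n a)]
  /-- the identity operation -/
  one : obj 1 0
  comp : ∀ {n m N : ℕ} {a b e : ℤ} (i : ℕ), i < n → N + 1 = n + m → e = a + b →
    (obj n a →ₗ[k] obj m b →ₗ[k] obj N e)
  d : ∀ {n : ℕ} {a b : ℤ}, a + 1 = b → (obj n a →ₗ[k] obj n b)
  d_d : ∀ {n : ℕ} {a b c : ℤ} (h : a + 1 = b) (h' : b + 1 = c) (x : obj n a), d h' (d h x) = 0
  d_one : ∀ {b : ℤ} (h : 0 + 1 = b), d h one = 0
  one_comp : ∀ {n : ℕ} {a : ℤ} (hi : 0 < 1) (hN : n + 1 = 1 + n) (he : a = 0 + a) (x : obj n a),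
    comp 0 hi hN he one x = x
  comp_one : ∀ {n : ℕ} {a : ℤ} (i : ℕ) (hi : i < n) (hN : n + 1 = n + 1) (he : a = a + 0)
    (x : obj n a), comp i hi hN he x one = x
  /-- sequential composition: `(x ∘ᵢ y) ∘ z = x ∘ᵢ (y ∘ⱼ z)`, `z` being inserted into `y` -/
  comp_assoc : ∀ {n m l N₁ M N : ℕ} {a b c e f g : ℤ} (i j : ℕ) (hi : i < n) (hj : j < m)
    (hij : i + j < N₁) (h₁ : N₁ + 1 = n + m) (h₂ : N + 1 = N₁ + l) (h₃ : M + 1 = m + l)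
    (h₄ : N + 1 = n + M) (e₁ : e = a + b) (e₂ : g = e + c) (e₃ : f = b + c) (e₄ : g = a + f)
    (x : obj n a) (y : obj m b) (z : obj l c),
    comp (i + j) hij h₂ e₂ (comp i hi h₁ e₁ x y) z = comp i hi h₄ e₄ x (comp j hj h₃ e₃ y z)
  /-- parallel composition: for inputs `i < r` of `x`, inserting `y` at `i` and `z` at `r`
  in the two possible orders gives the same result up to the Koszul sign -/
  comp_comm : ∀ {n m l N₁ M₁ N : ℕ} {a b c e f g : ℤ} (i r s : ℕ) (_ : i < r) (hi : i < n)
    (hr : r < n) (_ : s + 1 = r + m) (hs : s < N₁) (hi' : i < M₁)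
    (h₁ : N₁ + 1 = n + m) (h₂ : N + 1 = N₁ + l) (h₃ : M₁ + 1 = n + l) (h₄ : N + 1 = M₁ + m)
    (e₁ : e = a + b) (e₂ : g = e + c) (e₃ : f = a + c) (e₄ : g = f + b)
    (x : obj n a) (y : obj m b) (z : obj l c),
    comp s hs h₂ e₂ (comp i hi h₁ e₁ x y) z =
      koszulSign k (b * c) • comp i hi' h₄ e₄ (comp r hr h₃ e₃ x z) y
  /-- the Leibniz rule -/
  d_comp : ∀ {n m N : ℕ} {a a' b b' e e' : ℤ} (i : ℕ) (hi : i < n) (hN : N + 1 = n + m)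
    (he : e = a + b) (h : e + 1 = e') (ha : a + 1 = a') (hb : b + 1 = b') (he₁ : e' = a' + b)
    (he₂ : e' = a + b') (x : obj n a) (y : obj m b),
    d h (comp i hi hN he x y) =
      comp i hi hN he₁ (d ha x) y + koszulSign k a • comp i hi hN he₂ x (d hb y)

namespace DgOperad

attribute [instance] DgOperad.addCommGroup DgOperad.module

/-- A morphism of non-symmetric dg operads. -/
structure Hom {k : Type u} [Field k] (P Q : DgOperad k) where
  map : ∀ (n : ℕ) (a : ℤ), P.obj n a →ₗ[k] Q.obj n a
  map_one : map 1 0 P.one = Q.one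
  map_comp : ∀ {n m N : ℕ} {a b e : ℤ} (i : ℕ) (hi : i < n) (hN : N + 1 = n + m) (he : e = a + b)
    (x : P.obj n a) (y : P.obj m b),
    map N e (P.comp i hi hN he x y) = Q.comp i hi hN he (map n a x) (map m b y)
  map_d : ∀ {n : ℕ} {a b : ℤ} (h : a + 1 = b) (x : P.obj n a),
    map n b (P.d h x) = Q.d h (map n a x)

/-- The cochain complex of `n`-ary operations. -/
noncomputable def complex {k : Type u} [Field k] (P : DgOperad k) (n : ℕ) :
    CochainComplex (ModuleCat.{u} k) ℤ where
  X a := ModuleCat.of k (P.obj n a)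
  d a b := if h : a + 1 = b then ModuleCat.ofHom (P.d h) else 0
  shape a b h := dif_neg h
  d_comp_d' a b c h h' := by
    have h₁ : a + 1 = b := h
    have h₂ : b + 1 = c := h'
    rw [dif_pos h₁, dif_pos h₂]
    ext x
    exact P.d_d h₁ h₂ x

/-- The map of complexes of `n`-ary operations induced by a morphism of dg operads. -/
noncomputable def Hom.mapComplex {k : Type u} [Field k] {P Q : DgOperad k} (F : Hom P Q) (n : ℕ) :
    P.complex n ⟶ Q.complex n where
  f a := ModuleCat.ofHom (F.map n a)
  comm' a b h := by
    have h₁ : a + 1 = b := h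
    simp only [complex, dif_pos h₁]
    ext x
    exact (F.map_d h₁ x).symm

/-- A morphism of dg operads is a quasi-isomorphism if it is one in every arity `n ≥ 0`. -/
def Hom.IsQuasiIso {k : Type u} [Field k] {P Q : DgOperad k} (F : Hom P Q) : Prop :=
  ∀ n : ℕ, QuasiIso (F.mapComplex n)

end DgOperad

/-! ### The operad of strictly unital associative algebras -/

/-- `Assoc₊(n)` is `k` in degree `0` and zero in the other degrees. -/
def assocObj (k : Type u) [Field k] (a : ℤ) : Submodule k k where
  carrier := {x | a ≠ 0 → x = 0}
  add_mem' hx hy ha := by simp [hx ha, hy ha]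
  zero_mem' _ := rfl
  smul_mem' c x hx ha := by simp [hx ha]

/-- The operad `Assoc₊` of strictly unital associative algebras: one-dimensional in every arity
`n ≥ 0`, concentrated in degree `0`, all compositions being the multiplication of scalars. -/
def AssocPlus (k : Type u) [Field k] : DgOperad k where
  obj _ a := assocObj k a
  one := ⟨1, fun h => absurd rfl h⟩
  comp {n m N a b e} i hi hN he := LinearMap.mk₂ k
    (fun x y => ⟨(x : k) * (y : k), fun h => by
      by_cases ha : a = 0
      · have hb : b ≠ 0 := fun hb => h (by omega)
        rw [y.2 hb, mul_zero]
      · rw [x.2 ha, zero_mul]⟩)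
    (fun x x' y => Subtype.ext (add_mul _ _ _))
    (fun c x y => Subtype.ext (mul_assoc _ _ _))
    (fun x y y' => Subtype.ext (mul_add _ _ _))
    (fun c x y => Subtype.ext (mul_left_comm _ _ _))
  d _ := 0
  d_d _ _ _ := rfl
  d_one _ := rfl
  one_comp _ _ _ x := Subtype.ext (one_mul _)
  comp_one _ _ _ _ x := Subtype.ext (mul_one _)
  comp_assoc _ _ _ _ _ _ _ _ _ _ _ _ _ x y z := Subtype.ext (mul_assoc _ _ _)
  comp_comm {n m l N₁ M₁ N a b c e f g} _ _ _ _ _ _ _ _ _ _ _ _ _ _ _ _ _ x y z := by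
    apply Subtype.ext
    change (x : k) * y * z = koszulSign k (b * c) * (x * z * y)
    by_cases hb : b = 0
    · subst hb
      simp only [koszulSign, zero_mul, Int.negOnePow_zero, Units.val_one, Int.cast_one, one_mul]
      ring
    · rw [y.2 hb]; simp
  d_comp _ _ _ _ _ _ _ _ _ x y := by simp; rfl

/-- The `n`-fold multiplication, the canonical basis element of `Assoc₊(n)`. For `n = 2` it is the
multiplication `m`, for `n = 0` it is the unit `1`. -/
def AssocPlus.op (k : Type u) [Field k] (n : ℕ) : (AssocPlus k).obj n 0 :=
  ⟨1, fun h => absurd rfl h⟩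

/-! ### The operad governing weakly unital dg categories

An index `(n; i₁, …, iₖ)` with `1 ≤ i₁ < ⋯ < iₖ ≤ n` is encoded by the word `w` of length `n ≥ 1`
whose letter number `i` is `true` if `i ∈ {i₁, …, iₖ}` and `false` otherwise. So the letters
`true` mark the slots of `pₙ` that are filled with a formal unit `1`, and the letters `false` are
the `n - k` remaining inputs. -/

namespace WeaklyUnital

/-- Formal expressions of arity `n` and degree `a` in the generators `m`, `j`, `p w`, built with
the operations of a dg operad. -/
inductive Term (k : Type u) : ℕ → ℤ → Type u
  | one : Term k 1 0
  | m : Term k 2 0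
  | j : Term k 0 0
  | p (w : List Bool) (hw : 1 ≤ w.length) {n : ℕ} {a : ℤ} (hn : n = w.count false)
      (ha : a = 1 - (w.length : ℤ)) : Term k n a
  | comp {n m N : ℕ} {a b e : ℤ} (i : ℕ) (hi : i < n) (hN : N + 1 = n + m) (he : e = a + b)
      (x : Term k n a) (y : Term k m b) : Term k N e
  | d {n : ℕ} {a b : ℤ} (h : a + 1 = b) (x : Term k n a) : Term k n b
  | zero {n : ℕ} {a : ℤ} : Term k n a
  | add {n : ℕ} {a : ℤ} (x y : Term k n a) : Term k n a
  | smul {n : ℕ} {a : ℤ} (c : k) (x : Term k n a) : Term k n a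

namespace Term

/-- The sum of a list of terms. -/
def sum {k : Type u} {n : ℕ} {a : ℤ} (L : List (Term k n a)) : Term k n a :=
  L.foldr Term.add Term.zero

/-- The operation `m ∘ (p_u, p_v)`, that is `m (p_u (…), p_v (…))`. -/
def cut (k : Type u) (u v : List Bool) (hu : 1 ≤ u.length) (hv : 1 ≤ v.length) {n : ℕ} {a : ℤ}
    (hn : n = u.count false + v.count false)
    (ha : a = 2 - ((u.length : ℤ) + (v.length : ℤ))) : Term k n a :=
  .comp (n := u.count false + 1) (a := 1 - (u.length : ℤ)) (u.count false) (by omega) (by omega)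
    (by omega)
    (.comp 0 (by omega) (by omega) (by omega) .m (.p u hu rfl rfl)) (.p v hv rfl rfl)

/-- The operation `p_{n-1} (u, x · y, v)` for two neighbouring letters `x`, `y` of the word
`u x y v`. If both are inputs, their product is formed with `m`; a formal unit is a strict unit
for the product, so that `1 · 1 = 1`, `1 · f = f` and `f · 1 = f`. -/
def merge (k : Type u) (u v : List Bool) : ∀ (x y : Bool) {n : ℕ} {a : ℤ},
    n = (u ++ x :: y :: v).count false → a = 2 - ((u ++ x :: y :: v).length : ℤ) → Term k n a
  | false, false, n, a, hn, ha =>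
    .comp (u.count false) (by simp) (by simp at hn ⊢; omega) (by simp at ha ⊢; omega)
      (.p (u ++ false :: v) (by simp; omega) rfl rfl) .m
  | true, false, n, a, hn, ha =>
    .p (u ++ false :: v) (by simp; omega) (by simpa using hn) (by simp at ha ⊢; omega)
  | false, true, n, a, hn, ha =>
    .p (u ++ false :: v) (by simp; omega) (by simpa using hn) (by simp at ha ⊢; omega)
  | true, true, n, a, hn, ha =>
    .p (u ++ true :: v) (by simp; omega) (by simpa using hn) (by simp at ha ⊢; omega)

theorem split_eq (w : List Bool) (i : ℕ) (hi : i + 1 < w.length) :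
    w.take i ++ w[i] :: w[i + 1] :: w.drop (i + 2) = w := by
  rw [List.getElem_cons_drop, List.getElem_cons_drop, List.take_append_drop]

/-- The right-hand side of the formula for the differential,
`d p_w = ∑_{1 ≤ l ≤ n-1} (-1)^l m ∘ (p_{w₁…w_l}, p_{w_{l+1}…w_n})
  + ∑_{1 ≤ r ≤ n-1} (-1)^{r-1} p_{n-1} (w₁, …, w_r · w_{r+1}, …, w_n)`
(below `l = i + 1`, respectively `r = i + 1`). It says that the `p_n` are the Taylor components
of an `A_∞` functor. -/
def dp (k : Type u) [Field k] (w : List Bool) {n : ℕ} {a : ℤ} (hn : n = w.count false)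
    (ha : a = 2 - (w.length : ℤ)) : Term k n a :=
  .add
    (sum ((List.finRange (w.length - 1)).map fun (i : Fin (w.length - 1)) =>
      .smul ((-1) ^ ((i : ℕ) + 1))
        (cut k (w.take (i + 1)) (w.drop (i + 1))
          (by have := i.2; simp only [List.length_take]; omega)
          (by have := i.2; simp only [List.length_drop]; omega)
          (by rw [← List.count_append, List.take_append_drop, hn])
          (by have := i.2; simp only [List.length_take, List.length_drop]; omega))))
    (sum ((List.finRange (w.length - 1)).map fun (i : Fin (w.length - 1)) =>
      .smul ((-1) ^ (i : ℕ))
        (merge k (w.take i) (w.drop (i + 2))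
          (w[(i : ℕ)]'(by have := i.2; omega)) (w[(i : ℕ) + 1]'(by have := i.2; omega))
          (by rw [split_eq w i (by have := i.2; omega), hn])
          (by rw [split_eq w i (by have := i.2; omega), ha]))))

end Term

/-- The relations between formal expressions: the axioms of a dg operad, compatibility with all
the operations, and the defining relations of the operad. -/
inductive Rel (k : Type u) [Field k] : ∀ {n : ℕ} {a : ℤ}, Term k n a → Term k n a → Prop
  -- compatibility with the operations
  | comp_left {n m N : ℕ} {a b e : ℤ} (i : ℕ) (hi : i < n) (hN : N + 1 = n + m) (he : e = a + b)
      {x x' : Term k n a} (y : Term k m b) (h : Rel k x x') :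
      Rel k (.comp i hi hN he x y) (.comp i hi hN he x' y)
  | comp_right {n m N : ℕ} {a b e : ℤ} (i : ℕ) (hi : i < n) (hN : N + 1 = n + m) (he : e = a + b)
      (x : Term k n a) {y y' : Term k m b} (h : Rel k y y') :
      Rel k (.comp i hi hN he x y) (.comp i hi hN he x y')
  | d_congr {n : ℕ} {a b : ℤ} (h : a + 1 = b) {x x' : Term k n a} (hx : Rel k x x') :
      Rel k (.d h x) (.d h x')
  | add_left {n : ℕ} {a : ℤ} {x x' : Term k n a} (y : Term k n a) (h : Rel k x x') :
      Rel k (.add x y) (.add x' y)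
  | add_right {n : ℕ} {a : ℤ} (x : Term k n a) {y y' : Term k n a} (h : Rel k y y') :
      Rel k (.add x y) (.add x y')
  | smul_congr {n : ℕ} {a : ℤ} (c : k) {x x' : Term k n a} (h : Rel k x x') :
      Rel k (.smul c x) (.smul c x')
  -- vector space axioms
  | add_assoc {n : ℕ} {a : ℤ} (x y z : Term k n a) :
      Rel k (.add (.add x y) z) (.add x (.add y z))
  | add_comm {n : ℕ} {a : ℤ} (x y : Term k n a) : Rel k (.add x y) (.add y x)
  | zero_add {n : ℕ} {a : ℤ} (x : Term k n a) : Rel k (.add .zero x) x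
  | neg_add_cancel {n : ℕ} {a : ℤ} (x : Term k n a) : Rel k (.add (.smul (-1) x) x) .zero
  | smul_add {n : ℕ} {a : ℤ} (c : k) (x y : Term k n a) :
      Rel k (.smul c (.add x y)) (.add (.smul c x) (.smul c y))
  | add_smul {n : ℕ} {a : ℤ} (c c' : k) (x : Term k n a) :
      Rel k (.smul (c + c') x) (.add (.smul c x) (.smul c' x))
  | mul_smul {n : ℕ} {a : ℤ} (c c' : k) (x : Term k n a) :
      Rel k (.smul (c * c') x) (.smul c (.smul c' x))
  | one_smul {n : ℕ} {a : ℤ} (x : Term k n a) : Rel k (.smul 1 x) x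
  -- linearity of the compositions and of the differential
  | comp_add_left {n m N : ℕ} {a b e : ℤ} (i : ℕ) (hi : i < n) (hN : N + 1 = n + m)
      (he : e = a + b) (x x' : Term k n a) (y : Term k m b) :
      Rel k (.comp i hi hN he (.add x x') y)
        (.add (.comp i hi hN he x y) (.comp i hi hN he x' y))
  | comp_smul_left {n m N : ℕ} {a b e : ℤ} (i : ℕ) (hi : i < n) (hN : N + 1 = n + m)
      (he : e = a + b) (c : k) (x : Term k n a) (y : Term k m b) :
      Rel k (.comp i hi hN he (.smul c x) y) (.smul c (.comp i hi hN he x y))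
  | comp_add_right {n m N : ℕ} {a b e : ℤ} (i : ℕ) (hi : i < n) (hN : N + 1 = n + m)
      (he : e = a + b) (x : Term k n a) (y y' : Term k m b) :
      Rel k (.comp i hi hN he x (.add y y'))
        (.add (.comp i hi hN he x y) (.comp i hi hN he x y'))
  | comp_smul_right {n m N : ℕ} {a b e : ℤ} (i : ℕ) (hi : i < n) (hN : N + 1 = n + m)
      (he : e = a + b) (c : k) (x : Term k n a) (y : Term k m b) :
      Rel k (.comp i hi hN he x (.smul c y)) (.smul c (.comp i hi hN he x y))
  | d_add {n : ℕ} {a b : ℤ} (h : a + 1 = b) (x y : Term k n a) :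
      Rel k (.d h (.add x y)) (.add (.d h x) (.d h y))
  | d_smul {n : ℕ} {a b : ℤ} (h : a + 1 = b) (c : k) (x : Term k n a) :
      Rel k (.d h (.smul c x)) (.smul c (.d h x))
  -- axioms of a dg operad
  | d_d {n : ℕ} {a b c : ℤ} (h : a + 1 = b) (h' : b + 1 = c) (x : Term k n a) :
      Rel k (.d h' (.d h x)) .zero
  | d_one {b : ℤ} (h : 0 + 1 = b) : Rel k (.d h .one) .zero
  | one_comp {n : ℕ} {a : ℤ} (hi : 0 < 1) (hN : n + 1 = 1 + n) (he : a = 0 + a)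
      (x : Term k n a) : Rel k (.comp 0 hi hN he .one x) x
  | comp_one {n : ℕ} {a : ℤ} (i : ℕ) (hi : i < n) (hN : n + 1 = n + 1) (he : a = a + 0)
      (x : Term k n a) : Rel k (.comp i hi hN he x .one) x
  | comp_assoc {n m l N₁ M N : ℕ} {a b c e f g : ℤ} (i j : ℕ) (hi : i < n) (hj : j < m)
      (hij : i + j < N₁) (h₁ : N₁ + 1 = n + m) (h₂ : N + 1 = N₁ + l) (h₃ : M + 1 = m + l)
      (h₄ : N + 1 = n + M) (e₁ : e = a + b) (e₂ : g = e + c) (e₃ : f = b + c) (e₄ : g = a + f)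
      (x : Term k n a) (y : Term k m b) (z : Term k l c) :
      Rel k (.comp (i + j) hij h₂ e₂ (.comp i hi h₁ e₁ x y) z)
        (.comp i hi h₄ e₄ x (.comp j hj h₃ e₃ y z))
  | comp_comm {n m l N₁ M₁ N : ℕ} {a b c e f g : ℤ} (i r s : ℕ) (hir : i < r) (hi : i < n)
      (hr : r < n) (hrs : s + 1 = r + m) (hs : s < N₁) (hi' : i < M₁)
      (h₁ : N₁ + 1 = n + m) (h₂ : N + 1 = N₁ + l) (h₃ : M₁ + 1 = n + l) (h₄ : N + 1 = M₁ + m)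
      (e₁ : e = a + b) (e₂ : g = e + c) (e₃ : f = a + c) (e₄ : g = f + b)
      (x : Term k n a) (y : Term k m b) (z : Term k l c) :
      Rel k (.comp s hs h₂ e₂ (.comp i hi h₁ e₁ x y) z)
        (.smul (koszulSign k (b * c)) (.comp i hi' h₄ e₄ (.comp r hr h₃ e₃ x z) y))
  | d_comp {n m N : ℕ} {a a' b b' e e' : ℤ} (i : ℕ) (hi : i < n) (hN : N + 1 = n + m)
      (he : e = a + b) (h : e + 1 = e') (ha : a + 1 = a') (hb : b + 1 = b') (he₁ : e' = a' + b)
      (he₂ : e' = a + b') (x : Term k n a) (y : Term k m b) :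
      Rel k (.d h (.comp i hi hN he x y))
        (.add (.comp i hi hN he₁ (.d ha x) y)
          (.smul (koszulSign k a) (.comp i hi hN he₂ x (.d hb y))))
  -- (i) `m` is associative and `dm = 0`
  | m_assoc (h₀ : 0 < 2) (h₁ : 1 < 2) (hN : 3 + 1 = 2 + 2) (he : (0 : ℤ) = 0 + 0) :
      Rel k (.comp (N := 3) 0 h₀ hN he .m .m) (.comp (N := 3) 1 h₁ hN he .m .m)
  | d_m {b : ℤ} (h : 0 + 1 = b) : Rel k (.d h .m) .zero
  -- (ii) `m ∘ (j, j) = j` and `dj = 0`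
  | m_j_j (h₀ : 0 < 2) (h₁ : 0 < 1) (hN : 1 + 1 = 2 + 0) (hN' : 0 + 1 = 1 + 0)
      (he : (0 : ℤ) = 0 + 0) :
      Rel k (.comp (n := 1) 0 h₁ hN' he (.comp (n := 2) 0 h₀ hN he .m .j) .j) .j
  | d_j {b : ℤ} (h : 0 + 1 = b) : Rel k (.d h .j) .zero
  -- (iii) `p_{n; i₁, …, iₖ} = 0` if `n ≥ 2` and `k = 0` or `k = n`
  | p_const (c : Bool) (l : ℕ) (hl : 2 ≤ l) (hw : 1 ≤ (List.replicate l c).length) {n : ℕ} {a : ℤ}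
      (hn : n = (List.replicate l c).count false)
      (ha : a = 1 - ((List.replicate l c).length : ℤ)) :
      Rel k (.p (List.replicate l c) hw hn ha) .zero
  -- (iv) `p_{1;1} = j` and `p_{1;-} = id`
  | p_true (hw : 1 ≤ [true].length) (hn : 0 = [true].count false)
      (ha : (0 : ℤ) = 1 - ([true].length : ℤ)) : Rel k (.p [true] hw hn ha) .j
  | p_false (hw : 1 ≤ [false].length) (hn : 1 = [false].count false)
      (ha : (0 : ℤ) = 1 - ([false].length : ℤ)) : Rel k (.p [false] hw hn ha) .one
  -- (v) the formula for the differential of `p_{n; i₁, …, iₖ}`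
  | d_p (w : List Bool) (hw : 1 ≤ w.length) {n : ℕ} {a b : ℤ} (hn : n = w.count false)
      (ha : a = 1 - (w.length : ℤ)) (h : a + 1 = b) (hb : b = 2 - (w.length : ℤ)) :
      Rel k (.d h (.p w hw hn ha)) (Term.dp k w hn hb)

/-- The space of operations of arity `n` and degree `a`: formal expressions modulo relations. -/
def Obj (k : Type u) [Field k] (n : ℕ) (a : ℤ) : Type u :=
  Quot (Rel k : Term k n a → Term k n a → Prop)

namespace Obj

instance (k : Type u) [Field k] (n : ℕ) (a : ℤ) : Zero (Obj k n a) := ⟨Quot.mk _ Term.zero⟩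

instance (k : Type u) [Field k] (n : ℕ) (a : ℤ) : Add (Obj k n a) :=
  ⟨Quot.map₂ Term.add (fun x _ _ h => Rel.add_right x h) (fun _ _ y h => Rel.add_left y h)⟩

instance (k : Type u) [Field k] (n : ℕ) (a : ℤ) : Neg (Obj k n a) :=
  ⟨Quot.map (Term.smul (-1)) (fun _ _ h => Rel.smul_congr _ h)⟩

instance (k : Type u) [Field k] (n : ℕ) (a : ℤ) : AddCommGroup (Obj k n a) where
  add_assoc := by rintro ⟨x⟩ ⟨y⟩ ⟨z⟩; exact Quot.sound (Rel.add_assoc x y z)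
  add_comm := by rintro ⟨x⟩ ⟨y⟩; exact Quot.sound (Rel.add_comm x y)
  zero_add := by rintro ⟨x⟩; exact Quot.sound (Rel.zero_add x)
  add_zero := by
    rintro ⟨x⟩
    exact (Quot.sound (Rel.add_comm x Term.zero)).trans (Quot.sound (Rel.zero_add x))
  neg_add_cancel := by rintro ⟨x⟩; exact Quot.sound (Rel.neg_add_cancel x)
  nsmul := nsmulRec
  zsmul := zsmulRec

instance (k : Type u) [Field k] (n : ℕ) (a : ℤ) : SMul k (Obj k n a) where
  smul c := Quot.map (Term.smul c) (fun _ _ h => Rel.smul_congr c h)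

instance (k : Type u) [Field k] (n : ℕ) (a : ℤ) : Module k (Obj k n a) :=
  Module.ofMinimalAxioms
    (by rintro c ⟨x⟩ ⟨y⟩; exact Quot.sound (Rel.smul_add c x y))
    (by rintro c c' ⟨x⟩; exact Quot.sound (Rel.add_smul c c' x))
    (by rintro c c' ⟨x⟩; exact Quot.sound (Rel.mul_smul c c' x))
    (by rintro ⟨x⟩; exact Quot.sound (Rel.one_smul x))

end Obj

/-- The non-symmetric dg operad `𝒪` governing weakly unital dg categories: the quotient of the free
dg operad on `m`, `j` and the `p_{n; i₁, …, iₖ}` by the relations (i)-(v). -/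
def operadO (k : Type u) [Field k] : DgOperad k where
  obj n a := Obj k n a
  one := Quot.mk _ Term.one
  comp i hi hN he := LinearMap.mk₂ k
    (Quot.map₂ (Term.comp i hi hN he) (fun x _ _ h => Rel.comp_right i hi hN he x h)
      (fun _ _ y h => Rel.comp_left i hi hN he y h))
    (by rintro ⟨x⟩ ⟨x'⟩ ⟨y⟩; exact Quot.sound (Rel.comp_add_left i hi hN he x x' y))
    (by rintro c ⟨x⟩ ⟨y⟩; exact Quot.sound (Rel.comp_smul_left i hi hN he c x y))
    (by rintro ⟨x⟩ ⟨y⟩ ⟨y'⟩; exact Quot.sound (Rel.comp_add_right i hi hN he x y y'))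
    (by rintro c ⟨x⟩ ⟨y⟩; exact Quot.sound (Rel.comp_smul_right i hi hN he c x y))
  d h :=
    { toFun := Quot.map (Term.d h) (fun _ _ hx => Rel.d_congr h hx)
      map_add' := by rintro ⟨x⟩ ⟨y⟩; exact Quot.sound (Rel.d_add h x y)
      map_smul' := by rintro c ⟨x⟩; exact Quot.sound (Rel.d_smul h c x) }
  d_d h h' := by rintro ⟨x⟩; exact Quot.sound (Rel.d_d h h' x)
  d_one h := Quot.sound (Rel.d_one h)
  one_comp hi hN he := by rintro ⟨x⟩; exact Quot.sound (Rel.one_comp hi hN he x)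
  comp_one i hi hN he := by rintro ⟨x⟩; exact Quot.sound (Rel.comp_one i hi hN he x)
  comp_assoc i j hi hj hij h₁ h₂ h₃ h₄ e₁ e₂ e₃ e₄ := by
    rintro ⟨x⟩ ⟨y⟩ ⟨z⟩
    exact Quot.sound (Rel.comp_assoc i j hi hj hij h₁ h₂ h₃ h₄ e₁ e₂ e₃ e₄ x y z)
  comp_comm i r s hir hi hr hrs hs hi' h₁ h₂ h₃ h₄ e₁ e₂ e₃ e₄ := by
    rintro ⟨x⟩ ⟨y⟩ ⟨z⟩
    exact Quot.sound
      (Rel.comp_comm i r s hir hi hr hrs hs hi' h₁ h₂ h₃ h₄ e₁ e₂ e₃ e₄ x y z)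
  d_comp i hi hN he h ha hb he₁ he₂ := by
    rintro ⟨x⟩ ⟨y⟩
    exact Quot.sound (Rel.d_comp i hi hN he h ha hb he₁ he₂ x y)

/-- The generator `m`, a binary operation of degree `0`. -/
def opM (k : Type u) [Field k] : (operadO k).obj 2 0 := Quot.mk _ Term.m

/-- The generator `j`, a `0`-ary operation of degree `0`. -/
def opJ (k : Type u) [Field k] : (operadO k).obj 0 0 := Quot.mk _ Term.j

/-- The generator `p_{n; i₁, …, iₖ}`, an `(n - k)`-ary operation of degree `1 - n`. -/
def opP (k : Type u) [Field k] (w : List Bool) (hw : 1 ≤ w.length) :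
    (operadO k).obj (w.count false) (1 - (w.length : ℤ)) := Quot.mk _ (Term.p w hw rfl rfl)

/-- `F` sends `m` to the multiplication, `j` to the unit `1`, and all the operations
`p_{n; i₁, …, iₖ}` with `n ≥ 2` to `0`. -/
def IsProjection {k : Type u} [Field k] (F : DgOperad.Hom (operadO k) (AssocPlus k)) : Prop :=
  F.map 2 0 (opM k) = AssocPlus.op k 2 ∧
  F.map 0 0 (opJ k) = AssocPlus.op k 0 ∧
  ∀ (w : List Bool) (hw : 1 ≤ w.length), 2 ≤ w.length → F.map _ _ (opP k w hw) = 0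

end WeaklyUnital

/-!
The surjectivity of the projection on homology, its existence and its uniqueness are elementary. The
point is that every closed operation `x` in the kernel of the augmentation `aug` is a boundary. No
normal form for the operations of `𝒪` is used; instead a contraction is read off from one
well-chosen algebra over `𝒪`.

Let `A = ⨁ 𝒪(n)^a` be the free `𝒪`-algebra on one generator `v`, the identity operation (`totAlg`);
an operation is recovered as `x = x (v, …, v)` (`plug_replicate_one`). Let `S = k[X]`, and let
`ι : S → A` send `Xⁿ` to `j v j v ⋯ v j` (`WeakAlg.basePoint`). It is linear, closed, and fixed by
the left multiplication with `j`. On the triples `(a, s, h)` with `a ∈ A`, `s ∈ S` and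
`h : S → A` linear there is the differential algebra of endomorphisms of the mapping cone of `ι`
(`pathDga`), with `d (a, s, h) = (d a, 0, a ι - ι s - d h)`.

The main construction is `pathAlg`: this differential algebra carries operations `p` which make it
an algebra over `𝒪`, such that the projections to `A` and to the strictly unital algebra `S` are
compatible with them. Written in the bar sign conventions, as a function `τ` of words over the
algebra and a formal unit, an `𝒪`-algebra structure is a solution of the Maurer-Cartan equation
`d τ = bar τ + cut (sbar τ) τ` which is normalized on short words and on the words with only formal
units or no formal units. The third component of `τ` has to be a twisted module map extending `ι`.
The obvious candidate is `tail`, which appends base points `ι x` to a word (`bar_tail`, `d_tail`).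
It fails only in that it does not vanish on words of formal units; its values there are corrected
by an explicit boundary (`correction`, `d_correction`, `d_gauge`), which leaves the values on words
without formal units unchanged.

The generator lifts to the closed element `(v, X, p₂ (1, v ι (-)))` of the path algebra
(`d_liftGen`). The value of `x` at copies of this lift is `(x, aug x · Xⁿ, h)`. If `x` is closed and
`aug x = 0`, the last component of the differential of this triple, evaluated at `1 ∈ S`, reads
`x j = d (h 1)`. As `x - x j` is, up to sign, the differential of `p₂ (x, 1)`, `x` is a boundary
(`exists_d_eq`). The same triple shows that the augmentation respects the relations
(`aug_eq_of_rel`).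

Formal expressions act on any algebra with operations `m`, `j` and `p` through `eval`, and this
action respects the relations as soon as the operations satisfy the relations between generators
(`eval_eq_of_rel`); `eval_dp_add_dPart` translates the formula for `d p` into the Maurer-Cartan
equation.
-/

set_option linter.unusedSectionVars false

namespace WeaklyUnital

/-! ### The bar differential on words -/

/-- A differential algebra, possibly without unit, graded only through the parity operator `eps`
(`x ↦ (-1)^|x| x`). Keeping `eps` as a linear map makes all Koszul signs available without any
reference to homogeneous elements. -/
structure ParityDga (k : Type*) (X : Type*) [Field k] [AddCommGroup X] [Module k X] where
  eps : X →ₗ[k] X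
  d : X →ₗ[k] X
  mul : X →ₗ[k] X →ₗ[k] X
  eps_eps : ∀ x, eps (eps x) = x
  d_d : ∀ x, d (d x) = 0
  d_eps : ∀ x, d (eps x) = -eps (d x)
  eps_mul : ∀ x y, eps (mul x y) = mul (eps x) (eps y)
  mul_assoc : ∀ x y z, mul (mul x y) z = mul x (mul y z)
  d_mul : ∀ x y, d (mul x y) = mul (d x) y + mul (eps x) (d y)

section Words

variable {k : Type*} [Field k] {X : Type*} [AddCommGroup X] [Module k X]
  {M : Type*} [AddCommGroup M] [Module k M]

/-- Linearity of a function of words over `X ∪ {1}` in each letter from `X`; the letter `none`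
stands for the formal unit. -/
structure IsMulti (k : Type*) [Field k] {X : Type*} [AddCommGroup X] [Module k X]
    {M : Type*} [AddCommGroup M] [Module k M] (φ : List (Option X) → M) : Prop where
  add : ∀ L₁ L₂ x y, φ (L₁ ++ some (x + y) :: L₂) = φ (L₁ ++ some x :: L₂) + φ (L₁ ++ some y :: L₂)
  smul : ∀ L₁ L₂ (c : k) x, φ (L₁ ++ some (c • x) :: L₂) = c • φ (L₁ ++ some x :: L₂)

namespace IsMulti

theorem cons {φ : List (Option X) → M} (h : IsMulti k φ) (z : Option X) :
    IsMulti k fun L => φ (z :: L) :=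
  ⟨fun L₁ L₂ x y => h.add (z :: L₁) L₂ x y, fun L₁ L₂ c x => h.smul (z :: L₁) L₂ c x⟩

theorem zero_slot {φ : List (Option X) → M} (h : IsMulti k φ) (L₁ L₂) :
    φ (L₁ ++ some 0 :: L₂) = 0 := by
  simpa using h.smul L₁ L₂ 0 0

theorem neg_slot {φ : List (Option X) → M} (h : IsMulti k φ) (L₁ L₂ x) :
    φ (L₁ ++ some (-x) :: L₂) = -φ (L₁ ++ some x :: L₂) := by
  simpa using h.smul L₁ L₂ (-1) x

theorem add_head {φ : List (Option X) → M} (h : IsMulti k φ) (L x y) :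
    φ (some (x + y) :: L) = φ (some x :: L) + φ (some y :: L) := h.add [] L x y

theorem smul_head {φ : List (Option X) → M} (h : IsMulti k φ) (L) (c : k) (x) :
    φ (some (c • x) :: L) = c • φ (some x :: L) := h.smul [] L c x

theorem zero_head {φ : List (Option X) → M} (h : IsMulti k φ) (L) : φ (some 0 :: L) = 0 :=
  h.zero_slot [] L

theorem neg_head {φ : List (Option X) → M} (h : IsMulti k φ) (L x) :
    φ (some (-x) :: L) = -φ (some x :: L) := h.neg_slot [] L x

theorem sub_head {φ : List (Option X) → M} (h : IsMulti k φ) (L x y) :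
    φ (some (x - y) :: L) = φ (some x :: L) - φ (some y :: L) := by
  rw [sub_eq_add_neg, h.add_head, h.neg_head, sub_eq_add_neg]

/-- A function of words is multilinear as soon as it is linear in the first letter and
all its slices are multilinear. -/
theorem of_cons {φ : List (Option X) → M}
    (ha : ∀ L x y, φ (some (x + y) :: L) = φ (some x :: L) + φ (some y :: L))
    (hs : ∀ L (c : k) x, φ (some (c • x) :: L) = c • φ (some x :: L))
    (hc : ∀ z, IsMulti k fun L => φ (z :: L)) : IsMulti k φ := by
  refine ⟨fun L₁ L₂ x y => ?_, fun L₁ L₂ c x => ?_⟩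
  · cases L₁ with
    | nil => exact ha L₂ x y
    | cons z L₁ => exact (hc z).add L₁ L₂ x y
  · cases L₁ with
    | nil => exact hs L₂ c x
    | cons z L₁ => exact (hc z).smul L₁ L₂ c x

theorem fun_add {φ ψ : List (Option X) → M} (h : IsMulti k φ) (h' : IsMulti k ψ) :
    IsMulti k fun L => φ L + ψ L :=
  ⟨fun L₁ L₂ x y => by rw [h.add, h'.add]; abel,
    fun L₁ L₂ c x => by rw [h.smul, h'.smul, smul_add]⟩

theorem fun_neg {φ : List (Option X) → M} (h : IsMulti k φ) : IsMulti k fun L => -φ L :=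
  ⟨fun L₁ L₂ x y => by rw [h.add]; abel, fun L₁ L₂ c x => by rw [h.smul, smul_neg]⟩

theorem fun_sub {φ ψ : List (Option X) → M} (h : IsMulti k φ) (h' : IsMulti k ψ) :
    IsMulti k fun L => φ L - ψ L := by
  simpa only [sub_eq_add_neg] using h.fun_add h'.fun_neg

theorem fun_zero : IsMulti k fun _ : List (Option X) => (0 : M) :=
  ⟨fun _ _ _ _ => (add_zero 0).symm, fun _ _ c _ => (smul_zero c).symm⟩

theorem map {M' : Type*} [AddCommGroup M'] [Module k M'] {φ : List (Option X) → M}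
    (h : IsMulti k φ) (f : M →ₗ[k] M') : IsMulti k fun L => f (φ L) :=
  ⟨fun L₁ L₂ x y => by rw [h.add, map_add], fun L₁ L₂ c x => by rw [h.smul, map_smul]⟩

/-- Pulling back along a linear map of letters. -/
theorem comp_map {Y : Type*} [AddCommGroup Y] [Module k Y] {φ : List (Option X) → M}
    (h : IsMulti k φ) (f : Y →ₗ[k] X) : IsMulti k fun L => φ (L.map (Option.map f)) :=
  ⟨fun L₁ L₂ x y => by simp [h.add], fun L₁ L₂ c x => by simp [h.smul]⟩

theorem signed {φ : List (Option X) → M} (h : IsMulti k φ) :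
    IsMulti k fun L => (-1 : k) ^ L.length • φ L :=
  ⟨fun L₁ L₂ x y => by simp [h.add], fun L₁ L₂ c x => by simp [h.smul, smul_comm c]⟩

end IsMulti

namespace ParityDga

variable (D : ParityDga k X)

/-- The parity operator on `X ∪ {1}`. -/
def oeps (z : Option X) : Option X := z.map D.eps

/-- The product on `X ∪ {1}`, for which `1` is a strict unit. -/
def omul : Option X → Option X → Option X
  | none, z => z
  | some x, none => some x
  | some x, some y => some (D.mul x y)

@[simp] theorem oeps_none : D.oeps none = none := rfl

@[simp] theorem oeps_some (x : X) : D.oeps (some x) = some (D.eps x) := rfl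

@[simp] theorem omul_none_left (z : Option X) : D.omul none z = z := by cases z <;> rfl

@[simp] theorem omul_none_right (z : Option X) : D.omul z none = z := by cases z <;> rfl

@[simp] theorem omul_some_some (x y : X) : D.omul (some x) (some y) = some (D.mul x y) := rfl

@[simp] theorem oeps_oeps (z : Option X) : D.oeps (D.oeps z) = z := by
  cases z <;> simp [D.eps_eps]

theorem oeps_omul (z z' : Option X) :
    D.oeps (D.omul z z') = D.omul (D.oeps z) (D.oeps z') := by
  cases z <;> cases z' <;> simp [D.eps_mul]

theorem omul_assoc (z z' z'' : Option X) :
    D.omul (D.omul z z') z'' = D.omul z (D.omul z' z'') := by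
  cases z <;> cases z' <;> cases z'' <;> simp [D.mul_assoc]

@[simp] theorem oeps_comp_oeps : D.oeps ∘ D.oeps = id := funext D.oeps_oeps

/-- The contribution to `bar` of the differential of the first letter. -/
def dTerm (φ : List (Option X) → M) : Option X → List (Option X) → M
  | none, _ => 0
  | some x, L => φ (some (D.d x) :: L)

/-- The contribution to `bar` of the product of the first letter with what follows it: the second
letter, or, through `en`, the end of the word. -/
def mTerm (en : Option X → M →ₗ[k] M) (φ : List (Option X) → M) :
    Option X → List (Option X) → M
  | z, [] => en z (φ [])
  | z, z' :: L => φ (D.omul (D.oeps z) z' :: L)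

/-- The transpose of the bar differential: `bar φ (z₁ … zₙ)` is the sum of the
`± φ (ε z₁, …, ε zᵢ₋₁, d zᵢ, …)` and the `± φ (ε z₁, …, (ε zᵢ) zᵢ₊₁, …)`, with sign `(-1)^(i-1)`.
The operators `en z` describe an action of the last letter on the values, which occurs when words
are extended by an element of a module; for the bar construction itself `en = 0`. -/
def bar (en : Option X → M →ₗ[k] M) : (List (Option X) → M) → List (Option X) → M
  | _, [] => 0
  | φ, z :: L => D.dTerm φ z L + D.mTerm en φ z L - bar en (fun L' => φ (D.oeps z :: L')) L

/-- Precomposition with the parity operator of the shifted grading on words. -/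
def sbar (φ : List (Option X) → M) (L : List (Option X)) : M :=
  (-1 : k) ^ L.length • φ (L.map D.oeps)

variable {D} {en : Option X → M →ₗ[k] M}

@[simp] theorem bar_nil (φ : List (Option X) → M) : D.bar en φ [] = 0 := rfl

theorem bar_cons (φ : List (Option X) → M) (z L) : D.bar en φ (z :: L) =
    D.dTerm φ z L + D.mTerm en φ z L - D.bar en (fun L' => φ (D.oeps z :: L')) L := rfl

@[simp] theorem dTerm_none (φ : List (Option X) → M) (L) : D.dTerm φ none L = 0 := rfl

@[simp] theorem dTerm_some (φ : List (Option X) → M) (x L) :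
    D.dTerm φ (some x) L = φ (some (D.d x) :: L) := rfl

@[simp] theorem mTerm_nil (φ : List (Option X) → M) (z) : D.mTerm en φ z [] = en z (φ []) := by
  cases z <;> rfl

@[simp] theorem mTerm_cons (φ : List (Option X) → M) (z z' L) :
    D.mTerm en φ z (z' :: L) = φ (D.omul (D.oeps z) z' :: L) := by cases z <;> rfl

theorem bar_add (φ ψ : List (Option X) → M) (L) :
    D.bar en (fun L => φ L + ψ L) L = D.bar en φ L + D.bar en ψ L := by
  induction L generalizing φ ψ with
  | nil => simp
  | cons z L ih =>
    simp only [bar_cons, ih]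
    cases z <;> cases L <;> simp <;> abel

/-- Compatibility of `bar` with linear maps of the values. -/
theorem map_bar {M' : Type*} [AddCommGroup M'] [Module k M'] {en' : Option X → M' →ₗ[k] M'}
    (f : M →ₗ[k] M') (hf : ∀ z y, f (en z y) = en' z (f y)) (φ : List (Option X) → M) (L) :
    f (D.bar en φ L) = D.bar en' (fun L => f (φ L)) L := by
  induction L generalizing φ with
  | nil => simp
  | cons z L ih =>
    simp only [bar_cons, map_sub, map_add, ih]
    cases z <;> cases L <;> simp [hf]

theorem bar_smul (c : k) (φ : List (Option X) → M) (L) :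
    D.bar en (fun L => c • φ L) L = c • D.bar en φ L :=
  (map_bar (en := en) (en' := en) (LinearMap.lsmul k M c) (fun z y => by simp) φ L).symm

theorem bar_neg (φ : List (Option X) → M) (L) :
    D.bar en (fun L => -φ L) L = -D.bar en φ L := by
  simpa using bar_smul (D := D) (en := en) (-1) φ L

theorem bar_sub (φ ψ : List (Option X) → M) (L) :
    D.bar en (fun L => φ L - ψ L) L = D.bar en φ L - D.bar en ψ L := by
  simp only [sub_eq_add_neg, bar_add, bar_neg]

@[simp] theorem bar_zero (L) : D.bar en (fun _ => 0) L = 0 := by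
  simpa using bar_smul (D := D) (en := en) 0 (fun _ => 0) L

/-- `bar` does not depend on the values on the empty word if there is no end term. -/
theorem bar_congr_of_ne_nil {φ ψ : List (Option X) → M} (h : ∀ L, L ≠ [] → φ L = ψ L) (L) :
    D.bar (0 : Option X → M →ₗ[k] M) φ L = D.bar (0 : Option X → M →ₗ[k] M) ψ L := by
  cases L with
  | nil => rfl
  | cons z L =>
    have : (fun L' => φ (D.oeps z :: L')) = fun L' => ψ (D.oeps z :: L') :=
      funext fun L' => h _ (by simp)
    rw [bar_cons, bar_cons, this]
    cases z <;> cases L <;> simp [h]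

/-- The bar differential squares to zero. -/
theorem bar_bar (hd : ∀ x, en (some (D.d x)) = 0) (he : ∀ z, en (D.oeps z) = en z)
    (hm : ∀ z z' y, en (D.omul z z') y = en z' (en z y)) {φ : List (Option X) → M}
    (hφ : IsMulti k φ) (L) : D.bar en (D.bar en φ) L = 0 := by
  induction L generalizing φ with
  | nil => rfl
  | cons z L ih =>
    have h1 : D.bar en (fun L' => D.bar en φ (D.oeps z :: L')) L =
        D.bar en (fun L' => D.dTerm φ (D.oeps z) L') L
          + D.bar en (fun L' => D.mTerm en φ (D.oeps z) L') L := by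
      have := ih (hφ.cons z)
      simp only [bar_cons φ, oeps_oeps]
      rw [bar_sub, bar_add]
      simp [show D.bar en (D.bar en fun L' => φ (z :: L')) L = 0 from this]
    rw [bar_cons, h1]
    have key : ∀ (z : Option X), D.dTerm (D.bar en φ) z L
        = z.elim 0 (fun x => D.mTerm en φ (some (D.d x)) L)
          + D.bar en (fun L' => D.dTerm φ (D.oeps z) L') L := by
      rintro (_ | x)
      · simp
      · simp only [dTerm_some, bar_cons, D.d_d, oeps_some, hφ.zero_head, D.d_eps, hφ.neg_head,
          bar_neg, Option.elim_some]
        abel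
    rw [key]
    cases L with
    | nil => cases z <;> simp [hd]
    | cons z' L' =>
      simp only [mTerm_cons, bar_cons]
      have h2 : (fun L'' => φ (D.oeps (D.omul (D.oeps z) z') :: L''))
          = fun L'' => φ (D.omul (D.oeps (D.oeps z)) (D.oeps z') :: L'') := by
        rw [oeps_omul]
      rw [h2]
      have h3 : D.mTerm en φ (D.omul (D.oeps z) z') L'
          = D.mTerm en (fun L'' => D.mTerm en φ (D.oeps z) L'') z' L' := by
        cases L' with
        | nil => simp [hm, he]
        | cons z'' L'' => simp [oeps_omul, omul_assoc]
      rw [h3]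
      have h4 : D.dTerm φ (D.omul (D.oeps z) z') L'
          + z.elim 0 (fun x => D.mTerm en φ (some (D.d x)) (z' :: L'))
          = D.dTerm (fun L'' => D.mTerm en φ (D.oeps z) L'') z' L' := by
        cases z <;> cases z' <;> simp [D.d_eps, D.d_mul, D.eps_eps, hφ.add_head, hφ.neg_head]
      rw [← h4]
      simp only [mTerm_cons]
      abel

theorem sbar_cons (φ : List (Option X) → M) (z L) :
    D.sbar φ (z :: L) = -D.sbar (fun L' => φ (D.oeps z :: L')) L := by
  simp [sbar, pow_succ]

@[simp] theorem sbar_nil (φ : List (Option X) → M) : D.sbar φ [] = φ [] := by simp [sbar]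

@[simp] theorem sbar_sbar (φ : List (Option X) → M) : D.sbar (D.sbar φ) = φ := by
  funext L
  simp [sbar, smul_smul, ← mul_pow]

theorem sbar_add (φ ψ : List (Option X) → M) (L) :
    D.sbar (fun L => φ L + ψ L) L = D.sbar φ L + D.sbar ψ L := smul_add _ _ _

theorem sbar_neg (φ : List (Option X) → M) (L) :
    D.sbar (fun L => -φ L) L = -D.sbar φ L := smul_neg _ _

theorem map_sbar {M' : Type*} [AddCommGroup M'] [Module k M'] (f : M →ₗ[k] M')
    (φ : List (Option X) → M) (L) : f (D.sbar φ L) = D.sbar (fun L => f (φ L)) L :=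
  map_smul _ _ _

theorem isMulti_sbar {φ : List (Option X) → M} (h : IsMulti k φ) : IsMulti k (D.sbar φ) :=
  (h.comp_map D.eps).signed

/-- The bar differential has degree one for the shifted grading. -/
theorem bar_sbar (he : ∀ z, en (D.oeps z) = en z) {φ : List (Option X) → M}
    (hφ : IsMulti k φ) (L) : D.bar en (D.sbar φ) L = -D.sbar (D.bar en φ) L := by
  induction L generalizing φ with
  | nil => simp
  | cons z L ih =>
    have h1 : (fun L' => D.sbar φ (D.oeps z :: L')) = fun L' => -D.sbar (fun L'' => φ (z :: L'')) L'
      := by funext L'; rw [sbar_cons, oeps_oeps]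
    rw [bar_cons, h1, bar_neg, ih (hφ.cons z), sbar_cons]
    simp only [bar_cons φ, oeps_oeps]
    have h2 : ∀ L, D.dTerm (D.sbar φ) z L = D.sbar (fun L' => D.dTerm φ (D.oeps z) L') L := by
      intro L
      cases z with
      | none => simp [sbar]
      | some x => simp [sbar_cons, D.d_eps, hφ.neg_head, sbar_neg]
    have h3 : ∀ L, D.mTerm en (D.sbar φ) z L = D.sbar (fun L' => D.mTerm en φ (D.oeps z) L') L := by
      intro L
      cases L with
      | nil => simp [he]
      | cons z' L' => simp [sbar_cons, oeps_omul]
    have h4 : D.sbar (fun L' => D.dTerm φ (D.oeps z) L' + D.mTerm en φ (D.oeps z) L' -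
        D.bar en (fun L'' => φ (z :: L'')) L') L
        = D.sbar (fun L' => D.dTerm φ (D.oeps z) L') L
          + D.sbar (fun L' => D.mTerm en φ (D.oeps z) L') L
          - D.sbar (D.bar en fun L'' => φ (z :: L'')) L := by
      simp only [sbar, smul_sub, smul_add]
    rw [h4, h2, h3]
    abel

theorem isMulti_dTerm {φ : List (Option X) → M} (h : IsMulti k φ) (z) :
    IsMulti k fun L => D.dTerm φ z L := by
  cases z with
  | none => exact IsMulti.fun_zero
  | some x => exact h.cons _

theorem omul_some_add (z : Option X) (x y : X) {φ : List (Option X) → M} (h : IsMulti k φ) (L) :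
    φ (D.omul z (some (x + y)) :: L) = φ (D.omul z (some x) :: L) + φ (D.omul z (some y) :: L) := by
  cases z <;> simp [h.add_head]

theorem omul_some_smul (z : Option X) (c : k) (x : X) {φ : List (Option X) → M} (h : IsMulti k φ)
    (L) : φ (D.omul z (some (c • x)) :: L) = c • φ (D.omul z (some x) :: L) := by
  cases z <;> simp [h.smul_head]

theorem isMulti_bar (hadd : ∀ x y v, en (some (x + y)) v = en (some x) v + en (some y) v)
    (hsmul : ∀ (c : k) x v, en (some (c • x)) v = c • en (some x) v)
    {φ : List (Option X) → M} (h : IsMulti k φ) : IsMulti k (D.bar en φ) := by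
  have hslice : ∀ {φ : List (Option X) → M}, IsMulti k φ → ∀ (L : List (Option X)),
      (∀ x y, D.bar en (fun L' => φ (some (x + y) :: L')) L =
        D.bar en (fun L' => φ (some x :: L')) L + D.bar en (fun L' => φ (some y :: L')) L) ∧
      ∀ (c : k) x, D.bar en (fun L' => φ (some (c • x) :: L')) L =
        c • D.bar en (fun L' => φ (some x :: L')) L := by
    intro φ hφ L
    refine ⟨fun x y => ?_, fun c x => ?_⟩
    · rw [← bar_add]; simp only [hφ.add_head]
    · rw [← bar_smul]; simp only [hφ.smul_head]
  have main : ∀ L₁ : List (Option X), ∀ φ : List (Option X) → M, IsMulti k φ →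
      (∀ L₂ x y, D.bar en φ (L₁ ++ some (x + y) :: L₂) =
        D.bar en φ (L₁ ++ some x :: L₂) + D.bar en φ (L₁ ++ some y :: L₂)) ∧
      (∀ L₂ (c : k) x, D.bar en φ (L₁ ++ some (c • x) :: L₂) =
        c • D.bar en φ (L₁ ++ some x :: L₂)) := by
    intro L₁
    induction L₁ with
    | nil =>
      intro φ hφ
      refine ⟨fun L₂ x y => ?_, fun L₂ c x => ?_⟩
      · simp only [List.nil_append, bar_cons, oeps_some, map_add, dTerm_some]
        rw [(hslice hφ L₂).1, hφ.add_head]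
        cases L₂ with
        | nil => simp [hadd]; abel
        | cons z L =>
          cases z <;> simp [hφ.add_head] <;> abel
      · simp only [List.nil_append, bar_cons, oeps_some, map_smul, dTerm_some, smul_add, smul_sub]
        rw [(hslice hφ L₂).2, hφ.smul_head]
        cases L₂ with
        | nil => simp [hsmul]
        | cons z L =>
          cases z <;> simp [hφ.smul_head]
    | cons z L₁ ih =>
      intro φ hφ
      have ih' := ih _ (hφ.cons (D.oeps z))
      have hd := isMulti_dTerm (D := D) hφ z
      refine ⟨fun L₂ x y => ?_, fun L₂ c x => ?_⟩
      · simp only [List.cons_append, bar_cons, ih'.1, hd.add]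
        cases L₁ with
        | nil => simp [omul_some_add _ _ _ hφ]; abel
        | cons z' L₁ =>
          have := (hφ.cons (D.omul (D.oeps z) z')).add L₁ L₂ x y
          simp [this]; abel
      · simp only [List.cons_append, bar_cons, ih'.2, hd.smul, smul_sub, smul_add]
        cases L₁ with
        | nil => simp [omul_some_smul _ _ _ hφ]
        | cons z' L₁ =>
          have := (hφ.cons (D.omul (D.oeps z) z')).smul L₁ L₂ c x
          simp [this]
  exact ⟨fun L₁ L₂ x y => (main L₁ φ h).1 L₂ x y, fun L₁ L₂ c x => (main L₁ φ h).2 L₂ c x⟩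

end ParityDga
end Words
end WeaklyUnital

namespace WeaklyUnital

/-! ### Cut products of functions of words -/

section Words

variable {k : Type*} [Field k] {X : Type*} [AddCommGroup X] [Module k X]
  {M : Type*} [AddCommGroup M] [Module k M] {N : Type*} [AddCommGroup N] [Module k N]

/-- The cut product of two functions of words: the sum of the `τ u · φ v` over all the
factorizations `u v` of the word with `u` nonempty. -/
def cut {α : Type*} (la : X →ₗ[k] N →ₗ[k] M) :
    (List α → X) → (List α → N) → List α → M
  | _, _, [] => 0
  | τ, φ, z :: L => la (τ [z]) (φ L) + cut la (fun u => τ (z :: u)) φ L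

section Cut

variable {α : Type*} {la : X →ₗ[k] N →ₗ[k] M}

@[simp] theorem cut_nil (τ : List α → X) (φ : List α → N) : cut la τ φ [] = 0 := rfl

theorem cut_cons (τ : List α → X) (φ : List α → N) (z L) :
    cut la τ φ (z :: L) = la (τ [z]) (φ L) + cut la (fun u => τ (z :: u)) φ L := rfl

theorem cut_add_left (τ τ' : List α → X) (φ : List α → N) (L) :
    cut la (fun u => τ u + τ' u) φ L = cut la τ φ L + cut la τ' φ L := by
  induction L generalizing τ τ' with
  | nil => simp
  | cons z L ih => simp only [cut_cons, ih, map_add, LinearMap.add_apply]; abel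

theorem cut_smul_left (c : k) (τ : List α → X) (φ : List α → N) (L) :
    cut la (fun u => c • τ u) φ L = c • cut la τ φ L := by
  induction L generalizing τ with
  | nil => simp
  | cons z L ih => simp only [cut_cons, ih, map_smul, LinearMap.smul_apply, smul_add]

theorem cut_neg_left (τ : List α → X) (φ : List α → N) (L) :
    cut la (fun u => -τ u) φ L = -cut la τ φ L := by
  simpa using cut_smul_left (la := la) (-1) τ φ L

theorem cut_zero_left (φ : List α → N) (L) : cut la (fun _ => 0) φ L = 0 := by
  simpa using cut_smul_left (la := la) 0 (fun _ => 0) φ L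

theorem cut_add_right (τ : List α → X) (φ φ' : List α → N) (L) :
    cut la τ (fun u => φ u + φ' u) L = cut la τ φ L + cut la τ φ' L := by
  induction L generalizing τ with
  | nil => simp
  | cons z L ih => simp only [cut_cons, ih, map_add]; abel

theorem cut_smul_right (c : k) (τ : List α → X) (φ : List α → N) (L) :
    cut la τ (fun u => c • φ u) L = c • cut la τ φ L := by
  induction L generalizing τ with
  | nil => simp
  | cons z L ih => simp only [cut_cons, ih, map_smul, smul_add]

theorem cut_neg_right (τ : List α → X) (φ : List α → N) (L) :
    cut la τ (fun u => -φ u) L = -cut la τ φ L := by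
  simpa using cut_smul_right (la := la) (-1) τ φ L

/-- Only the values of the left factor on nonempty words matter. -/
theorem cut_congr_left {τ τ' : List α → X} (h : ∀ u, u ≠ [] → τ u = τ' u) (φ : List α → N) (L) :
    cut la τ φ L = cut la τ' φ L := by
  induction L generalizing τ τ' with
  | nil => rfl
  | cons z L ih =>
    rw [cut_cons, cut_cons, h _ (by simp), ih fun u _ => h (z :: u) (by simp)]

theorem cut_map {β : Type*} (f : β → α) (τ : List α → X) (φ : List α → N) (L : List β) :
    cut la τ φ (L.map f) = cut la (fun u => τ (u.map f)) (fun u => φ (u.map f)) L := by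
  induction L generalizing τ with
  | nil => rfl
  | cons z L ih => simp [cut_cons, ih]

theorem cut_eq_zero_of_left {τ : List α → X} (φ : List α → N) {L : List α}
    (h : ∀ u, u ≠ [] → u <+: L → τ u = 0) : cut la τ φ L = 0 := by
  induction L generalizing τ with
  | nil => rfl
  | cons z L ih =>
    rw [cut_cons, h [z] (by simp) (by simp), ih fun u _ hu => h (z :: u) (by simp) (by simpa)]
    simp

theorem cut_eq_zero_of_right (τ : List α → X) {φ : List α → N} {L : List α}
    (h : ∀ v, v <:+ L → φ v = 0) : cut la τ φ L = 0 := by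
  induction L generalizing τ with
  | nil => rfl
  | cons z L ih =>
    rw [cut_cons, h L (List.suffix_cons z L),
      ih _ fun v hv => h v (hv.trans (List.suffix_cons z L))]
    simp

/-- A linear map that turns a product into a sum of two products does the same with cut
products. -/
theorem map_cut_add {M' X₁ N₁ X₂ N₂ : Type*} [AddCommGroup M'] [Module k M'] [AddCommGroup X₁]
    [Module k X₁] [AddCommGroup N₁] [Module k N₁] [AddCommGroup X₂] [Module k X₂]
    [AddCommGroup N₂] [Module k N₂] {la₁ : X₁ →ₗ[k] N₁ →ₗ[k] M'} {la₂ : X₂ →ₗ[k] N₂ →ₗ[k] M'}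
    (f : M →ₗ[k] M') (g₁ : X → X₁) (f₁ : N → N₁) (g₂ : X → X₂) (f₂ : N → N₂)
    (h : ∀ a y, f (la a y) = la₁ (g₁ a) (f₁ y) + la₂ (g₂ a) (f₂ y)) (τ : List α → X)
    (φ : List α → N) (L) :
    f (cut la τ φ L) = cut la₁ (fun u => g₁ (τ u)) (fun u => f₁ (φ u)) L
      + cut la₂ (fun u => g₂ (τ u)) (fun u => f₂ (φ u)) L := by
  induction L generalizing τ with
  | nil => simp
  | cons z L ih => simp only [cut_cons, map_add, h, ih]; abel

end Cut

section CutModule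

variable {α : Type*} {la : X →ₗ[k] M →ₗ[k] M}

/-- Compatibility of cut products with a pair of linear maps. -/
theorem map_cut {X' M' : Type*} [AddCommGroup X'] [Module k X'] [AddCommGroup M'] [Module k M']
    {la' : X' →ₗ[k] M' →ₗ[k] M'} (g : X →ₗ[k] X') (f : M →ₗ[k] M')
    (h : ∀ a y, f (la a y) = la' (g a) (f y)) (τ : List α → X) (φ : List α → M) (L) :
    f (cut la τ φ L) = cut la' (fun u => g (τ u)) (fun u => f (φ u)) L := by
  induction L generalizing τ with
  | nil => simp
  | cons z L ih => simp only [cut_cons, map_add, h, ih]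

/-- The Leibniz rule for cut products. -/
theorem d_cut {dX eX : X →ₗ[k] X} {dM : M →ₗ[k] M}
    (h : ∀ a y, dM (la a y) = la (dX a) y + la (eX a) (dM y)) (τ : List α → X) (φ : List α → M)
    (L) : dM (cut la τ φ L) =
      cut la (fun u => dX (τ u)) φ L + cut la (fun u => eX (τ u)) (fun u => dM (φ u)) L := by
  induction L generalizing τ with
  | nil => simp
  | cons z L ih => simp only [cut_cons, map_add, h, ih]; abel

theorem la_cut {mul : X →ₗ[k] X →ₗ[k] X} (h : ∀ a b y, la (mul a b) y = la a (la b y)) (a : X)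
    (τ : List α → X) (φ : List α → M) (L) :
    cut la (fun u => mul a (τ u)) φ L = la a (cut la τ φ L) := by
  induction L generalizing τ with
  | nil => simp
  | cons z L ih => simp only [cut_cons, h, ih, map_add]

/-- Associativity of cut products. -/
theorem cut_cut {mul : X →ₗ[k] X →ₗ[k] X} (h : ∀ a b y, la (mul a b) y = la a (la b y))
    (τ τ' : List α → X) (h' : τ' [] = 0) (φ : List α → M) (L) :
    cut la τ (cut la τ' φ) L = cut la (cut mul τ τ') φ L := by
  induction L generalizing τ with
  | nil => rfl
  | cons z L ih =>
    rw [cut_cons, ih, cut_cons]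
    simp only [cut_cons (la := mul)]
    rw [cut_add_left, la_cut h]
    simp [h']

end CutModule

namespace ParityDga

variable {D : ParityDga k X} {Y : Type*} [AddCommGroup Y] [Module k Y] {B : ParityDga k Y}
  {en : Option X → M →ₗ[k] M} {la : Y →ₗ[k] M →ₗ[k] M}

theorem sbar_cut (τ : List (Option X) → Y) (φ : List (Option X) → M) (L) :
    D.sbar (cut la τ φ) L = cut la (D.sbar τ) (D.sbar φ) L := by
  induction L generalizing τ with
  | nil => simp
  | cons z L ih =>
    have h : (fun u => D.sbar τ (z :: u)) = fun u => -D.sbar (fun u => τ (D.oeps z :: u)) u :=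
      funext fun u => sbar_cons τ z u
    rw [sbar_cons, cut_cons, h, cut_neg_left, ← ih]
    simp only [cut_cons, sbar_add]
    simp [sbar, add_comm]

/-- The bar differential is a coderivation for the deconcatenation of words. -/
theorem bar_cut (hla : ∀ z a y, en z (la a y) = la a (en z y)) (τ : List (Option X) → Y)
    (φ : List (Option X) → M) (L) :
    D.bar en (cut la τ φ) L =
      cut la (D.bar (0 : Option X → Y →ₗ[k] Y) τ) φ L + cut la (D.sbar τ) (D.bar en φ) L := by
  induction L generalizing τ with
  | nil => simp
  | cons z L ih =>
    have h : (fun u => D.sbar τ (z :: u)) = fun u => -D.sbar (fun u => τ (D.oeps z :: u)) u :=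
      funext fun u => sbar_cons τ z u
    have h1 : D.bar en (fun L' => cut la τ φ (D.oeps z :: L')) L
        = la (τ [D.oeps z]) (D.bar en φ L)
          + (cut la (D.bar 0 fun u => τ (D.oeps z :: u)) φ L +
            cut la (D.sbar fun u => τ (D.oeps z :: u)) (D.bar en φ) L) := by
      simp only [cut_cons]
      rw [bar_add, ih, map_bar (en' := en) (la (τ [D.oeps z]))
        (fun z y => (hla z _ y).symm)]
    rw [bar_cons, h1, cut_cons, cut_cons, h, cut_neg_left]
    have h2 : cut la (fun u => D.bar (0 : Option X → Y →ₗ[k] Y) τ (z :: u)) φ L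
        = cut la (fun u => D.dTerm τ z u) φ L
          + cut la (fun u => D.mTerm (0 : Option X → Y →ₗ[k] Y) τ z u) φ L
          - cut la (D.bar 0 fun u => τ (D.oeps z :: u)) φ L := by
      simp only [bar_cons τ, sub_eq_add_neg]
      rw [cut_add_left, cut_add_left, cut_neg_left]
    have h3 : D.dTerm (cut la τ φ) z L
        = la (D.dTerm τ z []) (φ L) + cut la (fun u => D.dTerm τ z u) φ L := by
      cases z with
      | none => simp [cut_zero_left]
      | some x => simp [cut_cons]
    have h4 : D.mTerm en (cut la τ φ) z L
        = cut la (fun u => D.mTerm (0 : Option X → Y →ₗ[k] Y) τ z u) φ L := by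
      cases L with
      | nil => simp
      | cons z' L => simp [cut_cons]
    rw [h2, h3, h4]
    simp [bar_cons, sbar]
    abel

theorem sbar_map (f : X →ₗ[k] Y) (he : ∀ x, f (D.eps x) = B.eps (f x)) (φ : List (Option Y) → M)
    (L : List (Option X)) :
    B.sbar φ (L.map (Option.map f)) = D.sbar (fun u => φ (u.map (Option.map f))) L := by
  have h : B.oeps ∘ Option.map f = Option.map f ∘ D.oeps := by
    funext z
    cases z <;> simp [he]
  simp [sbar, h]

/-- Naturality of the bar differential. -/
theorem bar_map (f : X →ₗ[k] Y) (hd : ∀ x, f (D.d x) = B.d (f x))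
    (he : ∀ x, f (D.eps x) = B.eps (f x)) (hm : ∀ x y, f (D.mul x y) = B.mul (f x) (f y))
    {en : Option Y → M →ₗ[k] M} (φ : List (Option Y) → M) (L : List (Option X)) :
    B.bar en φ (L.map (Option.map f)) =
      D.bar (fun z => en (z.map f)) (fun u => φ (u.map (Option.map f))) L := by
  have h : ∀ z, B.oeps (Option.map f z) = Option.map f (D.oeps z) := by
    intro z
    cases z <;> simp [he]
  have h' : ∀ z z', B.omul (Option.map f z) (Option.map f z') = Option.map f (D.omul z z') := by
    intro z z'
    cases z <;> cases z' <;> simp [hm]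
  induction L generalizing φ with
  | nil => rfl
  | cons z L ih =>
    simp only [List.map_cons, bar_cons, ih, h]
    congr 1
    congr 1
    · cases z <;> simp [hd]
    · cases L <;> simp [h, h']

end ParityDga

theorem IsMulti.cut {α : Type*} [AddCommGroup α] [Module k α] {Y : Type*} [AddCommGroup Y]
    [Module k Y] {la : Y →ₗ[k] N →ₗ[k] M} {τ : List (Option α) → Y} {φ : List (Option α) → N}
    (h : IsMulti k τ) (h' : IsMulti k φ) : IsMulti k (cut la τ φ) := by
  have main : ∀ L₁ : List (Option α), ∀ τ : List (Option α) → Y, IsMulti k τ →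
      (∀ L₂ x y, WeaklyUnital.cut la τ φ (L₁ ++ some (x + y) :: L₂) =
        WeaklyUnital.cut la τ φ (L₁ ++ some x :: L₂) +
          WeaklyUnital.cut la τ φ (L₁ ++ some y :: L₂)) ∧
      (∀ L₂ (c : k) x, WeaklyUnital.cut la τ φ (L₁ ++ some (c • x) :: L₂) =
        c • WeaklyUnital.cut la τ φ (L₁ ++ some x :: L₂)) := by
    intro L₁
    induction L₁ with
    | nil =>
      intro τ hτ
      refine ⟨fun L₂ x y => ?_, fun L₂ c x => ?_⟩
      · simp only [List.nil_append, cut_cons, hτ.add_head, map_add, LinearMap.add_apply,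
          cut_add_left]
        abel
      · simp only [List.nil_append, cut_cons, hτ.smul_head, map_smul, LinearMap.smul_apply,
          cut_smul_left, smul_add]
    | cons z L₁ ih =>
      intro τ hτ
      have ih' := ih _ (hτ.cons z)
      refine ⟨fun L₂ x y => ?_, fun L₂ c x => ?_⟩
      · simp only [List.cons_append, cut_cons, ih'.1, h'.add, map_add]; abel
      · simp only [List.cons_append, cut_cons, ih'.2, h'.smul, map_smul, smul_add]
  exact ⟨fun L₁ L₂ x y => (main L₁ τ h).1 L₂ x y, fun L₁ L₂ c x => (main L₁ τ h).2 L₂ c x⟩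

end Words
end WeaklyUnital

namespace WeaklyUnital

/-! ### Weakly unital algebras as twisting cochains -/

/-- An algebra over the operad `𝒪`, written as a twisting cochain. With
`τ (z₁, …, zₙ) = pₙ (ε^(n-1) z₁, …, ε zₙ₋₁, zₙ)`, where `z = none` is the formal unit, all the signs
in the formula for `d pₙ` are absorbed by the parity operator and the formula becomes the
Maurer-Cartan equation `d_τ`. That `j` is a closed even idempotent is a consequence. -/
structure WeakAlg (k : Type*) (X : Type*) [Field k] [AddCommGroup X] [Module k X] extends
    ParityDga k X where
  j : X
  τ : List (Option X) → X
  multi : IsMulti k τ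
  τ_nil : τ [] = 0
  τ_some : ∀ x, τ [some x] = x
  τ_none : τ [none] = j
  τ_replicate_none : ∀ n, 2 ≤ n → τ (List.replicate n none) = 0
  τ_map_some : ∀ L : List X, 2 ≤ L.length → τ (L.map some) = 0
  eps_τ : ∀ z, eps (τ z) = -toParityDga.sbar τ z
  d_τ : ∀ z, d (τ z) = toParityDga.bar 0 τ z + cut mul (toParityDga.sbar τ) τ z

namespace WeakAlg

open ParityDga

variable {k : Type*} [Field k] {A : Type*} [AddCommGroup A] [Module k A] (W : WeakAlg k A)

theorem eps_j : W.eps W.j = W.j := by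
  simpa [sbar, W.τ_none] using W.eps_τ [none]

theorem d_j : W.d W.j = 0 := by
  simpa [bar_cons, cut_cons, W.τ_none, W.τ_nil] using W.d_τ [none]

theorem mul_j_j : W.mul W.j W.j = W.j := by
  have h0 : W.τ [none, none] = 0 := W.τ_replicate_none 2 le_rfl
  have h := W.d_τ [none, none]
  simp only [h0, bar_cons, cut_cons, W.τ_none, W.τ_nil, sbar] at h
  simp [W.τ_none] at h
  exact (sub_eq_zero.mp (by rw [sub_eq_add_neg]; exact h.symm)).symm

end WeakAlg

/-! ### The path algebra -/

section Path

open ParityDga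

variable {k : Type*} [Field k] {A : Type*} [AddCommGroup A] [Module k A]
  {S : Type*} [CommRing S] [Algebra k S]

/-- A linear function as a linear map; zero if the function is not linear. -/
noncomputable def lin {N N' : Type*} [AddCommGroup N] [Module k N] [AddCommGroup N'] [Module k N']
    (f : N → N') : N →ₗ[k] N' :=
  open Classical in if h : IsLinearMap k f then h.mk' f else 0

theorem lin_apply {N N' : Type*} [AddCommGroup N] [Module k N] [AddCommGroup N'] [Module k N']
    {f : N → N'} (h : IsLinearMap k f) (x : N) : lin (k := k) f x = f x := by
  rw [lin, dif_pos h]; rfl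

/-- The linear map given by the values of `ψ` on one-letter words. -/
noncomputable def single (ψ : List (Option A) → A) : A →ₗ[k] A := lin fun y => ψ [some y]

theorem single_apply {ψ : List (Option A) → A} (h : IsMulti k ψ) (y : A) :
    single (k := k) ψ y = ψ [some y] :=
  lin_apply ⟨fun x y => h.add_head [] x y, fun c x => h.smul_head [] c x⟩ y

/-- An even closed linear map `ι` from a commutative algebra `S` (in degree zero) to a weakly unital
algebra, whose image is fixed by the left multiplication with `j`. -/
structure BasePoint (W : WeakAlg k A) (S : Type*) [CommRing S] [Algebra k S] where
  ι : S →ₗ[k] A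
  d_ι : ∀ x, W.d (ι x) = 0
  eps_ι : ∀ x, W.eps (ι x) = ι x
  j_ι : ∀ x, W.mul W.j (ι x) = ι x

variable (W : WeakAlg k A)

/-- Left multiplication of linear maps with values in `A` by elements of `A`. -/
def lmul (S : Type*) [CommRing S] [Algebra k S] : A →ₗ[k] (S →ₗ[k] A) →ₗ[k] (S →ₗ[k] A) :=
  LinearMap.llcomp k S A A ∘ₗ W.mul

@[simp] theorem lmul_apply (a : A) (ψ : S →ₗ[k] A) (x : S) : lmul W S a ψ x = W.mul a (ψ x) := rfl

/-- Precomposition of linear maps with the multiplications of `S`. -/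
def rmul (k A S : Type*) [Field k] [AddCommGroup A] [Module k A] [CommRing S] [Algebra k S] :
    (S →ₗ[k] A) →ₗ[k] S →ₗ[k] (S →ₗ[k] A) :=
  LinearMap.mk₂ k (fun ψ s => ψ ∘ₗ LinearMap.mulLeft k s)
    (fun _ _ _ => rfl) (fun _ _ _ => rfl)
    (fun ψ s s' => by ext x; simp [add_mul])
    (fun c ψ s => by ext x; simp)

@[simp] theorem rmul_apply (s : S) (ψ : S →ₗ[k] A) (x : S) :
    rmul k A S ψ s x = ψ (s * x) := rfl

/-- The underlying space of the path algebra: triples `(a, s, h)` of an element `a` of `A`, an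
element `s` of `S`, and a homotopy `h` between the left multiplication of the base point by `a` and
its precomposition with `s`. -/
abbrev Path (k A S : Type*) [Field k] [AddCommGroup A] [Module k A] [CommRing S] [Algebra k S] :=
  A × S × (S →ₗ[k] A)

variable {W} (b : BasePoint W S)

/-- The differential algebra of triples `(a, s, h)`: endomorphisms of the mapping cone of `ι` that
preserve its filtration, the action of `s` being by multiplication on `S`. -/
def pathDga : ParityDga k (Path k A S) where
  eps :=
    { toFun := fun e => (W.eps e.1, e.2.1, -(W.eps ∘ₗ e.2.2))
      map_add' := fun e e' => by
        ext <;> simp; abel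
      map_smul' := fun c e => by ext <;> simp }
  d :=
    { toFun := fun e => (W.d e.1, 0, lmul W S e.1 b.ι - rmul k A S b.ι e.2.1 - W.d ∘ₗ e.2.2)
      map_add' := fun e e' => by
        ext <;> simp; abel
      map_smul' := fun c e => by ext <;> simp [smul_sub] }
  mul := LinearMap.mk₂ k
    (fun e e' => (W.mul e.1 e'.1, e.2.1 * e'.2.1,
      lmul W S (W.eps e.1) e'.2.2 + rmul k A S e.2.2 e'.2.1))
    (fun e e' f => by ext <;> simp [add_mul]; abel)
    (fun c e f => by ext <;> simp)
    (fun e e' f => by ext <;> simp [mul_add]; abel)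
    (fun c e f => by ext <;> simp)
  eps_eps e := by
    ext <;> simp [W.eps_eps]
  d_d e := by
    ext <;> simp [W.d_d, W.d_mul, b.d_ι]
  d_eps e := by
    ext <;> simp [W.d_eps, W.eps_mul, b.eps_ι]; abel
  eps_mul e e' := by
    ext <;> simp [W.eps_mul]; abel
  mul_assoc e f g := by
    ext <;> simp [W.mul_assoc, _root_.mul_assoc, W.eps_mul]; abel
  d_mul e f := by
    ext <;> simp [W.d_mul, W.eps_eps, W.d_eps, W.mul_assoc, _root_.mul_assoc]; abel

@[simp] theorem pathDga_eps (e : Path k A S) :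
    (pathDga b).eps e = (W.eps e.1, e.2.1, -(W.eps ∘ₗ e.2.2)) := rfl

@[simp] theorem pathDga_d (e : Path k A S) : (pathDga b).d e =
    (W.d e.1, 0, lmul W S e.1 b.ι - rmul k A S b.ι e.2.1 - W.d ∘ₗ e.2.2) := rfl

@[simp] theorem pathDga_mul (e e' : Path k A S) : (pathDga b).mul e e' =
    (W.mul e.1 e'.1, e.2.1 * e'.2.1,
      lmul W S (W.eps e.1) e'.2.2 + rmul k A S e.2.2 e'.2.1) := rfl

/-- Precomposition with the multiplication by the `S`-component of a letter. -/
def endTerm (k A S : Type*) [Field k] [AddCommGroup A] [Module k A] [CommRing S] [Algebra k S] :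
    Option (Path k A S) → (S →ₗ[k] A) →ₗ[k] (S →ₗ[k] A)
  | none => LinearMap.id
  | some e => (rmul k A S).flip e.2.1

@[simp] theorem endTerm_none (ψ : S →ₗ[k] A) : endTerm k A S none ψ = ψ := rfl

@[simp] theorem endTerm_some (e : Path k A S) (ψ : S →ₗ[k] A) :
    endTerm k A S (some e) ψ = rmul k A S ψ e.2.1 := rfl

/-- The first projection of words over the path algebra. -/
def toBase (L : List (Option (Path k A S))) : List (Option A) := L.map (Option.map Prod.fst)

@[simp] theorem toBase_nil : toBase ([] : List (Option (Path k A S))) = [] := rfl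

@[simp] theorem toBase_cons (z : Option (Path k A S)) (L) :
    toBase (z :: L) = z.map Prod.fst :: toBase L := rfl

theorem bar_toBase {M : Type*} [AddCommGroup M] [Module k M] (φ : List (Option A) → M) (L) :
    W.bar 0 φ (toBase L) = (pathDga b).bar 0 (fun u => φ (toBase u)) L :=
  bar_map (D := pathDga b) (B := W.toParityDga) (LinearMap.fst k A (S × (S →ₗ[k] A)))
    (fun _ => rfl) (fun _ => rfl) (fun _ _ => rfl) φ L

theorem sbar_toBase {M : Type*} [AddCommGroup M] [Module k M] (φ : List (Option A) → M) (L) :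
    W.sbar φ (toBase L) = (pathDga b).sbar (fun u => φ (toBase u)) L :=
  sbar_map (D := pathDga b) (B := W.toParityDga) (LinearMap.fst k A (S × (S →ₗ[k] A)))
    (fun _ => rfl) φ L

/-- The contribution of a last letter `(a, s, h)` to `tail`. -/
noncomputable def hTerm (ψ : List (Option A) → A) :
    Option (Path k A S) → List (Option (Path k A S)) → (S →ₗ[k] A)
  | some e, [] => single ψ ∘ₗ e.2.2
  | _, _ => 0

/-- The homotopy obtained by inserting base points: up to signs, `tail ψ (z₁ … zₙ) x` is
`ψ (z₁, …, zₙ, ι x) + ψ (z₁, …, zₙ₋₁, hₙ x)`, where `hₙ` is the homotopy contained in `zₙ` (zero for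
a formal unit). -/
noncomputable def tail : (List (Option A) → A) → List (Option (Path k A S)) → (S →ₗ[k] A)
  | ψ, [] => single ψ ∘ₗ b.ι
  | ψ, z :: L => hTerm ψ z L - tail (fun u => ψ (W.oeps (z.map Prod.fst) :: u)) L

@[simp] theorem hTerm_none (ψ : List (Option A) → A) (L : List (Option (Path k A S))) :
    hTerm ψ none L = 0 := by cases L <;> rfl

@[simp] theorem hTerm_cons (ψ : List (Option A) → A) (z z' : Option (Path k A S)) (L) :
    hTerm ψ z (z' :: L) = 0 := by cases z <;> rfl

@[simp] theorem hTerm_some_nil (ψ : List (Option A) → A) (e : Path k A S) :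
    hTerm ψ (some e) [] = single ψ ∘ₗ e.2.2 := rfl

@[simp] theorem tail_nil (ψ : List (Option A) → A) : tail b ψ [] = single ψ ∘ₗ b.ι := rfl

theorem tail_cons (ψ : List (Option A) → A) (z L) : tail b ψ (z :: L) =
    hTerm ψ z L - tail b (fun u => ψ (W.oeps (z.map Prod.fst) :: u)) L := rfl

@[simp] theorem map_fst_oeps (z : Option (Path k A S)) :
    ((pathDga b).oeps z).map Prod.fst = W.oeps (z.map Prod.fst) := by cases z <;> rfl

@[simp] theorem map_fst_omul (z z' : Option (Path k A S)) :
    ((pathDga b).omul z z').map Prod.fst = W.omul (z.map Prod.fst) (z'.map Prod.fst) := by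
  cases z <;> cases z' <;> rfl

theorem single_add {ψ ψ' : List (Option A) → A} (h : IsMulti k ψ) (h' : IsMulti k ψ') :
    single (k := k) (fun u => ψ u + ψ' u) = single ψ + single ψ' := by
  ext y
  simp [single_apply, h, h', h.fun_add h']

theorem single_map {ψ : List (Option A) → A} (h : IsMulti k ψ) (f : A →ₗ[k] A) :
    single (k := k) (fun u => f (ψ u)) = f ∘ₗ single ψ := by
  ext y
  simp [single_apply, h, h.map f]

theorem tail_add {ψ ψ' : List (Option A) → A} (h : IsMulti k ψ) (h' : IsMulti k ψ') (L) :
    tail b (fun u => ψ u + ψ' u) L = tail b ψ L + tail b ψ' L := by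
  induction L generalizing ψ ψ' with
  | nil => simp [single_add h h', LinearMap.add_comp]
  | cons z L ih =>
    rw [tail_cons, ih (h.cons _) (h'.cons _), tail_cons, tail_cons]
    rcases z with _ | e
    · simp; abel
    · cases L with
      | nil => simp [single_add h h', LinearMap.add_comp]; abel
      | cons z L => simp; abel

theorem tail_map {ψ : List (Option A) → A} (h : IsMulti k ψ) (f : A →ₗ[k] A) (L) :
    tail b (fun u => f (ψ u)) L = f ∘ₗ tail b ψ L := by
  induction L generalizing ψ with
  | nil => simp [single_map h, LinearMap.comp_assoc]
  | cons z L ih =>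
    rw [tail_cons, ih (h.cons _), tail_cons, LinearMap.comp_sub]
    rcases z with _ | e
    · simp
    · cases L with
      | nil => simp [single_map h, LinearMap.comp_assoc]
      | cons z L => simp

theorem tail_neg {ψ : List (Option A) → A} (h : IsMulti k ψ) (L) :
    tail b (fun u => -ψ u) L = -tail b ψ L := by
  have := tail_map b h (-LinearMap.id) L
  simpa [LinearMap.neg_comp] using this

theorem tail_sub {ψ ψ' : List (Option A) → A} (h : IsMulti k ψ) (h' : IsMulti k ψ') (L) :
    tail b (fun u => ψ u - ψ' u) L = tail b ψ L - tail b ψ' L := by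
  simp only [sub_eq_add_neg]
  rw [tail_add b h h'.fun_neg, tail_neg b h']

theorem isMulti_bar_zero {X M : Type*} [AddCommGroup X] [Module k X] [AddCommGroup M] [Module k M]
    {D : ParityDga k X} {φ : List (Option X) → M} (h : IsMulti k φ) : IsMulti k (D.bar 0 φ) :=
  isMulti_bar (by simp) (by simp) h

theorem isMulti_mTerm_zero {X M : Type*} [AddCommGroup X] [Module k X] [AddCommGroup M]
    [Module k M] {D : ParityDga k X} {φ : List (Option X) → M} (h : IsMulti k φ) (z) :
    IsMulti k fun L => D.mTerm (0 : Option X → M →ₗ[k] M) φ z L := by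
  refine IsMulti.of_cons (fun L x y => ?_) (fun L c x => ?_) fun z' => ?_
  · simpa using omul_some_add _ _ _ h L
  · simpa using omul_some_smul _ _ _ h L
  · simpa using h.cons _

/-- The tail construction anticommutes with the bar differentials: inserting base points and their
homotopies is a map of bar complexes. -/
theorem bar_tail {ψ : List (Option A) → A} (h : IsMulti k ψ) (L) :
    (pathDga b).bar (endTerm k A S) (tail b ψ) L = -tail b (W.bar 0 ψ) L := by
  induction L generalizing ψ with
  | nil =>
    ext x
    simp [single_apply (isMulti_bar_zero h), bar_cons, b.d_ι, h.zero_head]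
  | cons z L ih =>
    have e1 : (fun L' => tail b ψ ((pathDga b).oeps z :: L')) = fun L' =>
        hTerm ψ ((pathDga b).oeps z) L' - tail b (fun u => ψ (z.map Prod.fst :: u)) L' := by
      funext L'
      rw [tail_cons, map_fst_oeps, oeps_oeps]
    have e2 : tail b (fun u => W.bar 0 ψ (W.oeps (z.map Prod.fst) :: u)) L =
        tail b (fun u => W.dTerm ψ (W.oeps (z.map Prod.fst)) u) L
        + tail b (fun u => W.mTerm 0 ψ (W.oeps (z.map Prod.fst)) u) L
        - tail b (W.bar 0 fun u => ψ (z.map Prod.fst :: u)) L := by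
      simp only [bar_cons ψ, oeps_oeps]
      rw [tail_sub b ((isMulti_dTerm h _).fun_add (isMulti_mTerm_zero h _))
          (isMulti_bar_zero (h.cons _)), tail_add b (isMulti_dTerm h _) (isMulti_mTerm_zero h _)]
    rw [bar_cons, e1, bar_sub, ih (h.cons _), tail_cons, e2]
    have e3 : (pathDga b).dTerm (tail b ψ) z L =
        z.elim 0 (fun e => hTerm ψ (some ((pathDga b).d e)) L)
        + tail b (fun u => W.dTerm ψ (W.oeps (z.map Prod.fst)) u) L := by
      rcases z with _ | e
      · have h0 : tail b (fun _ => 0) L = 0 := by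
          have := tail_map b (IsMulti.fun_zero (k := k) (X := A) (M := A)) 0 L
          simpa using this
        simp [h0]
      · have := tail_neg b (h.cons (some (W.eps (W.d e.1)))) L
        simp only [dTerm_some, tail_cons, Option.elim_some, Option.map_some, oeps_some,
          W.d_eps, h.neg_head, this, pathDga_d]
        abel
    rw [e3]
    cases L with
    | nil =>
      rcases z with _ | e
      · ext x
        simp [single_apply h, single_apply (isMulti_mTerm_zero h _)]
      · ext x
        simp [single_apply h, single_apply (isMulti_bar_zero h), bar_cons,
          single_apply (isMulti_mTerm_zero h _), W.eps_eps, h.sub_head]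
        abel
    | cons z' L =>
      have e4 : tail b ψ ((pathDga b).omul ((pathDga b).oeps z) z' :: L)
          = hTerm ψ ((pathDga b).omul ((pathDga b).oeps z) z') L
            - tail b (fun u => ψ (W.omul (z.map Prod.fst) (W.oeps (z'.map Prod.fst)) :: u)) L := by
        rw [tail_cons, map_fst_omul, map_fst_oeps, oeps_omul, oeps_oeps]
      have e5 : tail b (fun u => W.mTerm 0 ψ (W.oeps (z.map Prod.fst)) u) (z' :: L)
          = hTerm (fun u => W.mTerm 0 ψ (W.oeps (z.map Prod.fst)) u) z' L
            - tail b (fun u => ψ (W.omul (z.map Prod.fst) (W.oeps (z'.map Prod.fst)) :: u)) L := by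
        rw [tail_cons]
        simp
      have e6 : ∀ w : Option (Path k A S), z.elim 0 (fun e => hTerm ψ (some ((pathDga b).d e))
          (w :: L)) = 0 := by
        intro w
        cases z <;> simp
      have e7 : (pathDga b).bar (endTerm k A S) (hTerm ψ ((pathDga b).oeps z)) (z' :: L)
          = (match L with
            | [] => endTerm k A S z' (hTerm ψ ((pathDga b).oeps z) [])
            | _ :: _ => 0) := by
        have : (fun L' => hTerm ψ ((pathDga b).oeps z) ((pathDga b).oeps z' :: L')) = fun _ => 0 :=
          funext fun L' => by simp
        rw [bar_cons, this]
        cases z' <;> cases L <;> simp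
      rw [e5, e6, e7, mTerm_cons, e4, hTerm_cons]
      cases L with
      | nil =>
        rcases z with _ | e <;> rcases z' with _ | e' <;> ext x <;>
          simp [single_apply h, single_apply (isMulti_mTerm_zero h _), W.eps_eps, h.neg_head,
            h.add_head]
        all_goals abel
      | cons z'' L =>
        simp

end Path
end WeaklyUnital

namespace WeaklyUnital

/-! ### Twisted module maps over the path algebra -/

section Path

open ParityDga

variable {k : Type*} [Field k] {A : Type*} [AddCommGroup A] [Module k A]
  {S : Type*} [CommRing S] [Algebra k S] {W : WeakAlg k A} (b : BasePoint W S)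

/-- Composition with a linear endomorphism of `A`, on linear maps with values in `A`. -/
def post (S : Type*) [CommRing S] [Algebra k S] (f : A →ₗ[k] A) :
    (S →ₗ[k] A) →ₗ[k] (S →ₗ[k] A) := LinearMap.llcomp k S A A f

@[simp] theorem post_apply (f : A →ₗ[k] A) (ψ : S →ₗ[k] A) (x : S) : post S f ψ x = f (ψ x) := rfl

/-- The twisting cochain of `A`, evaluated on the first components of words over the path
algebra. -/
def baseτ (_ : BasePoint W S) (L : List (Option (Path k A S))) : A := W.τ (toBase L)

theorem isMulti_baseτ : IsMulti k (baseτ b) :=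
  W.multi.comp_map (LinearMap.fst k A (S × (S →ₗ[k] A)))

theorem d_baseτ (L) : W.d (baseτ b L) =
    (pathDga b).bar 0 (baseτ b) L + cut W.mul ((pathDga b).sbar (baseτ b)) (baseτ b) L := by
  have h : ∀ u, W.sbar W.τ (toBase u) = (pathDga b).sbar (baseτ b) u := sbar_toBase b W.τ
  rw [baseτ, W.d_τ, bar_toBase b]
  congr 1
  exact (cut_map _ _ _ L).trans (cut_congr_left (fun u _ => h u) _ L)

theorem eps_baseτ (L) : W.eps (baseτ b L) = -(pathDga b).sbar (baseτ b) L := by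
  rw [baseτ, W.eps_τ, sbar_toBase b]; rfl

theorem tail_cut {σ φ : List (Option A) → A} (h : IsMulti k σ) (h' : IsMulti k φ) (h0 : φ [] = 0)
    (L) : tail b (cut W.mul σ φ) L =
      cut (lmul W S) (fun u => W.sbar σ (toBase u)) (tail b φ) L := by
  induction L generalizing σ with
  | nil =>
    ext x
    simp [single_apply (h.cut h'), cut_cons, h0]
  | cons z L ih =>
    have e1 : hTerm (S := S) (cut W.mul σ φ) z L = 0 := by
      cases z <;> cases L <;> ext x <;> simp [single_apply (h.cut h'), cut_cons, h0]
    have e2 : (fun u => W.sbar σ (toBase (z :: u))) = fun u =>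
        -W.sbar (fun v => σ (W.oeps (z.map Prod.fst) :: v)) (toBase u) := by
      funext u
      rw [toBase_cons, sbar_cons]
    rw [tail_cons, e1, cut_cons, e2, cut_neg_left, ← ih (h.cons _)]
    simp only [cut_cons]
    rw [tail_add b (h'.map _) ((h.cons _).cut h'), tail_map b h']
    ext x
    simp [sbar]
    abel

/-- The tail of the twisting cochain is a map of twisted modules. -/
theorem d_tail (L) : post S W.d (tail b W.τ L) =
    -(pathDga b).bar (endTerm k A S) (tail b W.τ) L +
      cut (lmul W S) (baseτ b) (tail b W.τ) L := by
  have h1 : post S W.d (tail b W.τ L) = tail b (fun u => W.d (W.τ u)) L :=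
    (tail_map b W.multi W.d L).symm
  rw [h1]
  simp only [W.d_τ]
  rw [tail_add b (isMulti_bar_zero W.multi) ((isMulti_sbar W.multi).cut W.multi),
    tail_cut b (isMulti_sbar W.multi) W.multi W.τ_nil, bar_tail b W.multi, neg_neg, sbar_sbar]
  rfl

theorem tail_sbar {ψ : List (Option A) → A} (h : IsMulti k ψ) (L) :
    tail b (W.sbar ψ) L = -(pathDga b).sbar (tail b ψ) L := by
  induction L generalizing ψ with
  | nil =>
    ext x
    simp [single_apply h, single_apply (isMulti_sbar h), sbar, b.eps_ι]
  | cons z L ih =>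
    have e1 : (fun u => W.sbar ψ (W.oeps (z.map Prod.fst) :: u)) =
        fun u => -W.sbar (fun v => ψ (z.map Prod.fst :: v)) u := by
      funext u
      rw [sbar_cons, oeps_oeps]
    have e2 : (fun u => tail b ψ ((pathDga b).oeps z :: u)) = fun u =>
        hTerm ψ ((pathDga b).oeps z) u + -tail b (fun v => ψ (z.map Prod.fst :: v)) u := by
      funext u
      rw [tail_cons, map_fst_oeps, oeps_oeps, sub_eq_add_neg]
    rw [tail_cons, e1, tail_neg b (isMulti_sbar (h.cons _)), ih (h.cons _), sbar_cons, e2,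
      sbar_add, sbar_neg]
    cases z <;> cases L <;> ext x <;>
      simp [single_apply h, single_apply (isMulti_sbar h), sbar, sub_eq_add_neg]

theorem eps_tail (L) : post S W.eps (tail b W.τ L) = (pathDga b).sbar (tail b W.τ) L := by
  have h1 : post S W.eps (tail b W.τ L) = tail b (fun u => W.eps (W.τ u)) L :=
    (tail_map b W.multi W.eps L).symm
  rw [h1]
  simp only [W.eps_τ]
  rw [tail_neg b (isMulti_sbar W.multi), tail_sbar b W.multi, neg_neg]

theorem tail_smul {ψ : List (Option A) → A} (h : IsMulti k ψ) (c : k) (L) :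
    tail b (fun u => c • ψ u) L = c • tail b ψ L :=
  tail_map b h (LinearMap.lsmul k A c) L

theorem isMulti_tail {ψ : List (Option A) → A} (h : IsMulti k ψ) : IsMulti k (tail b ψ) := by
  have main : ∀ L₁ : List (Option (Path k A S)), ∀ ψ : List (Option A) → A, IsMulti k ψ →
      (∀ L₂ x y, tail b ψ (L₁ ++ some (x + y) :: L₂) =
        tail b ψ (L₁ ++ some x :: L₂) + tail b ψ (L₁ ++ some y :: L₂)) ∧
      (∀ L₂ (c : k) x, tail b ψ (L₁ ++ some (c • x) :: L₂) =
        c • tail b ψ (L₁ ++ some x :: L₂)) := by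
    intro L₁
    induction L₁ with
    | nil =>
      intro ψ hψ
      refine ⟨fun L₂ x y => ?_, fun L₂ c x => ?_⟩
      · simp only [List.nil_append, tail_cons, Option.map_some, oeps_some, Prod.fst_add, map_add,
          hψ.add_head]
        rw [tail_add b (hψ.cons _) (hψ.cons _)]
        cases L₂
        · simp [LinearMap.comp_add]; abel
        · simp; abel
      · simp only [List.nil_append, tail_cons, Option.map_some, oeps_some, Prod.smul_fst, map_smul,
          hψ.smul_head]
        rw [tail_smul b (hψ.cons _)]
        cases L₂ <;> simp [LinearMap.comp_smul, smul_sub]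
    | cons z L₁ ih =>
      intro ψ hψ
      have ih' := ih _ (hψ.cons (W.oeps (z.map Prod.fst)))
      have hT : ∀ w (L₂ : List (Option (Path k A S))), hTerm ψ z (L₁ ++ w :: L₂) = 0 := by
        intro w L₂
        cases L₁ <;> simp
      refine ⟨fun L₂ x y => ?_, fun L₂ c x => ?_⟩
      · simp only [List.cons_append, tail_cons, ih'.1, hT]; abel
      · simp only [List.cons_append, tail_cons, ih'.2, hT, zero_sub, smul_neg]
  exact ⟨fun L₁ L₂ x y => (main L₁ ψ h).1 L₂ x y, fun L₁ L₂ c x => (main L₁ ψ h).2 L₂ c x⟩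

/-- The boundary of `G` in the complex of functions of words with values in `S →ₗ[k] A`, with the
differential twisted by the cochain of `A`; adding it changes a twisted module map by a
homotopy. -/
def gauge (G : List (Option (Path k A S)) → (S →ₗ[k] A)) (L : List (Option (Path k A S))) :
    S →ₗ[k] A :=
  post S W.d (G L) - (pathDga b).bar (endTerm k A S) G L -
    cut (lmul W S) ((pathDga b).sbar (baseτ b)) G L

theorem endTerm_oeps (z : Option (Path k A S)) :
    endTerm k A S ((pathDga b).oeps z) = endTerm k A S z := by cases z <;> rfl

theorem endTerm_omul (z z' : Option (Path k A S)) (ψ : S →ₗ[k] A) :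
    endTerm k A S ((pathDga b).omul z z') ψ = endTerm k A S z' (endTerm k A S z ψ) := by
  cases z <;> cases z' <;> ext x <;> simp [_root_.mul_assoc]

theorem endTerm_d (e : Path k A S) : endTerm k A S (some ((pathDga b).d e)) = 0 := by
  ext ψ x
  simp

theorem endTerm_post (f : A →ₗ[k] A) (z : Option (Path k A S)) (ψ : S →ₗ[k] A) :
    post S f (endTerm k A S z ψ) = endTerm k A S z (post S f ψ) := by
  cases z <;> rfl

theorem endTerm_lmul (z : Option (Path k A S)) (a : A) (ψ : S →ₗ[k] A) :
    endTerm k A S z (lmul W S a ψ) = lmul W S a (endTerm k A S z ψ) := by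
  cases z <;> rfl

theorem isMulti_bar_endTerm {G : List (Option (Path k A S)) → (S →ₗ[k] A)} (h : IsMulti k G) :
    IsMulti k ((pathDga b).bar (endTerm k A S) G) :=
  isMulti_bar (fun x y v => by simp) (fun c x v => by simp) h

theorem isMulti_gauge {G : List (Option (Path k A S)) → (S →ₗ[k] A)} (h : IsMulti k G) :
    IsMulti k (gauge b G) :=
  ((h.map _).fun_sub (isMulti_bar_endTerm b h)).fun_sub
    ((isMulti_sbar (isMulti_baseτ b)).cut h)

theorem lmul_mul (a a' : A) (ψ : S →ₗ[k] A) :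
    lmul W S (W.mul a a') ψ = lmul W S a (lmul W S a' ψ) := by
  ext x
  simp [W.mul_assoc]

theorem post_d_lmul (a : A) (ψ : S →ₗ[k] A) : post S W.d (lmul W S a ψ) =
    lmul W S (W.d a) ψ + lmul W S (W.eps a) (post S W.d ψ) := by
  ext x
  simp [W.d_mul]

theorem post_eps_lmul (a : A) (ψ : S →ₗ[k] A) : post S W.eps (lmul W S a ψ) =
    lmul W S (W.eps a) (post S W.eps ψ) := by
  ext x
  simp [W.eps_mul]

theorem d_sbar_baseτ (L) : W.d ((pathDga b).sbar (baseτ b) L) =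
    -(pathDga b).bar 0 ((pathDga b).sbar (baseτ b)) L +
      cut W.mul (baseτ b) ((pathDga b).sbar (baseτ b)) L := by
  rw [map_sbar]
  simp only [d_baseτ]
  rw [sbar_add, bar_sbar (fun _ => rfl) (isMulti_baseτ b), neg_neg, sbar_cut, sbar_sbar]

theorem eps_sbar_baseτ (L) : W.eps ((pathDga b).sbar (baseτ b) L) = -baseτ b L := by
  rw [map_sbar]
  simp only [eps_baseτ]
  rw [sbar_neg, sbar_sbar]

/-- A boundary in the complex of twisted module maps is a twisted module map. -/
theorem d_gauge {G : List (Option (Path k A S)) → (S →ₗ[k] A)} (hG : IsMulti k G) (L) :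
    post S W.d (gauge b G L) = -(pathDga b).bar (endTerm k A S) (gauge b G) L +
      cut (lmul W S) (baseτ b) (gauge b G) L := by
  have e0 : post S W.d (post S W.d (G L)) = 0 := by
    ext x
    simp [W.d_d]
  have e1 : post S W.d ((pathDga b).bar (endTerm k A S) G L) =
      (pathDga b).bar (endTerm k A S) (fun u => post S W.d (G u)) L :=
    map_bar _ (fun z y => endTerm_post _ z y) G L
  have e2 : post S W.d (cut (lmul W S) ((pathDga b).sbar (baseτ b)) G L) =
      -cut (lmul W S) ((pathDga b).bar 0 ((pathDga b).sbar (baseτ b))) G L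
      + cut (lmul W S) (cut W.mul (baseτ b) ((pathDga b).sbar (baseτ b))) G L
      - cut (lmul W S) (baseτ b) (fun u => post S W.d (G u)) L := by
    rw [d_cut (la := lmul W S) post_d_lmul]
    simp only [d_sbar_baseτ, eps_sbar_baseτ]
    rw [cut_add_left, cut_neg_left, cut_neg_left, sub_eq_add_neg]
  have e3 : (pathDga b).bar (endTerm k A S) (gauge b G) L =
      (pathDga b).bar (endTerm k A S) (fun u => post S W.d (G u)) L
      - cut (lmul W S) ((pathDga b).bar 0 ((pathDga b).sbar (baseτ b))) G L
      - cut (lmul W S) (baseτ b) ((pathDga b).bar (endTerm k A S) G) L := by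
    have h := bar_cut (D := pathDga b) (en := endTerm k A S) (la := lmul W S) endTerm_lmul
      ((pathDga b).sbar (baseτ b)) G L
    have h' := bar_bar (D := pathDga b) (endTerm_d b) (endTerm_oeps b) (endTerm_omul b) hG L
    rw [sbar_sbar] at h
    unfold gauge
    rw [bar_sub, bar_sub, h, h']
    abel
  have e4 : cut (lmul W S) (baseτ b) (gauge b G) L =
      cut (lmul W S) (baseτ b) (fun u => post S W.d (G u)) L
      - cut (lmul W S) (baseτ b) ((pathDga b).bar (endTerm k A S) G) L
      - cut (lmul W S) (cut W.mul (baseτ b) ((pathDga b).sbar (baseτ b))) G L := by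
    have h : (pathDga b).sbar (baseτ b) [] = 0 := by simp [baseτ, W.τ_nil]
    rw [← cut_cut (la := lmul W S) (mul := W.mul) lmul_mul _ _ h]
    unfold gauge
    simp only [sub_eq_add_neg]
    rw [cut_add_right, cut_add_right, cut_neg_right, cut_neg_right]
  rw [e3, e4, gauge, map_sub, map_sub, e0, e1, e2]
  abel

theorem eps_gauge {G : List (Option (Path k A S)) → (S →ₗ[k] A)} (hG : IsMulti k G)
    (h : ∀ L, post S W.eps (G L) = -(pathDga b).sbar G L) (L) :
    post S W.eps (gauge b G L) = (pathDga b).sbar (gauge b G) L := by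
  have e0 : post S W.eps (post S W.d (G L)) = (pathDga b).sbar (fun u => post S W.d (G u)) L := by
    have : post S W.eps (post S W.d (G L)) = -post S W.d (post S W.eps (G L)) := by
      ext x
      simp [W.d_eps]
    rw [this, h, map_neg, neg_neg, map_sbar]
  have e1 : post S W.eps ((pathDga b).bar (endTerm k A S) G L) =
      (pathDga b).sbar ((pathDga b).bar (endTerm k A S) G) L := by
    rw [map_bar (en' := endTerm k A S) _ (fun z y => endTerm_post _ z y)]
    simp only [h]
    rw [bar_neg, bar_sbar (endTerm_oeps b) hG, neg_neg]
  have e2 : post S W.eps (cut (lmul W S) ((pathDga b).sbar (baseτ b)) G L) =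
      (pathDga b).sbar (cut (lmul W S) ((pathDga b).sbar (baseτ b)) G) L := by
    rw [map_cut (la' := lmul W S) W.eps (post S W.eps) post_eps_lmul, sbar_cut, sbar_sbar]
    simp only [h, eps_sbar_baseτ]
    rw [cut_neg_left, cut_neg_right, neg_neg]
  rw [gauge, map_sub, map_sub, e0, e1, e2]
  simp only [sbar, gauge, smul_sub]

end Path
end WeaklyUnital

namespace WeaklyUnital

/-! ### Correction of the homotopy on words of formal units -/

section Path

open ParityDga

variable {k : Type*} [Field k] {A : Type*} [AddCommGroup A] [Module k A]
  {S : Type*} [CommRing S] [Algebra k S] {W : WeakAlg k A} (b : BasePoint W S)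

/-- The function of words with the value `g n` on the word of `n` formal units, and zero on all
other words. -/
def unitWords {X M : Type*} [Zero M] : (ℕ → M) → List (Option X) → M
  | g, [] => g 0
  | g, none :: L => unitWords (fun n => g (n + 1)) L
  | _, some _ :: _ => 0

theorem unitWords_replicate {X M : Type*} [Zero M] (g : ℕ → M) (n : ℕ) :
    unitWords g (List.replicate n (none : Option X)) = g n := by
  induction n generalizing g with
  | zero => rfl
  | succ n ih => exact ih _

theorem unitWords_map_some {X M : Type*} [Zero M] (g : ℕ → M) (h : g 0 = 0) (L : List X) :
    unitWords g (L.map some) = 0 := by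
  cases L with
  | nil => exact h
  | cons x L => rfl

theorem isMulti_unitWords {X M : Type*} [AddCommGroup X] [Module k X] [AddCommGroup M]
    [Module k M] (g : ℕ → M) : IsMulti k (unitWords (X := X) g) := by
  have main : ∀ (L₁ : List (Option X)) (g : ℕ → M) (x : X) (L₂),
      unitWords g (L₁ ++ some x :: L₂) = 0 := by
    intro L₁
    induction L₁ with
    | nil => intros; rfl
    | cons z L₁ ih =>
      intro g x L₂
      cases z with
      | none => exact ih _ x L₂
      | some y => rfl
  exact ⟨fun L₁ L₂ x y => by simp [main], fun L₁ L₂ c x => by simp [main]⟩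

theorem map_unitWords {X M : Type*} [AddCommGroup X] [Module k X] [AddCommGroup M]
    [Module k M] (D : ParityDga k X) (f : M →ₗ[k] M) (g : ℕ → M) (c : k)
    (h : ∀ n, f (g n) = (c * (-1) ^ n) • g n) (L) :
    f (unitWords g L) = c • D.sbar (unitWords g) L := by
  induction L generalizing g c with
  | nil => simpa [unitWords] using h 0
  | cons z L ih =>
    cases z with
    | none =>
      have := ih (fun n => g (n + 1)) (-c) fun n => by rw [h, pow_succ]; congr 1; ring
      rw [sbar_cons]
      simpa [unitWords] using this
    | some x => simp [unitWords, sbar]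

theorem bar_replicate (φ : List (Option (Path k A S)) → (S →ₗ[k] A)) (n : ℕ) :
    (pathDga b).bar (endTerm k A S) φ (List.replicate (n + 1) none) =
      if Even n then φ (List.replicate n none) else 0 := by
  induction n generalizing φ with
  | zero => simp [bar_cons]
  | succ n ih =>
    rw [List.replicate_succ, bar_cons, oeps_none, ih]
    simp only [dTerm_none, List.replicate_succ, mTerm_cons, oeps_none, omul_none_left,
      Nat.even_add_one]
    by_cases h : Even n <;> simp [h]

theorem cut_replicate {τ : List (Option (Path k A S)) → A}
    (h : ∀ n, 2 ≤ n → τ (List.replicate n none) = 0)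
    (φ : List (Option (Path k A S)) → (S →ₗ[k] A)) (n : ℕ) :
    cut (lmul W S) τ φ (List.replicate (n + 1) none) =
      lmul W S (τ [none]) (φ (List.replicate n none)) := by
  rw [List.replicate_succ, cut_cons, cut_eq_zero_of_left, add_zero]
  intro u hu hu'
  have hr : u = List.replicate u.length none :=
    List.eq_replicate_of_mem fun z hz => List.eq_of_mem_replicate (hu'.subset hz)
  have := List.length_pos_of_ne_nil hu
  rw [hr]
  exact h (u.length + 1) (by omega)

theorem baseτ_replicate (n : ℕ) (h : 2 ≤ n) : baseτ b (List.replicate n none) = 0 := by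
  simpa [baseτ, toBase] using W.τ_replicate_none n h

theorem sbar_baseτ_replicate (n : ℕ) (h : 2 ≤ n) :
    (pathDga b).sbar (baseτ b) (List.replicate n none) = 0 := by
  simp [sbar, baseτ_replicate b n h]

theorem baseτ_none : baseτ b [none] = W.j := W.τ_none

/-- The defect of the unit: the values of the tail on words of formal units. -/
noncomputable def defect (n : ℕ) : S →ₗ[k] A := tail b W.τ (List.replicate n none)

theorem d_defect (n : ℕ) : post S W.d (defect b (n + 1)) =
    -(if Even n then defect b n else 0) + lmul W S W.j (defect b n) := by
  rw [defect, d_tail, bar_replicate, cut_replicate (baseτ_replicate b), baseτ_none]; rfl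

theorem eps_defect (n : ℕ) : post S W.eps (defect b n) = (-1 : k) ^ n • defect b n := by
  rw [defect, eps_tail, sbar]
  simp

theorem j_defect_zero : lmul W S W.j (defect b 0) = defect b 0 := by
  ext x
  simp [defect, single_apply W.multi, W.τ_some, b.j_ι]

/-- The homotopy `y ↦ p₂ (1, y)` between the identity and the left multiplication with `j`. -/
noncomputable def unitHomotopy (W : WeakAlg k A) : A →ₗ[k] A := single fun u => W.τ (none :: u)

theorem unitHomotopy_apply (y : A) : unitHomotopy W y = W.τ [none, some y] :=
  single_apply (W.multi.cons none) y

theorem d_unitHomotopy (y : A) :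
    W.d (unitHomotopy W y) = y - W.mul W.j y - unitHomotopy W (W.d y) := by
  simp [unitHomotopy_apply, W.d_τ, bar_cons, cut_cons, W.τ_some, W.τ_none, W.τ_nil, sbar]
  abel

theorem eps_unitHomotopy (y : A) : W.eps (unitHomotopy W y) = -unitHomotopy W (W.eps y) := by
  simp [unitHomotopy_apply, W.eps_τ, sbar]

theorem j_j (ψ : S →ₗ[k] A) : lmul W S W.j (lmul W S W.j ψ) = lmul W S W.j ψ := by
  rw [← lmul_mul, W.mul_j_j]

theorem d_j_lmul (ψ : S →ₗ[k] A) :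
    post S W.d (lmul W S W.j ψ) = lmul W S W.j (post S W.d ψ) := by
  rw [post_d_lmul, W.d_j, W.eps_j]; simp

theorem eps_j_lmul (ψ : S →ₗ[k] A) :
    post S W.eps (lmul W S W.j ψ) = lmul W S W.j (post S W.eps ψ) := by
  rw [post_eps_lmul, W.eps_j]

/-- A homotopy, supported on words of formal units, that removes the defect of the unit. The first
value is corrected by `unitHomotopy`, because the homotopy has to vanish on the empty word. -/
noncomputable def correction : ℕ → (S →ₗ[k] A)
  | 0 => 0
  | 1 => -lmul W S W.j (defect b 2) -
      (post S (unitHomotopy W) (defect b 1) -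
        lmul W S W.j (post S (unitHomotopy W) (defect b 1)))
  | n + 2 => -lmul W S W.j (defect b (n + 3)) + if Even n then defect b (n + 3) else 0

theorem d_correction (n : ℕ) : post S W.d (correction b (n + 1)) =
    -lmul W S W.j (correction b n) + (if Even n then correction b n else 0) -
      defect b (n + 1) := by
  have hd := d_defect b
  have h1 : post S W.d (defect b 1) = 0 := by
    rw [hd 0, j_defect_zero]; simp
  match n with
  | 0 =>
    have hu : post S W.d (post S (unitHomotopy W) (defect b 1)) =
        defect b 1 - lmul W S W.j (defect b 1) := by
      ext x
      have := LinearMap.congr_fun h1 x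
      simp only [post_apply, LinearMap.zero_apply] at this
      simp [d_unitHomotopy, this]
    have h2 := hd 1
    simp only [Nat.not_even_one, if_false, neg_zero, zero_add] at h2
    simp only [correction, map_sub, map_neg, d_j_lmul, h2, hu, j_j]
    simp
    abel
  | 1 =>
    have h3 := hd 2
    simp only [even_two, if_true] at h3
    simp only [correction, map_add, map_neg, d_j_lmul, h3, j_j, map_sub, Even.zero, if_true,
      Nat.not_even_one, if_false]
    abel
  | n + 2 =>
    have h3 := hd (n + 3)
    by_cases hn : Even n
    · have h1 : ¬Even (n + 1) := by simpa [Nat.even_add_one] using hn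
      have h3' : ¬Even (n + 3) := by simpa [Nat.even_add_one] using hn
      have h2 : Even (n + 2) := by simpa [Nat.even_add_one] using hn
      simp only [h3', if_false] at h3
      simp only [correction, hn, h1, h2, if_true, if_false, map_add, map_neg, d_j_lmul, h3, j_j,
        map_zero]
      abel
    · have h1 : Even (n + 1) := by simpa [Nat.even_add_one] using hn
      have h3' : Even (n + 3) := by simpa [Nat.even_add_one] using hn
      have h2 : ¬Even (n + 2) := by simpa [Nat.even_add_one] using hn
      simp only [h3', if_true] at h3
      simp only [correction, hn, h1, h2, if_true, if_false, map_add, map_neg, d_j_lmul, h3, j_j,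
        map_zero]
      abel

theorem eps_correction (n : ℕ) :
    post S W.eps (correction b n) = ((-1) * (-1 : k) ^ n) • correction b n := by
  have he := eps_defect b
  match n with
  | 0 => simp [correction]
  | 1 =>
    have hu : post S W.eps (post S (unitHomotopy W) (defect b 1)) =
        post S (unitHomotopy W) (defect b 1) := by
      ext x
      have := LinearMap.congr_fun (he 1) x
      simp only [post_apply, pow_one, neg_smul, one_smul, LinearMap.neg_apply] at this
      simp [eps_unitHomotopy, this]
    simp only [correction, map_sub, map_neg, eps_j_lmul, hu, he 2]
    simp
  | n + 2 =>
    simp only [correction, map_add, map_neg, eps_j_lmul, he (n + 3), map_smul]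
    have : (-1 : k) * (-1) ^ (n + 2) = (-1) ^ (n + 3) := by ring
    rw [this, smul_add, smul_neg]
    split_ifs <;> simp [he (n + 3)]

/-- The twisted module map that defines the weakly unital structure of the path algebra: the tail,
corrected so that it vanishes on words of formal units. On the empty word its value is `ι`. -/
noncomputable def homotopy (L : List (Option (Path k A S))) : S →ₗ[k] A :=
  tail b W.τ L + gauge b (unitWords (correction b)) L

theorem isMulti_homotopy : IsMulti k (homotopy b) :=
  (isMulti_tail b W.multi).fun_add (isMulti_gauge b (isMulti_unitWords _))

theorem d_homotopy (L) : post S W.d (homotopy b L) =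
    -(pathDga b).bar (endTerm k A S) (homotopy b) L +
      cut (lmul W S) (baseτ b) (homotopy b) L := by
  unfold homotopy
  rw [map_add, d_tail, d_gauge b (isMulti_unitWords _), bar_add, cut_add_right]
  abel

theorem eps_homotopy (L) : post S W.eps (homotopy b L) = (pathDga b).sbar (homotopy b) L := by
  unfold homotopy
  rw [map_add, eps_tail, eps_gauge b (isMulti_unitWords _), sbar_add]
  intro L
  simpa using map_unitWords (pathDga b) (post S W.eps) (correction b) (-1) (eps_correction b) L

/-- The path algebra satisfies the relation `p (1, …, 1) = 0`. -/
theorem homotopy_replicate (n : ℕ) : homotopy b (List.replicate (n + 1) none) = 0 := by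
  rw [homotopy, gauge, bar_replicate, cut_replicate (sbar_baseτ_replicate b),
    unitWords_replicate, unitWords_replicate, d_correction]
  have : (pathDga b).sbar (baseτ b) [none] = -W.j := by simp [sbar, baseτ_none]
  rw [this, ← defect]
  simp
  abel

theorem homotopy_nil : homotopy b [] = b.ι := by
  ext x
  simp [homotopy, gauge, unitWords, correction, single_apply W.multi, W.τ_some]

theorem gauge_map_some (L : List (Path k A S)) :
    gauge b (unitWords (correction b)) (L.map some) = 0 := by
  have h0 : ∀ L : List (Path k A S), unitWords (correction b) (L.map some) = 0 :=
    unitWords_map_some _ rfl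
  have hbar : ∀ (L : List (Path k A S)) (φ : List (Option (Path k A S)) → (S →ₗ[k] A)),
      (∀ L : List (Path k A S), φ (L.map some) = 0) →
      (pathDga b).bar (endTerm k A S) φ (L.map some) = 0 := by
    intro L
    induction L with
    | nil => intros; rfl
    | cons e L ih =>
      intro φ h
      have h1 := ih (fun L' => φ ((pathDga b).oeps (some e) :: L')) fun L' => h (_ :: L')
      have h2 : (pathDga b).dTerm φ (some e) (L.map some) = 0 := h (_ :: L)
      rw [List.map_cons, bar_cons, h1, h2]
      cases L with
      | nil => simp [show φ [] = 0 from h []]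
      | cons e' L =>
        have := h ((pathDga b).mul ((pathDga b).eps e) e' :: L)
        simpa using this
  rw [gauge, h0, hbar _ _ h0, cut_eq_zero_of_right]
  · simp
  · intro v hv
    obtain ⟨v', -, rfl⟩ := List.suffix_map_iff.mp hv
    exact h0 v'

theorem tail_map_some_eq_zero {ψ : List (Option A) → A} (hm : IsMulti k ψ)
    (h : ∀ u : List A, 1 ≤ u.length → ψ (u.map some) = 0) (L : List (Path k A S)) :
    tail b ψ (L.map some) = 0 := by
  induction L generalizing ψ with
  | nil =>
    ext x
    simpa [single_apply hm] using h [b.ι x] le_rfl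
  | cons e L ih =>
    have h1 : tail b (fun u => ψ (W.oeps (Option.map Prod.fst (some e)) :: u)) (L.map some) = 0 :=
      ih (hm.cons _) fun u hu => h (W.eps e.1 :: u) (by simp)
    rw [List.map_cons, tail_cons, h1]
    cases L with
    | nil =>
      ext x
      simpa [single_apply hm] using h [e.2.2 x] le_rfl
    | cons e' L => simp

theorem tail_cons_map_some (e : Path k A S) (L : List (Path k A S)) :
    tail b W.τ ((e :: L).map some) = hTerm W.τ (some e) (L.map some) := by
  rw [List.map_cons, tail_cons, tail_map_some_eq_zero b (W.multi.cons _) _ L, sub_zero]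
  intro u hu
  exact W.τ_map_some (W.eps e.1 :: u) (by simp; omega)

theorem homotopy_some (e : Path k A S) : homotopy b [some e] = e.2.2 := by
  have h1 := tail_cons_map_some b e []
  have h2 := gauge_map_some b [e]
  simp only [List.map_cons, List.map_nil] at h1 h2
  rw [homotopy, h1, h2, add_zero]
  ext x
  simp [single_apply W.multi, W.τ_some]

theorem homotopy_map_some (L : List (Path k A S)) (hL : 2 ≤ L.length) :
    homotopy b (L.map some) = 0 := by
  match L with
  | e :: e' :: L => rw [homotopy, gauge_map_some, tail_cons_map_some]; simp

end Path
end WeaklyUnital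

namespace WeaklyUnital

/-! ### The weakly unital structure of the path algebra -/

section Path

open ParityDga

variable {k : Type*} [Field k] {A : Type*} [AddCommGroup A] [Module k A]
  {S : Type*} [CommRing S] [Algebra k S] {W : WeakAlg k A} (b : BasePoint W S)

/-- The twisting cochain of the strictly unital algebra `S` on words over the path algebra: the
`S`-component on one-letter words, zero on longer words. -/
def strictτ : List (Option (Path k A S)) → S
  | [none] => 1
  | [some e] => e.2.1
  | _ => 0

@[simp] theorem strictτ_nil : strictτ ([] : List (Option (Path k A S))) = 0 := rfl

@[simp] theorem strictτ_none : strictτ ([none] : List (Option (Path k A S))) = 1 := rfl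

@[simp] theorem strictτ_some (e : Path k A S) : strictτ [some e] = e.2.1 := rfl

@[simp] theorem strictτ_cons_cons (z z' : Option (Path k A S)) (L) :
    strictτ (z :: z' :: L) = 0 := by cases z <;> rfl

theorem isMulti_strictτ : IsMulti k (strictτ (k := k) (A := A) (S := S)) := by
  refine ⟨fun L₁ L₂ x y => ?_, fun L₁ L₂ c x => ?_⟩ <;>
  · rcases L₁ with _ | ⟨z, _ | ⟨z', L₁⟩⟩ <;> rcases L₂ with _ | ⟨w, L₂⟩ <;> simp

/-- The end terms in the bar differential of words with values in linear maps `S → A` are cut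
products with the twisting cochain of `S`. -/
theorem bar_endTerm (φ : List (Option (Path k A S)) → (S →ₗ[k] A)) (z L) :
    (pathDga b).bar (endTerm k A S) φ (z :: L) = (pathDga b).bar 0 φ (z :: L)
      + cut (rmul k A S) ((pathDga b).sbar φ) strictτ (z :: L)
      + (if L = [] then endTerm k A S z (φ []) else 0) := by
  induction L generalizing z φ with
  | nil => simp [bar_cons, cut_cons]
  | cons z' L ih =>
    have h : (fun u => (pathDga b).sbar φ (z :: u)) = fun u =>
        -(pathDga b).sbar (fun u => φ ((pathDga b).oeps z :: u)) u :=
      funext fun u => sbar_cons φ z u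
    have h' : rmul k A S ((pathDga b).sbar φ [z]) (strictτ (z' :: L)) =
        -(if L = [] then endTerm k A S z' (φ [(pathDga b).oeps z]) else 0) := by
      cases L with
      | nil => cases z' <;> ext x <;> simp [sbar]
      | cons z'' L => simp
    rw [bar_cons, bar_cons (en := 0), ih, cut_cons ((pathDga b).sbar φ), h, cut_neg_left, h',
      mTerm_cons, mTerm_cons]
    simp
    abel

/-- The Maurer-Cartan equation of the strictly unital algebra `S`. -/
theorem strict_mc (L) : (pathDga b).bar 0 strictτ L
    + cut (LinearMap.mul k S) ((pathDga b).sbar strictτ) strictτ L = 0 := by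
  rcases L with _ | ⟨z, _ | ⟨z', L⟩⟩
  · simp
  · cases z <;> simp [bar_cons, cut_cons]
  · have h1 : ∀ (φ : List (Option (Path k A S)) → S) (L), (∀ u, u ≠ [] → φ u = 0) →
        (pathDga b).bar 0 φ L = 0 := by
      intro φ L h
      rw [bar_congr_of_ne_nil h, bar_zero]
    have h2 : (pathDga b).bar 0 (fun u => strictτ ((pathDga b).oeps z :: u)) (z' :: L) = 0 :=
      h1 _ _ fun u hu => by cases u <;> simp_all
    have h3 : cut (LinearMap.mul k S) (fun u => (pathDga b).sbar strictτ (z :: u)) strictτ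
        (z' :: L) = 0 :=
      cut_eq_zero_of_left _ fun u hu _ => by cases u <;> simp_all [sbar]
    rw [bar_cons, cut_cons, h2, h3]
    cases L with
    | nil => cases z <;> cases z' <;> simp [sbar]
    | cons z'' L => cases z <;> simp

/-- The component of the twisting cochain of the path algebra in linear maps `S → A`. -/
noncomputable def pathH (L : List (Option (Path k A S))) : S →ₗ[k] A :=
  if L = [] then 0 else homotopy b L

@[simp] theorem pathH_nil : pathH b ([] : List (Option (Path k A S))) = 0 := rfl

theorem pathH_of_ne_nil {L : List (Option (Path k A S))} (h : L ≠ []) :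
    pathH b L = homotopy b L := if_neg h

/-- The twisting cochain of the path algebra. -/
noncomputable def pathτ (L : List (Option (Path k A S))) : Path k A S :=
  (baseτ b L, strictτ L, pathH b L)

theorem isMulti_pathτ : IsMulti k (pathτ b) := by
  have h1 := isMulti_baseτ b
  have h2 := isMulti_strictτ (k := k) (A := A) (S := S)
  have h3 := isMulti_homotopy b
  refine ⟨fun L₁ L₂ x y => ?_, fun L₁ L₂ c x => ?_⟩
  · simp [pathτ, h1.add, h2.add, pathH_of_ne_nil, h3.add]
  · simp [pathτ, h1.smul, h2.smul, pathH_of_ne_nil, h3.smul]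

/-- The Maurer-Cartan equation of the path algebra, in its component of linear maps `S → A`. The
terms of `d_homotopy` that involve the value `ι` on the empty word become the part of the
differential of the path algebra given by `ι`. -/
theorem d_pathH (z : Option (Path k A S)) (L) :
    lmul W S (baseτ b (z :: L)) b.ι - rmul k A S b.ι (strictτ (z :: L))
        - post S W.d (pathH b (z :: L)) =
      (pathDga b).bar 0 (pathH b) (z :: L) - cut (lmul W S) (baseτ b) (pathH b) (z :: L)
        + cut (rmul k A S) ((pathDga b).sbar (pathH b)) strictτ (z :: L) := by
  have h1 : (pathDga b).bar 0 (homotopy b) (z :: L) = (pathDga b).bar 0 (pathH b) (z :: L) :=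
    bar_congr_of_ne_nil (fun u hu => (pathH_of_ne_nil b hu).symm) _
  have h2 : cut (rmul k A S) ((pathDga b).sbar (homotopy b)) strictτ (z :: L) =
      cut (rmul k A S) ((pathDga b).sbar (pathH b)) strictτ (z :: L) :=
    cut_congr_left (fun u hu => by simp [sbar, pathH_of_ne_nil, hu]) _ _
  have h3 : cut (lmul W S) (baseτ b) (homotopy b) (z :: L) =
      cut (lmul W S) (baseτ b) (pathH b) (z :: L) + lmul W S (baseτ b (z :: L)) b.ι := by
    have : ∀ (τ : List (Option (Path k A S)) → A) (z) (L),
        cut (lmul W S) τ (homotopy b) (z :: L) =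
        cut (lmul W S) τ (pathH b) (z :: L) + lmul W S (τ (z :: L)) b.ι := by
      intro τ z L
      induction L generalizing τ z with
      | nil => simp [cut_cons, homotopy_nil]
      | cons z' L ih =>
        rw [cut_cons τ (homotopy b), ih, cut_cons τ (pathH b),
          pathH_of_ne_nil b (L := z' :: L) (by simp)]
        abel
    exact this _ _ _
  have h4 : (if L = [] then endTerm k A S z (homotopy b []) else 0) =
      rmul k A S b.ι (strictτ (z :: L)) := by
    cases L with
    | nil => cases z <;> ext x <;> simp [homotopy_nil]
    | cons z' L => simp
  rw [pathH_of_ne_nil b (by simp), d_homotopy, bar_endTerm, h1, h2, h3, h4]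
  abel

theorem eps_pathH (L) : post S W.eps (pathH b L) = (pathDga b).sbar (pathH b) L := by
  cases L with
  | nil => simp
  | cons z L =>
    rw [pathH_of_ne_nil b (by simp), eps_homotopy]
    simp [sbar, pathH_of_ne_nil]

theorem sbar_strictτ (L : List (Option (Path k A S))) :
    (pathDga b).sbar strictτ L = -strictτ L := by
  rcases L with _ | ⟨z, _ | ⟨z', L⟩⟩
  · simp
  · cases z <;> simp [sbar]
  · simp [sbar]

/-- The path algebra is a weakly unital algebra. Its first projection to `A` and its second
projection to the strictly unital algebra `S` are compatible with all the operations. -/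
noncomputable def pathAlg : WeakAlg k (Path k A S) where
  toParityDga := pathDga b
  j := (W.j, 1, 0)
  τ := pathτ b
  multi := isMulti_pathτ b
  τ_nil := by simp [pathτ, baseτ, W.τ_nil]
  τ_some e := by
    simp [pathτ, baseτ, W.τ_some, pathH_of_ne_nil, homotopy_some]
  τ_none := by
    have := homotopy_replicate b 0
    simp only [zero_add, List.replicate_one] at this
    simp [pathτ, baseτ, W.τ_none, pathH_of_ne_nil, this]
  τ_replicate_none n hn := by
    obtain ⟨m, rfl⟩ : ∃ m, n = m + 2 := ⟨n - 2, by omega⟩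
    rw [pathτ, baseτ_replicate b _ hn, pathH_of_ne_nil b (by simp), homotopy_replicate b (m + 1)]
    rfl
  τ_map_some L hL := by
    match L, hL with
    | e :: e' :: L, hL =>
      have h1 : baseτ b ((e :: e' :: L).map some) = 0 := by
        have := W.τ_map_some ((e :: e' :: L).map Prod.fst) (by simp)
        simpa [baseτ, toBase] using this
      rw [pathτ, h1, pathH_of_ne_nil b (by simp), homotopy_map_some b _ hL]
      rfl
  eps_τ L := by
    have h1 := eps_baseτ b L
    have h2 := sbar_strictτ b L
    have h3 : W.eps ∘ₗ pathH b L = (pathDga b).sbar (pathH b) L := eps_pathH b L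
    have h4 : (pathDga b).sbar (pathτ b) L = ((pathDga b).sbar (baseτ b) L,
        (pathDga b).sbar strictτ L, (pathDga b).sbar (pathH b) L) := rfl
    rw [h4, h2]
    simp [pathτ, h1, h3]
  d_τ L := by
    cases L with
    | nil => simp [pathτ, baseτ, W.τ_nil]
    | cons z L =>
      let f₁ := LinearMap.fst k A (S × (S →ₗ[k] A))
      let f₂ := LinearMap.fst k S (S →ₗ[k] A) ∘ₗ LinearMap.snd k A (S × (S →ₗ[k] A))
      let f₃ := LinearMap.snd k S (S →ₗ[k] A) ∘ₗ LinearMap.snd k A (S × (S →ₗ[k] A))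
      have hs : ∀ u, (pathDga b).sbar (pathτ b) u = ((pathDga b).sbar (baseτ b) u,
        (pathDga b).sbar strictτ u, (pathDga b).sbar (pathH b) u) := fun _ => rfl
      have b1 := map_bar (D := pathDga b) (en := 0) (en' := 0) f₁ (by simp) (pathτ b) (z :: L)
      have b2 := map_bar (D := pathDga b) (en := 0) (en' := 0) f₂ (by simp) (pathτ b) (z :: L)
      have b3 := map_bar (D := pathDga b) (en := 0) (en' := 0) f₃ (by simp) (pathτ b) (z :: L)
      have c1 := map_cut (la := (pathDga b).mul) (la' := W.mul) f₁ f₁ (fun _ _ => rfl)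
        ((pathDga b).sbar (pathτ b)) (pathτ b) (z :: L)
      have c2 := map_cut (la := (pathDga b).mul) (la' := LinearMap.mul k S) f₂ f₂ (fun _ _ => rfl)
        ((pathDga b).sbar (pathτ b)) (pathτ b) (z :: L)
      have c3 := map_cut_add (la := (pathDga b).mul) (la₁ := lmul W S) (la₂ := rmul k A S) f₃
        (fun e => W.eps e.1) f₃ f₃ f₂ (fun _ _ => rfl)
        ((pathDga b).sbar (pathτ b)) (pathτ b) (z :: L)
      have c4 : cut (lmul W S) (fun u => W.eps ((pathDga b).sbar (baseτ b) u)) (pathH b) (z :: L) =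
          -cut (lmul W S) (baseτ b) (pathH b) (z :: L) := by
        simp only [eps_sbar_baseτ]
        rw [cut_neg_left]
      refine Prod.ext ?_ (Prod.ext ?_ ?_)
      · exact (d_baseτ b (z :: L)).trans (congrArg₂ (· + ·) b1.symm c1.symm)
      · exact (strict_mc b (z :: L)).symm.trans (congrArg₂ (· + ·) b2.symm c2.symm)
      · refine (d_pathH b z L).trans ?_
        refine Eq.trans ?_ (congrArg₂ (· + ·) b3.symm c3.symm)
        refine Eq.trans ?_ (congrArg (_ + ·) (congrArg (· + _) c4.symm))
        rw [sub_eq_add_neg, add_assoc]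
        rfl

end Path
end WeaklyUnital

namespace WeaklyUnital

/-! ### Evaluation of formal expressions -/

section Sign

variable (k : Type u) [Field k]

theorem koszulSign_add (a b : ℤ) : koszulSign k (a + b) = koszulSign k a * koszulSign k b := by
  simp [koszulSign, Int.negOnePow_add]

@[simp] theorem koszulSign_zero : koszulSign k 0 = 1 := by simp [koszulSign]

theorem koszulSign_even {a : ℤ} (h : Even a) : koszulSign k a = 1 := by
  simp [koszulSign, Int.negOnePow_even a h]

theorem koszulSign_odd {a : ℤ} (h : ¬Even a) : koszulSign k a = -1 := by
  simp [koszulSign, Int.negOnePow_odd a (Int.not_even_iff_odd.mp h)]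

theorem koszulSign_mul_self (a : ℤ) : koszulSign k a * koszulSign k a = 1 := by
  by_cases h : Even a
  · simp [koszulSign_even k h]
  · simp [koszulSign_odd k h]

theorem koszulSign_natCast (n : ℕ) : koszulSign k (n : ℤ) = (-1) ^ n := by
  rcases Nat.even_or_odd n with h | h
  · rw [h.neg_one_pow, koszulSign_even k (by exact_mod_cast h)]
  · rw [h.neg_one_pow, koszulSign_odd k (by simpa using h)]

end Sign

section Eval

open ParityDga

variable {k : Type u} [Field k] {X : Type*} [AddCommGroup X] [Module k X] (D : ParityDga k X)

/-- The operator `ε ^ a`, for an integer `a`. -/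
def epsZ (a : ℤ) : X →ₗ[k] X := if Even a then LinearMap.id else D.eps

variable {D}

theorem epsZ_even {a : ℤ} (h : Even a) : epsZ D a = LinearMap.id := if_pos h

theorem epsZ_odd {a : ℤ} (h : ¬Even a) : epsZ D a = D.eps := if_neg h

@[simp] theorem epsZ_zero (x : X) : epsZ D 0 x = x := by simp [epsZ_even]

theorem epsZ_epsZ (a b : ℤ) (x : X) : epsZ D a (epsZ D b x) = epsZ D (b + a) x := by
  by_cases ha : Even a <;> by_cases hb : Even b <;>
    simp [epsZ, ha, hb, Int.even_add, D.eps_eps]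

theorem epsZ_eps (a : ℤ) (x : X) : epsZ D a (D.eps x) = D.eps (epsZ D a x) := by
  by_cases ha : Even a <;> simp [epsZ, ha]

theorem d_epsZ (a : ℤ) (x : X) : D.d (epsZ D a x) = koszulSign k a • epsZ D a (D.d x) := by
  by_cases ha : Even a
  · simp [epsZ_even ha, koszulSign_even k ha]
  · simp [epsZ_odd ha, koszulSign_odd k ha, D.d_eps]

variable (D)

/-- The sum of the values of `f` on the lists obtained by applying the differential to one entry,
and the parity operator to the entries before it. -/
def dSum (f : List X → X) : List X → X
  | [] => 0
  | x :: L => f (D.d x :: L) + dSum (fun L' => f (D.eps x :: L')) L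

/-- The word with letters `none` at the places where `w` is `true`, and the entries of the list at
the other places. If the list is too short, missing entries are replaced by `none`. -/
def fill : List Bool → List X → List (Option X)
  | [], _ => []
  | true :: w, L => none :: fill w L
  | false :: w, x :: L => some x :: fill w L
  | false :: w, [] => none :: fill w []

/-- The value of a formal expression on a list of elements, for given operations `m`, `j` and `p`;
`P` gives the values of all the operations `p`, on words in which `none` stands for the formal unit.
The signs are those of the operad of graded multilinear maps. The value is meaningful only if the
length of the list is the arity of the expression. -/
def eval (j : X) (P : List (Option X) → X) : ∀ {n : ℕ} {a : ℤ}, Term k n a → List X → X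
  | _, _, .one, L => L.headD 0
  | _, _, .m, L => D.mul (L.headD 0) (L.tail.headD 0)
  | _, _, .j, _ => j
  | _, _, .p w _ _ _, L => P (fill w L)
  | _, _, .comp (m := m) (b := b) i _ _ _ x y, L =>
    eval j P x ((L.take i).map (epsZ D b) ++ eval j P y ((L.drop i).take m) :: L.drop (i + m))
  | _, _, .d (a := a) _ x, L => D.d (eval j P x L) - koszulSign k a • dSum D (eval j P x) L
  | _, _, .zero, _ => 0
  | _, _, .add x y, L => eval j P x L + eval j P y L
  | _, _, .smul c x, L => c • eval j P x L

variable {D}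

@[simp] theorem dSum_nil (f : List X → X) : dSum D f [] = 0 := rfl

theorem dSum_cons (f : List X → X) (x L) :
    dSum D f (x :: L) = f (D.d x :: L) + dSum D (fun L' => f (D.eps x :: L')) L := rfl

theorem dSum_congr {f g : List X → X} (L : List X)
    (h : ∀ L' : List X, L'.length = L.length → f L' = g L') : dSum D f L = dSum D g L := by
  induction L generalizing f g with
  | nil => rfl
  | cons x L ih =>
    rw [dSum_cons, dSum_cons, h _ (by simp), ih fun L' hL' => h _ (by simpa using hL')]

theorem dSum_add (f g : List X → X) (L) :
    dSum D (fun L => f L + g L) L = dSum D f L + dSum D g L := by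
  induction L generalizing f g with
  | nil => simp
  | cons x L ih => simp only [dSum_cons, ih]; abel

theorem map_dSum (φ : X →ₗ[k] X) (f : List X → X) (L) :
    φ (dSum D f L) = dSum D (fun L => φ (f L)) L := by
  induction L generalizing f with
  | nil => simp
  | cons x L ih => simp only [dSum_cons, map_add, ih]

theorem dSum_smul (c : k) (f : List X → X) (L) :
    dSum D (fun L => c • f L) L = c • dSum D f L :=
  (map_dSum (LinearMap.lsmul k X c) f L).symm

theorem dSum_append (f : List X → X) (L₁ L₂) : dSum D f (L₁ ++ L₂) =
    dSum D (fun L => f (L ++ L₂)) L₁ + dSum D (fun L => f (L₁.map D.eps ++ L)) L₂ := by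
  induction L₁ generalizing f with
  | nil => simp
  | cons x L₁ ih => simp only [List.cons_append, dSum_cons, ih, List.map_cons, add_assoc]

/-- Linearity in each entry, for lists of a fixed length. -/
def SlotLinear (k : Type*) [Field k] {X : Type*} [AddCommGroup X] [Module k X] (n : ℕ)
    (f : List X → X) : Prop :=
  ∀ L₁ L₂ (c : k) x y, L₁.length + L₂.length + 1 = n →
    f (L₁ ++ (c • x + y) :: L₂) = c • f (L₁ ++ x :: L₂) + f (L₁ ++ y :: L₂)

namespace SlotLinear

theorem cons {n : ℕ} {f : List X → X} (h : SlotLinear k (n + 1) f) (x : X) :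
    SlotLinear k n fun L => f (x :: L) :=
  fun L₁ L₂ c y z hn => h (x :: L₁) L₂ c y z (by simp; omega)

theorem zero_slot {n : ℕ} {f : List X → X} (h : SlotLinear k n f) (L₁ L₂)
    (hn : L₁.length + L₂.length + 1 = n) : f (L₁ ++ 0 :: L₂) = 0 := by
  simpa using h L₁ L₂ (-1) 0 0 hn

theorem add_slot {n : ℕ} {f : List X → X} (h : SlotLinear k n f) (L₁ L₂) (x y)
    (hn : L₁.length + L₂.length + 1 = n) :
    f (L₁ ++ (x + y) :: L₂) = f (L₁ ++ x :: L₂) + f (L₁ ++ y :: L₂) := by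
  simpa using h L₁ L₂ 1 x y hn

theorem smul_slot {n : ℕ} {f : List X → X} (h : SlotLinear k n f) (L₁ L₂) (c : k) (x)
    (hn : L₁.length + L₂.length + 1 = n) :
    f (L₁ ++ (c • x) :: L₂) = c • f (L₁ ++ x :: L₂) := by
  simpa [h.zero_slot L₁ L₂ hn] using h L₁ L₂ c x 0 hn

theorem neg_slot {n : ℕ} {f : List X → X} (h : SlotLinear k n f) (L₁ L₂) (x)
    (hn : L₁.length + L₂.length + 1 = n) :
    f (L₁ ++ (-x) :: L₂) = -f (L₁ ++ x :: L₂) := by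
  simpa using h.smul_slot L₁ L₂ (-1) x hn

theorem fun_add {n : ℕ} {f g : List X → X} (h : SlotLinear k n f) (h' : SlotLinear k n g) :
    SlotLinear k n fun L => f L + g L := fun L₁ L₂ c x y hn => by
  simp only [h _ _ _ _ _ hn, h' _ _ _ _ _ hn, smul_add]; abel

theorem fun_map {n : ℕ} {f : List X → X} (h : SlotLinear k n f) (φ : X →ₗ[k] X) :
    SlotLinear k n fun L => φ (f L) := fun L₁ L₂ c x y hn => by
  simp only [h _ _ _ _ _ hn, map_add, map_smul]

theorem dSum {n : ℕ} {f : List X → X} (h : SlotLinear k n f) :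
    SlotLinear k n (WeaklyUnital.dSum D f) := by
  intro L₁
  induction L₁ generalizing n f with
  | nil =>
    intro L₂ c x y hn
    simp only [List.nil_append, dSum_cons, map_add, map_smul]
    have h1 := h [] L₂ c (D.d x) (D.d y) hn
    have h2 : WeaklyUnital.dSum D (fun L' => f ((c • D.eps x + D.eps y) :: L')) L₂ =
        c • WeaklyUnital.dSum D (fun L' => f (D.eps x :: L')) L₂
          + WeaklyUnital.dSum D (fun L' => f (D.eps y :: L')) L₂ := by
      rw [← dSum_smul, ← dSum_add]
      exact dSum_congr _ fun L' hL' => h [] L' c _ _ (by simpa [hL'] using hn)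
    simp only [List.nil_append] at h1
    rw [h1, h2, smul_add]
    abel
  | cons z L₁ ih =>
    intro L₂ c x y hn
    obtain ⟨n, rfl⟩ : ∃ m, n = m + 1 := ⟨n - 1, by omega⟩
    have h1 := h (D.d z :: L₁) L₂ c x y hn
    have h2 := ih (h.cons (D.eps z)) L₂ c x y (by simp at hn; omega)
    simp only [List.cons_append] at h1
    simp only [List.cons_append, dSum_cons, h1, h2, smul_add]
    abel

end SlotLinear

/-- The differential on multilinear maps squares to zero. -/
theorem dSum_dSum {n : ℕ} {f : List X → X} (h : SlotLinear k n f) (L : List X)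
    (hL : L.length = n) : dSum D (dSum D f) L = 0 := by
  induction L generalizing n f with
  | nil => rfl
  | cons x L ih =>
    obtain ⟨n, rfl⟩ : ∃ m, n = m + 1 := ⟨n - 1, by simp at hL; omega⟩
    have hL' : L.length = n := by simpa using hL
    have h1 := ih (h.cons x) hL'
    have h2 : f (0 :: L) = 0 := h.zero_slot [] L (by simpa using hL)
    have h3 : dSum D (fun L' => f (-D.eps (D.d x) :: L')) L =
        -dSum D (fun L' => f (D.eps (D.d x) :: L')) L := by
      have := dSum_smul (D := D) (-1) (fun L' => f (D.eps (D.d x) :: L')) L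
      simp only [neg_smul, one_smul] at this
      rw [← this]
      exact dSum_congr _ fun L' hL'' => h.neg_slot [] L' _ (by simpa [hL''] using hL')
    simp only [dSum_cons, D.d_d, h2, D.d_eps, D.eps_eps]
    rw [dSum_add, h1, h3]
    abel

theorem dSum_map_eps {n : ℕ} {f g : List X → X} (h : SlotLinear k n f) (c : k)
    (hfg : ∀ L, L.length = n → f (L.map D.eps) = c • D.eps (g L)) (L : List X)
    (hL : L.length = n) : dSum D f (L.map D.eps) = -(c • D.eps (dSum D g L)) := by
  induction L generalizing n f g with
  | nil => simp
  | cons x L ih =>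
    obtain ⟨n, rfl⟩ : ∃ m, n = m + 1 := ⟨n - 1, by simp at hL; omega⟩
    have hL' : L.length = n := by simpa using hL
    have h1 := ih (f := fun L' => f (D.eps (D.eps x) :: L')) (g := fun L' => g (D.eps x :: L'))
      (h.cons _) (fun L'' h'' => by simpa using hfg (D.eps x :: L'') (by simpa using h'')) hL'
    have h2 : f (-D.eps (D.d x) :: L.map D.eps) = -f (D.eps (D.d x) :: L.map D.eps) :=
      h.neg_slot [] _ _ (by simpa using hL)
    have h3 := hfg (D.d x :: L) (by simpa using hL)
    simp only [List.map_cons] at h3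
    rw [List.map_cons, dSum_cons, dSum_cons, h1, D.d_eps, h2, h3, map_add, smul_add]
    abel

theorem dSum_comp_epsZ {n : ℕ} {f : List X → X} (h : SlotLinear k n f) (b : ℤ) (L : List X)
    (hL : L.length = n) : dSum D (fun L => f (L.map (epsZ D b))) L =
      koszulSign k b • dSum D f (L.map (epsZ D b)) := by
  induction L generalizing n f with
  | nil => simp
  | cons x L ih =>
    obtain ⟨n, rfl⟩ : ∃ m, n = m + 1 := ⟨n - 1, by simp at hL; omega⟩
    have hL' : L.length = n := by simpa using hL
    have h1 := ih (h.cons (D.eps (epsZ D b x))) hL'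
    have h2 : f ((koszulSign k b • epsZ D b (D.d x)) :: L.map (epsZ D b)) =
        koszulSign k b • f (epsZ D b (D.d x) :: L.map (epsZ D b)) :=
      h.smul_slot [] _ _ _ (by simpa using hL)
    rw [dSum_cons, List.map_cons, List.map_cons, dSum_cons, d_epsZ, h2]
    simp only [List.map_cons, epsZ_eps]
    rw [h1, smul_add, smul_smul, koszulSign_mul_self, one_smul]

theorem fill_append (w : List Bool) (L₁ L₂ : List X)
    (h : L₁.length + L₂.length + 1 = w.count false) :
    ∃ U₁ U₂, ∀ x, fill w (L₁ ++ x :: L₂) = U₁ ++ some x :: U₂ := by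
  induction w generalizing L₁ with
  | nil => simp at h
  | cons c w ih =>
    cases c with
    | true =>
      obtain ⟨U₁, U₂, hU⟩ := ih L₁ (by simpa using h)
      exact ⟨none :: U₁, U₂, fun x => by simp [fill, hU]⟩
    | false =>
      cases L₁ with
      | nil => exact ⟨[], fill w L₂, fun x => rfl⟩
      | cons y L₁ =>
        obtain ⟨U₁, U₂, hU⟩ := ih L₁ (by simp at h; omega)
        exact ⟨some y :: U₁, U₂, fun x => by simp [fill, hU]⟩

theorem fill_map {Y : Type*} (f : X → Y) (w : List Bool) (L : List X) :
    fill w (L.map f) = (fill w L).map (Option.map f) := by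
  induction w generalizing L with
  | nil => rfl
  | cons c w ih =>
    cases c with
    | true => simp [fill, ih]
    | false =>
      cases L with
      | nil => simpa [fill] using ih []
      | cons x L => simp [fill, ih]

@[simp] theorem length_fill (w : List Bool) (L : List X) : (fill w L).length = w.length := by
  induction w generalizing L with
  | nil => rfl
  | cons c w ih =>
    cases c with
    | true => simp [fill, ih]
    | false => cases L <;> simp [fill, ih]

variable {j : X} {P : List (Option X) → X}

theorem eval_comp_append {n m N : ℕ} {a b e : ℤ} (i : ℕ) (hi : i < n) (hN : N + 1 = n + m)
    (he : e = a + b) (x : Term k n a) (y : Term k m b) {L₁ L₂ : List X} (L₃ : List X)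
    (h₁ : L₁.length = i) (h₂ : L₂.length = m) :
    eval D j P (.comp i hi hN he x y) (L₁ ++ (L₂ ++ L₃)) =
      eval D j P x (L₁.map (epsZ D b) ++ eval D j P y L₂ :: L₃) := by
  subst h₁ h₂
  rw [eval, List.take_left, List.drop_left, List.take_left, ← List.append_assoc,
    ← List.length_append, List.drop_left]

theorem exists_append {α : Type*} {L : List α} {n : ℕ} (h : n ≤ L.length) :
    ∃ L₁ L₂, L = L₁ ++ L₂ ∧ L₁.length = n :=
  ⟨L.take n, L.drop n, (List.take_append_drop n L).symm, by simp [h]⟩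

theorem slotLinear_eval (hP : IsMulti k P) {n : ℕ} {a : ℤ} (t : Term k n a) :
    SlotLinear k n (eval D j P t) := by
  induction t with
  | one =>
    rintro (_ | ⟨z, L₁⟩) L₂ c x y h
    · rfl
    · simp at h
  | m =>
    rintro (_ | ⟨z, _ | ⟨z', L₁⟩⟩) L₂ c x y h
    · simp [eval]
    · simp [eval]
    · simp at h; omega
  | j =>
    intro L₁ L₂ c x y h
    omega
  | p w hw hn ha =>
    intro L₁ L₂ c x y h
    obtain ⟨U₁, U₂, hU⟩ := fill_append w L₁ L₂ (by omega)
    simp only [eval, hU, hP.add, hP.smul]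
  | comp i hi hN he x y ihx ihy =>
    rename_i n m N a b e
    intro L₁ L₂ c v w h
    rcases lt_or_ge L₁.length i with h1 | h1
    · obtain ⟨A, L₂, rfl, hA⟩ := exists_append (L := L₂) (n := i - L₁.length - 1) (by omega)
      obtain ⟨B, L₂, rfl, hB⟩ := exists_append (L := L₂) (n := m) (by simp at h; omega)
      have hl : ∀ v, (L₁ ++ v :: A).length = i := fun v => by simp; omega
      have hc := fun v => eval_comp_append (D := D) (j := j) (P := P) i hi hN he x y L₂ (hl v) hB
      simp only [List.append_assoc, List.cons_append] at hc
      simp only [hc, List.map_append, List.map_cons, map_add, map_smul, List.append_assoc,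
        List.cons_append]
      exact ihx _ _ _ _ _ (by simp at h ⊢; omega)
    · obtain ⟨A, L₁, rfl, hA⟩ := exists_append h1
      rcases lt_or_ge L₁.length m with h2 | h2
      · obtain ⟨B, L₂, rfl, hB⟩ := exists_append (L := L₂) (n := m - L₁.length - 1)
          (by simp at h; omega)
        have hl : ∀ v, (L₁ ++ v :: B).length = m := fun v => by simp; omega
        have hc := fun v => eval_comp_append (D := D) (j := j) (P := P) i hi hN he x y L₂ hA (hl v)
        simp only [List.append_assoc, List.cons_append] at hc
        simp only [hc, List.append_assoc]
        rw [ihy _ _ _ _ _ (by omega), ihx _ _ _ _ _ (by simp at h ⊢; omega)]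
      · obtain ⟨B, L₁, rfl, hB⟩ := exists_append h2
        have hc := fun L₃ => eval_comp_append (D := D) (j := j) (P := P) i hi hN he x y L₃ hA hB
        simp only [List.append_assoc, hc]
        have := fun v w => ihx (A.map (epsZ D b) ++ eval D j P y B :: L₁) L₂ c v w
          (by simp at h ⊢; omega)
        simpa only [List.append_assoc, List.cons_append] using this v w
  | d h x ih =>
    rename_i n a b
    have h1 := (ih.fun_map D.d).fun_add
      ((ih.dSum (D := D)).fun_map (LinearMap.lsmul k X (-koszulSign k a)))
    simpa [eval, sub_eq_add_neg] using h1
  | zero => intro L₁ L₂ c x y h; simp [eval]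
  | add x y ihx ihy => exact ihx.fun_add ihy
  | smul c x ih => exact ih.fun_map (LinearMap.lsmul k X c)

/-- The parity of the operation given by an expression of degree `a` is `(-1) ^ a`. -/
theorem eval_map_eps (hP : IsMulti k P) (hj : D.eps j = j)
    (hPε : ∀ z, P (z.map D.oeps) = koszulSign k (1 - (z.length : ℤ)) • D.eps (P z))
    {n : ℕ} {a : ℤ} (t : Term k n a) (L : List X) (hL : L.length = n) :
    eval D j P t (L.map D.eps) = koszulSign k a • D.eps (eval D j P t L) := by
  induction t generalizing L with
  | one =>
    obtain ⟨x, rfl⟩ := List.length_eq_one_iff.mp hL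
    simp [eval]
  | m =>
    obtain ⟨x, y, rfl⟩ := List.length_eq_two.mp hL
    simp [eval, D.eps_mul]
  | j => simp [eval, hj]
  | p w hw hn ha =>
    rw [eval, eval, fill_map]
    have := hPε (fill w L)
    rw [length_fill, ← ha] at this
    exact this
  | comp i hi hN he x y ihx ihy =>
    rename_i n m N a b e
    obtain ⟨L₁, L, rfl, h1⟩ := exists_append (L := L) (n := i) (by omega)
    obtain ⟨L₂, L₃, rfl, h2⟩ := exists_append (L := L) (n := m) (by simp at hL; omega)
    have h3 : (L₁.map D.eps).map (epsZ D b) = (L₁.map (epsZ D b)).map D.eps := by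
      simp [epsZ_eps]
    have h4 := ihx (L₁.map (epsZ D b) ++ eval D j P y L₂ :: L₃) (by simp at hL ⊢; omega)
    simp only [List.map_append, List.map_cons] at h4
    rw [List.map_append, List.map_append, eval_comp_append i hi hN he x y _ (by simpa) (by simpa),
      eval_comp_append i hi hN he x y _ h1 h2, ihy _ h2, h3,
      (slotLinear_eval hP x).smul_slot _ _ _ _ (by simp at hL ⊢; omega), h4, smul_smul, he,
      koszulSign_add, mul_comm]
  | d h x ih =>
    rename_i n a b
    rw [eval, eval, ih L hL, dSum_map_eps (slotLinear_eval hP x) _ ih L hL, ← h, koszulSign_add,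
      koszulSign_odd k (a := 1) (by decide)]
    simp only [map_smul, D.d_eps, map_sub, smul_sub, smul_neg, mul_neg, mul_one, neg_smul]
  | zero => simp [eval]
  | add x y ihx ihy => simp [eval, ihx L hL, ihy L hL]
  | smul c x ih => simp [eval, ih L hL, smul_comm c]

theorem eval_map_epsZ (hP : IsMulti k P) (hj : D.eps j = j)
    (hPε : ∀ z, P (z.map D.oeps) = koszulSign k (1 - (z.length : ℤ)) • D.eps (P z))
    {n : ℕ} {a : ℤ} (t : Term k n a) (c : ℤ) (L : List X) (hL : L.length = n) :
    eval D j P t (L.map (epsZ D c)) = koszulSign k (a * c) • epsZ D c (eval D j P t L) := by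
  by_cases hc : Even c
  · simp [epsZ_even hc, koszulSign_even k (hc.mul_left a)]
  · rw [epsZ_odd hc, eval_map_eps hP hj hPε t L hL]
    congr 1
    by_cases ha : Even a
    · rw [koszulSign_even k ha, koszulSign_even k (ha.mul_right c)]
    · rw [koszulSign_odd k ha, koszulSign_odd k (by simp [Int.even_mul, ha, hc])]

end Eval
end WeaklyUnital

namespace WeaklyUnital

/-! ### Formal expressions and the relations -/

section Eval

open ParityDga

variable {k : Type u} [Field k] {X : Type*} [AddCommGroup X] [Module k X] {D : ParityDga k X}
  {j : X} {P : List (Option X) → X}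

theorem eval_comp_assoc {n m l N₁ M N : ℕ} {a b c e f g : ℤ} (i r : ℕ) (hi : i < n) (hr : r < m)
    (hir : i + r < N₁) (h₁ : N₁ + 1 = n + m) (h₂ : N + 1 = N₁ + l) (h₃ : M + 1 = m + l)
    (h₄ : N + 1 = n + M) (e₁ : e = a + b) (e₂ : g = e + c) (e₃ : f = b + c) (e₄ : g = a + f)
    (x : Term k n a) (y : Term k m b) (z : Term k l c) (L : List X) (hL : L.length = N) :
    eval D j P (.comp (i + r) hir h₂ e₂ (.comp i hi h₁ e₁ x y) z) L =
      eval D j P (.comp i hi h₄ e₄ x (.comp r hr h₃ e₃ y z)) L := by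
  obtain ⟨L₁, L, rfl, k1⟩ := exists_append (L := L) (n := i) (by omega)
  simp only [List.length_append] at hL
  obtain ⟨M₁, L, rfl, k2⟩ := exists_append (L := L) (n := r) (by omega)
  simp only [List.length_append] at hL
  obtain ⟨M₂, L, rfl, k3⟩ := exists_append (L := L) (n := l) (by omega)
  simp only [List.length_append] at hL
  obtain ⟨M₃, L₃, rfl, k4⟩ := exists_append (L := L) (n := m - r - 1) (by omega)
  have q1 := eval_comp_append (D := D) (j := j) (P := P) (i + r) hir h₂ e₂ (.comp i hi h₁ e₁ x y) z
    (L₁ := L₁ ++ M₁) (L₂ := M₂) (M₃ ++ L₃) (by simp [k1, k2]) k3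
  have q2 := eval_comp_append (D := D) (j := j) (P := P) i hi h₁ e₁ x y
    (L₁ := L₁.map (epsZ D c)) (L₂ := M₁.map (epsZ D c) ++ eval D j P z M₂ :: M₃) L₃ (by simpa)
    (by simp; omega)
  have q3 := eval_comp_append (D := D) (j := j) (P := P) i hi h₄ e₄ x (.comp r hr h₃ e₃ y z)
    (L₁ := L₁) (L₂ := M₁ ++ (M₂ ++ M₃)) L₃ k1 (by simp; omega)
  have q4 := eval_comp_append (D := D) (j := j) (P := P) r hr h₃ e₃ y z
    (L₁ := M₁) (L₂ := M₂) M₃ k2 k3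
  simp only [List.append_assoc, List.map_append, List.cons_append, List.map_map] at q1 q2 q3 q4 ⊢
  rw [q1, q2, q3, q4]
  congr 2
  refine List.map_congr_left fun v _ => ?_
  rw [Function.comp_apply, epsZ_epsZ, e₃, add_comm]

theorem eval_comp_comm (hP : IsMulti k P) (hj : D.eps j = j)
    (hPε : ∀ z, P (z.map D.oeps) = koszulSign k (1 - (z.length : ℤ)) • D.eps (P z))
    {n m l N₁ M₁ N : ℕ} {a b c e f g : ℤ} (i r s : ℕ) (hir : i < r) (hi : i < n)
    (hr : r < n) (hrs : s + 1 = r + m) (hs : s < N₁) (hi' : i < M₁)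
    (h₁ : N₁ + 1 = n + m) (h₂ : N + 1 = N₁ + l) (h₃ : M₁ + 1 = n + l) (h₄ : N + 1 = M₁ + m)
    (e₁ : e = a + b) (e₂ : g = e + c) (e₃ : f = a + c) (e₄ : g = f + b)
    (x : Term k n a) (y : Term k m b) (z : Term k l c) (L : List X) (hL : L.length = N) :
    eval D j P (.comp s hs h₂ e₂ (.comp i hi h₁ e₁ x y) z) L = koszulSign k (b * c) •
      eval D j P (.comp i hi' h₄ e₄ (.comp r hr h₃ e₃ x z) y) L := by
  obtain ⟨L₁, L, rfl, k1⟩ := exists_append (L := L) (n := i) (by omega)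
  simp only [List.length_append] at hL
  obtain ⟨L₂, L, rfl, k2⟩ := exists_append (L := L) (n := m) (by omega)
  simp only [List.length_append] at hL
  obtain ⟨L₃, L, rfl, k3⟩ := exists_append (L := L) (n := r - i - 1) (by omega)
  simp only [List.length_append] at hL
  obtain ⟨L₄, L₅, rfl, k4⟩ := exists_append (L := L) (n := l) (by omega)
  simp only [List.length_append] at hL
  have q1 := eval_comp_append (D := D) (j := j) (P := P) s hs h₂ e₂ (.comp i hi h₁ e₁ x y) z
    (L₁ := L₁ ++ (L₂ ++ L₃)) (L₂ := L₄) L₅ (by simp; omega) k4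
  have q2 := eval_comp_append (D := D) (j := j) (P := P) i hi h₁ e₁ x y
    (L₁ := L₁.map (epsZ D c)) (L₂ := L₂.map (epsZ D c))
    (L₃.map (epsZ D c) ++ eval D j P z L₄ :: L₅) (by simpa) (by simpa)
  have q3 := eval_comp_append (D := D) (j := j) (P := P) i hi' h₄ e₄ (.comp r hr h₃ e₃ x z) y
    (L₁ := L₁) (L₂ := L₂) (L₃ ++ (L₄ ++ L₅)) k1 k2
  have q4 := eval_comp_append (D := D) (j := j) (P := P) r hr h₃ e₃ x z
    (L₁ := L₁.map (epsZ D b) ++ eval D j P y L₂ :: L₃) (L₂ := L₄) L₅ (by simp; omega) k4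
  have q5 := (slotLinear_eval (D := D) (j := j) hP x).smul_slot
    ((L₁.map (epsZ D c)).map (epsZ D b)) (L₃.map (epsZ D c) ++ eval D j P z L₄ :: L₅)
    (koszulSign k (b * c)) (epsZ D c (eval D j P y L₂)) (by simp; omega)
  have q6 : (L₁.map (epsZ D c)).map (epsZ D b) = (L₁.map (epsZ D b)).map (epsZ D c) := by
    simp [epsZ_epsZ, add_comm]
  simp only [List.append_assoc, List.map_append, List.cons_append, List.map_cons]
    at q1 q2 q3 q4 ⊢
  rw [q1, q2, q3, q4, eval_map_epsZ hP hj hPε y c L₂ k2, q5, q6]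

theorem eval_d_comp (hP : IsMulti k P) (hj : D.eps j = j)
    (hPε : ∀ z, P (z.map D.oeps) = koszulSign k (1 - (z.length : ℤ)) • D.eps (P z))
    {n m N : ℕ} {a a' b b' e e' : ℤ} (i : ℕ) (hi : i < n) (hN : N + 1 = n + m)
    (he : e = a + b) (h : e + 1 = e') (ha : a + 1 = a') (hb : b + 1 = b') (he₁ : e' = a' + b)
    (he₂ : e' = a + b') (x : Term k n a) (y : Term k m b) (L : List X) (hL : L.length = N) :
    eval D j P (.d h (.comp i hi hN he x y)) L =
      eval D j P (.comp i hi hN he₁ (.d ha x) y) L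
        + koszulSign k a • eval D j P (.comp i hi hN he₂ x (.d hb y)) L := by
  obtain ⟨L₁, L, rfl, k1⟩ := exists_append (L := L) (n := i) (by omega)
  simp only [List.length_append] at hL
  obtain ⟨L₂, L₃, rfl, k2⟩ := exists_append (L := L) (n := m) (by omega)
  simp only [List.length_append] at hL
  have hx := slotLinear_eval (D := D) (j := j) hP x
  set F := eval D j P (.comp i hi hN he x y) with hF
  set f := eval D j P x with hf
  set g := eval D j P y with hg
  have qF : ∀ (L₁ L₂ L₃ : List X), L₁.length = i → L₂.length = m →
      F (L₁ ++ (L₂ ++ L₃)) = f (L₁.map (epsZ D b) ++ g L₂ :: L₃) := fun L₁ L₂ L₃ h1 h2 =>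
    eval_comp_append i hi hN he x y L₃ h1 h2
  have q4 : (L₁.map D.eps).map (epsZ D b) = (L₁.map (epsZ D b)).map D.eps := by
    rw [List.map_map, List.map_map]
    exact List.map_congr_left fun v _ => epsZ_eps b v
  have s1 : dSum D (fun L => F (L ++ (L₂ ++ L₃))) L₁ =
      koszulSign k b • dSum D (fun L => f (L ++ g L₂ :: L₃)) (L₁.map (epsZ D b)) := by
    rw [← dSum_comp_epsZ (n := i) (f := fun L => f (L ++ g L₂ :: L₃)) _ b L₁ k1]
    · exact dSum_congr _ fun L' hL' => qF _ _ _ (by omega) k2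
    · intro A B c v w hn
      simpa using hx A (B ++ g L₂ :: L₃) c v w (by simp; omega)
  have s2 : dSum D (fun L => F (L₁.map D.eps ++ (L ++ L₃))) L₂ =
      f ((L₁.map D.eps).map (epsZ D b) ++ dSum D g L₂ :: L₃) := by
    let φ : X →ₗ[k] X :=
      { toFun := fun v => f ((L₁.map D.eps).map (epsZ D b) ++ v :: L₃)
        map_add' := fun v w => hx.add_slot _ _ _ _ (by simp; omega)
        map_smul' := fun c v => hx.smul_slot _ _ _ _ (by simp; omega) }
    have := map_dSum (D := D) φ g L₂
    refine Eq.trans ?_ this.symm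
    exact dSum_congr _ fun L' hL' => qF _ _ _ (by simpa) (by omega)
  have s3 : dSum D (fun L => F (L₁.map D.eps ++ (L₂.map D.eps ++ L))) L₃ = koszulSign k b •
      dSum D (fun L => f ((L₁.map (epsZ D b)).map D.eps ++ D.eps (g L₂) :: L)) L₃ := by
    rw [← dSum_smul]
    refine dSum_congr _ fun L' hL' => ?_
    rw [qF _ _ _ (by simpa) (by simpa), hg, eval_map_eps hP hj hPε y L₂ k2,
      hx.smul_slot _ _ _ _ (by simp; omega), q4]
  have s4 : dSum D F (L₁ ++ (L₂ ++ L₃)) =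
      koszulSign k b • dSum D (fun L => f (L ++ g L₂ :: L₃)) (L₁.map (epsZ D b))
      + (f ((L₁.map D.eps).map (epsZ D b) ++ dSum D g L₂ :: L₃)
      + koszulSign k b •
        dSum D (fun L => f ((L₁.map (epsZ D b)).map D.eps ++ D.eps (g L₂) :: L)) L₃) := by
    rw [dSum_append, dSum_append, s1, s2, s3]
  have s5 : dSum D f (L₁.map (epsZ D b) ++ g L₂ :: L₃) =
      dSum D (fun L => f (L ++ g L₂ :: L₃)) (L₁.map (epsZ D b))
      + (f ((L₁.map (epsZ D b)).map D.eps ++ D.d (g L₂) :: L₃)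
      + dSum D (fun L => f ((L₁.map (epsZ D b)).map D.eps ++ D.eps (g L₂) :: L)) L₃) := by
    rw [dSum_append, dSum_cons]
  have q1 := eval_comp_append (D := D) (j := j) (P := P) i hi hN he₁ (.d ha x) y
    (L₁ := L₁) (L₂ := L₂) L₃ k1 k2
  have q2 := eval_comp_append (D := D) (j := j) (P := P) i hi hN he₂ x (.d hb y)
    (L₁ := L₁) (L₂ := L₂) L₃ k1 k2
  have q3 : L₁.map (epsZ D b') = (L₁.map (epsZ D b)).map D.eps := by
    rw [List.map_map]
    refine List.map_congr_left fun v _ => ?_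
    rw [Function.comp_apply, ← hb]
    by_cases hb' : Even b <;>
      simp [epsZ, hb', ← Int.not_even_iff_odd, D.eps_eps]
  have q5 := hx ((L₁.map (epsZ D b)).map D.eps) L₃ (-koszulSign k b) (dSum D g L₂) (D.d (g L₂))
    (by simp; omega)
  have q6 : eval D j P (.d hb y) L₂ = (-koszulSign k b) • dSum D g L₂ + D.d (g L₂) := by
    rw [eval, neg_smul, sub_eq_neg_add]
  have q7 : ∀ L, eval D j P (.d h (.comp i hi hN he x y)) L =
      D.d (F L) - koszulSign k e • dSum D F L := fun _ => rfl
  have q8 : ∀ L, eval D j P (.d ha x) L = D.d (f L) - koszulSign k a • dSum D f L := fun _ => rfl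
  rw [q1, q2, q6, q3, ← hf, q5, q7, q8, ← hg, s4, s5, qF _ _ _ k1 k2, he, koszulSign_add, q4]
  have hs := koszulSign_mul_self k b
  have hs' : koszulSign k a * koszulSign k b * koszulSign k b = koszulSign k a := by
    rw [_root_.mul_assoc, hs, mul_one]
  simp only [smul_add, smul_smul, hs', neg_smul, smul_neg]
  abel

/-- The interpretation of formal expressions respects the relations, as soon as the operations
`p` satisfy the relations (iii), (iv) and (v). -/
theorem eval_eq_of_rel (hP : IsMulti k P) (hj : D.eps j = j) (hdj : D.d j = 0)
    (hjj : D.mul j j = j)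
    (hPε : ∀ z, P (z.map D.oeps) = koszulSign k (1 - (z.length : ℤ)) • D.eps (P z))
    (hc : ∀ l, 2 ≤ l → P (List.replicate l none) = 0)
    (hs : ∀ L : List X, 2 ≤ L.length → P (L.map some) = 0)
    (h1 : P [none] = j) (h2 : ∀ x, P [some x] = x)
    (hd : ∀ (w : List Bool) (_ : 1 ≤ w.length) (L : List X), L.length = w.count false →
      D.d (P (fill w L)) -
          koszulSign k (1 - (w.length : ℤ)) • dSum D (fun L => P (fill w L)) L =
        eval D j P (Term.dp k w rfl rfl) L)
    {n : ℕ} {a : ℤ} {t t' : Term k n a} (h : Rel k t t') (L : List X) (hL : L.length = n) :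
    eval D j P t L = eval D j P t' L := by
  induction h generalizing L with
  | comp_left i hi hN he y h ih =>
    simp only [eval]
    exact ih _ (by simp; omega)
  | comp_right i hi hN he x h ih =>
    simp only [eval]
    rw [ih _ (by simp; omega)]
  | d_congr h hx ih =>
    simp only [eval]
    rw [ih L hL, dSum_congr L fun L' hL' => ih L' (hL'.trans hL)]
  | add_left y h ih => simp only [eval, ih L hL]
  | add_right x h ih => simp only [eval, ih L hL]
  | smul_congr c h ih => simp only [eval, ih L hL]
  | add_assoc x y z => simp only [eval, add_assoc]
  | add_comm x y => simp only [eval, add_comm]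
  | zero_add x => simp only [eval, zero_add]
  | neg_add_cancel x => simp [eval]
  | smul_add c x y => simp only [eval, smul_add]
  | add_smul c c' x => simp only [eval, add_smul]
  | mul_smul c c' x => simp only [eval, mul_smul]
  | one_smul x => simp only [eval, one_smul]
  | comp_add_left i hi hN he x x' y => simp only [eval]
  | comp_smul_left i hi hN he c x y => simp only [eval]
  | comp_add_right i hi hN he x y y' =>
    simp only [eval]
    exact (slotLinear_eval hP x).add_slot _ _ _ _ (by simp; omega)
  | comp_smul_right i hi hN he c x y =>
    simp only [eval]
    exact (slotLinear_eval hP x).smul_slot _ _ _ _ (by simp; omega)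
  | d_add h x y =>
    simp only [eval, dSum_add, map_add, smul_add]; abel
  | d_smul h c x =>
    simp only [eval, dSum_smul, map_smul, smul_sub, smul_comm c]
  | d_d h h' x =>
    rename_i n a b c
    have e1 : dSum D (eval D j P (.d h x)) L = dSum D (fun L => D.d (eval D j P x L)) L := by
      have := dSum_add (D := D) (fun L => D.d (eval D j P x L))
        (fun L => (-koszulSign k a) • dSum D (eval D j P x) L) L
      rw [dSum_smul, dSum_dSum (slotLinear_eval hP x) L hL, smul_zero, add_zero] at this
      rw [← this]
      exact dSum_congr _ fun L' _ => by simp [eval, sub_eq_add_neg]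
    rw [eval, e1, eval, eval, map_sub, D.d_d, map_smul, map_dSum, ← h, koszulSign_add,
      koszulSign_odd k (a := 1) (by decide)]
    simp
  | d_one h =>
    obtain ⟨x, rfl⟩ := List.length_eq_one_iff.mp hL
    simp [eval, dSum_cons]
  | one_comp hi hN he x =>
    simp [eval, ← hL]
  | comp_one i hi hN he x =>
    obtain ⟨L₁, L, rfl, k1⟩ := exists_append (L := L) (n := i) (by omega)
    simp only [List.length_append] at hL
    obtain ⟨L₂, L₃, rfl, k2⟩ := exists_append (L := L) (n := 1) (by omega)
    rw [eval_comp_append i hi hN he x _ L₃ k1 k2]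
    obtain ⟨y, rfl⟩ := List.length_eq_one_iff.mp k2
    have : L₁.map (epsZ D 0) = L₁ :=
      (List.map_congr_left fun v _ => epsZ_zero v).trans (List.map_id L₁)
    simp [eval, this]
  | comp_assoc i r hi hr hir h₁ h₂ h₃ h₄ e₁ e₂ e₃ e₄ x y z =>
    exact eval_comp_assoc i r hi hr hir h₁ h₂ h₃ h₄ e₁ e₂ e₃ e₄ x y z L hL
  | comp_comm i r s hir hi hr hrs hs hi' h₁ h₂ h₃ h₄ e₁ e₂ e₃ e₄ x y z =>
    exact eval_comp_comm hP hj hPε i r s hir hi hr hrs hs hi' h₁ h₂ h₃ h₄ e₁ e₂ e₃ e₄ x y z L hL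
  | d_comp i hi hN he h ha hb he₁ he₂ x y =>
    exact eval_d_comp hP hj hPε i hi hN he h ha hb he₁ he₂ x y L hL
  | m_assoc h₀ h₁ hN he =>
    obtain ⟨x, y, z, rfl⟩ := List.length_eq_three.mp hL
    simp [eval, D.mul_assoc]
  | d_m h =>
    obtain ⟨x, y, rfl⟩ := List.length_eq_two.mp hL
    simp [eval, dSum_cons, D.d_mul]
  | m_j_j h₀ h₁ hN hN' he =>
    simp [eval, hjj]
  | d_j h =>
    obtain rfl := List.length_eq_zero_iff.mp hL
    simp [eval, hdj]
  | p_const c l hl hw hn ha =>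
    simp only [eval]
    cases c with
    | true =>
      have : ∀ l (L : List X), fill (List.replicate l true) L = List.replicate l none := by
        intro l
        induction l with
        | zero => intro L; rfl
        | succ l ih => intro L; simp [List.replicate_succ, fill, ih]
      rw [this, hc l hl]
    | false =>
      have : ∀ l (L : List X), L.length = l → fill (List.replicate l false) L = L.map some := by
        intro l
        induction l with
        | zero => intro L h; obtain rfl := List.length_eq_zero_iff.mp h; rfl
        | succ l ih =>
          intro L h
          cases L with
          | nil => simp at h
          | cons x L => simp [List.replicate_succ, fill, ih L (by simpa using h)]
      have hl' : L.length = l := by simpa using hL.trans hn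
      rw [this l L hl', hs L (by omega)]
  | p_true hw hn ha => simp [eval, fill, h1]
  | p_false hw hn ha =>
    obtain ⟨x, rfl⟩ := List.length_eq_one_iff.mp hL
    simp [eval, fill, h2]
  | d_p w hw hn ha h hb =>
    subst hn ha hb
    simpa only [eval] using hd w hw L hL

end Eval
end WeaklyUnital

namespace WeaklyUnital

/-! ### The differential of the operations `p` -/

section Twist

open ParityDga

variable {k : Type u} [Field k] {X : Type*} [AddCommGroup X] [Module k X] (D : ParityDga k X)

/-- The operator `ε ^ a` on `X ∪ {1}`. -/
def oepsZ (a : ℤ) (z : Option X) : Option X := z.map (epsZ D a)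

/-- The word `ε ^ (n - 1) z₁, …, ε zₙ₋₁, zₙ`. It relates the operadic sign conventions, in which
`p` has degree `1 - n`, to those of the bar construction, in which it has degree `1`. -/
def twist : List (Option X) → List (Option X)
  | [] => []
  | z :: L => oepsZ D L.length z :: twist L

variable {D}

theorem oeps_eq (z : Option X) : D.oeps z = oepsZ D 1 z := by
  cases z <;> simp [oepsZ, epsZ]

theorem oepsZ_oepsZ (a b : ℤ) (z : Option X) : oepsZ D a (oepsZ D b z) = oepsZ D (b + a) z := by
  cases z <;> simp [oepsZ, epsZ_epsZ]

theorem oepsZ_even {a : ℤ} (h : Even a) (z : Option X) : oepsZ D a z = z := by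
  cases z <;> simp [oepsZ, epsZ_even h]

theorem oepsZ_congr {a b : ℤ} (h : Even (b - a)) (z : Option X) : oepsZ D a z = oepsZ D b z := by
  rw [← oepsZ_even (D := D) h (oepsZ D a z), oepsZ_oepsZ, add_sub_cancel]

theorem omul_oepsZ (a : ℤ) (z z' : Option X) :
    D.omul (oepsZ D a z) (oepsZ D a z') = oepsZ D a (D.omul z z') := by
  cases z <;> cases z' <;> simp [oepsZ, epsZ]
  split_ifs <;> simp [D.eps_mul]

@[simp] theorem length_twist (L : List (Option X)) : (twist D L).length = L.length := by
  induction L with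
  | nil => rfl
  | cons z L ih => simp [twist, ih]

theorem twist_map (a : ℤ) (L : List (Option X)) :
    twist D (L.map (oepsZ D a)) = (twist D L).map (oepsZ D a) := by
  induction L with
  | nil => rfl
  | cons z L ih => simp [twist, ih, oepsZ_oepsZ, add_comm]

theorem map_oepsZ_oepsZ (a b : ℤ) (L : List (Option X)) :
    (L.map (oepsZ D a)).map (oepsZ D b) = L.map (oepsZ D (a + b)) := by
  rw [List.map_map]
  exact List.map_congr_left fun z _ => oepsZ_oepsZ b a z

theorem map_oepsZ_congr {a b : ℤ} (h : Even (b - a)) (L : List (Option X)) :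
    L.map (oepsZ D a) = L.map (oepsZ D b) :=
  List.map_congr_left fun z _ => oepsZ_congr h z

theorem map_oeps (L : List (Option X)) : L.map D.oeps = L.map (oepsZ D 1) :=
  List.map_congr_left fun z _ => oeps_eq z

theorem twist_twist (L : List (Option X)) : twist D (twist D L) = L := by
  induction L with
  | nil => rfl
  | cons z L ih => rw [twist, twist, length_twist, oepsZ_oepsZ, ih, oepsZ_even ⟨_, rfl⟩]

theorem twist_append (L₁ L₂ : List (Option X)) :
    twist D (L₁ ++ L₂) = (twist D L₁).map (oepsZ D L₂.length) ++ twist D L₂ := by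
  induction L₁ with
  | nil => rfl
  | cons z L ih => simp [twist, ih, oepsZ_oepsZ]

theorem isMulti_twist {M : Type*} [AddCommGroup M] [Module k M] {φ : List (Option X) → M}
    (h : IsMulti k φ) : IsMulti k fun L => φ (twist D L) := by
  constructor
  · intro L₁ L₂ x y
    simp only [twist_append, twist, oepsZ, Option.map_some, map_add, List.length_cons]
    exact h.add _ _ _ _
  · intro L₁ L₂ c x
    simp only [twist_append, twist, oepsZ, Option.map_some, map_smul, List.length_cons]
    exact h.smul _ _ _ _

theorem twist_replicate_none (n : ℕ) :
    twist D (List.replicate n none) = List.replicate n none := by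
  induction n with
  | zero => rfl
  | succ n ih => simp [List.replicate_succ, twist, ih, oepsZ]

theorem twist_map_some (L : List X) : ∃ L' : List X, L'.length = L.length ∧
    twist D (L.map some) = L'.map some := by
  induction L with
  | nil => exact ⟨[], rfl, rfl⟩
  | cons x L ih =>
    obtain ⟨L', h, h'⟩ := ih
    exact ⟨epsZ D L.length x :: L', by simp [h], by simp [twist, h', oepsZ]⟩

variable {M : Type*} [AddCommGroup M] [Module k M]

variable (D) in
/-- The part of `bar` that comes from the differential, in the operadic sign convention. -/
def dPart : (List (Option X) → M) → List (Option X) → M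
  | _, [] => 0
  | φ, z :: L => D.dTerm φ z L + dPart (fun L' => φ (D.oeps z :: L')) L

variable (D) in
/-- The part of `bar` that comes from the product, in the operadic sign convention. -/
def mPart : (List (Option X) → M) → List (Option X) → M
  | _, [] => 0
  | _, [_] => 0
  | φ, z :: z' :: L => φ (D.omul z z' :: L) - mPart (fun L' => φ (z :: L')) (z' :: L)

theorem dPart_congr {φ ψ : List (Option X) → M} (L : List (Option X))
    (h : ∀ L' : List (Option X), L'.length = L.length → φ L' = ψ L') :
    dPart D φ L = dPart D ψ L := by
  induction L generalizing φ ψ with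
  | nil => rfl
  | cons z L ih =>
    rw [dPart, dPart, ih fun L' hL' => h _ (by simpa using hL')]
    congr 1
    cases z with
    | none => rfl
    | some x => exact h _ rfl

theorem mPart_congr {φ ψ : List (Option X) → M} (L : List (Option X))
    (h : ∀ L' : List (Option X), L'.length + 1 = L.length → φ L' = ψ L') :
    mPart D φ L = mPart D ψ L := by
  induction L generalizing φ ψ with
  | nil => rfl
  | cons z L ih =>
    cases L with
    | nil => rfl
    | cons z' L =>
      rw [mPart, mPart, ih fun L' hL' => h _ (by simpa using hL'), h _ (by simp)]

/-- Under the twist, the bar differential becomes the sum of the two operadic parts. -/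
theorem bar_twist {φ : List (Option X) → M} (hφ : IsMulti k φ) (L : List (Option X)) :
    D.bar 0 φ (twist D L) = koszulSign k (1 - (L.length : ℤ)) • dPart D (fun L => φ (twist D L)) L
      + mPart D (fun L => φ (twist D L)) L := by
  induction L generalizing φ with
  | nil => simp [twist, dPart, mPart]
  | cons z L ih =>
    have hs : koszulSign k (1 - ((L.length + 1 : ℕ) : ℤ)) = -koszulSign k (1 - (L.length : ℤ)) := by
      rw [← neg_one_mul, ← koszulSign_odd k (a := -1) (by decide), ← koszulSign_add]
      congr 1
      push_cast
      ring
    have h1 : D.dTerm φ (oepsZ D L.length z) (twist D L) =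
        -koszulSign k (1 - (L.length : ℤ)) • D.dTerm (fun L => φ (twist D L)) z L := by
      cases z with
      | none => simp [oepsZ]
      | some x =>
        have h := hφ.smul [] (twist D L) (koszulSign k L.length) (epsZ D L.length (D.d x))
        simp only [List.nil_append] at h
        have hs' : koszulSign k (L.length : ℤ) = -koszulSign k (1 - (L.length : ℤ)) := by
          rw [← neg_one_mul, ← koszulSign_odd k (a := -1) (by decide), ← koszulSign_add]
          by_cases hL : Even (L.length : ℤ)
          · rw [koszulSign_even k hL,
              koszulSign_even k (by simpa [Int.even_add, Int.even_sub] using hL)]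
          · rw [koszulSign_odd k hL,
              koszulSign_odd k (by simpa [Int.even_add, Int.even_sub] using hL)]
        simp [oepsZ, twist, d_epsZ, h, ← hs']
    have h2 : D.mTerm 0 φ (oepsZ D L.length z) (twist D L)
        - mPart D (fun L' => φ (D.oeps (oepsZ D L.length z) :: twist D L')) L =
        mPart D (fun L => φ (twist D L)) (z :: L) := by
      cases L with
      | nil => simp [twist, mPart]
      | cons z' L =>
        rw [mPart, twist, mTerm_cons, oeps_eq, oepsZ_oepsZ,
          oepsZ_congr (b := L.length) (by simp [Int.even_sub]), omul_oepsZ]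
        congr 1
        refine mPart_congr _ fun L' hL' => ?_
        rw [twist]
        congr 2
        exact oepsZ_congr (by simp at hL'; simp [hL']) z
    have h3 : dPart D (fun L' => φ (D.oeps (oepsZ D L.length z) :: twist D L')) L =
        dPart D (fun L' => φ (twist D (D.oeps z :: L'))) L := by
      refine dPart_congr _ fun L' hL' => ?_
      rw [twist, oeps_eq, oeps_eq, oepsZ_oepsZ, oepsZ_oepsZ, hL', add_comm]
    rw [twist, bar_cons, ih (hφ.cons _), h1, h3, ← h2, dPart, List.length_cons, hs]
    simp only [neg_smul, smul_add]
    abel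

theorem cut_eq_sum {α N : Type*} [AddCommGroup N] [Module k N] (la : X →ₗ[k] N →ₗ[k] M)
    (τ : List α → X) (φ : List α → N) (L : List α) :
    cut la τ φ L =
      ∑ i ∈ Finset.range L.length, la (τ (L.take (i + 1))) (φ (L.drop (i + 1))) := by
  induction L generalizing τ with
  | nil => rfl
  | cons z L ih =>
    rw [cut_cons, ih, List.length_cons, Finset.sum_range_succ', add_comm]
    simp

theorem mPart_eq_sum (φ : List (Option X) → M) (L : List (Option X)) :
    mPart D φ L = ∑ i ∈ Finset.range (L.length - 1), (-1 : k) ^ i •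
      φ (L.take i ++ D.omul (L.getD i none) (L.getD (i + 1) none) :: L.drop (i + 2)) := by
  induction L generalizing φ with
  | nil => rfl
  | cons z L ih =>
    cases L with
    | nil => rfl
    | cons z' L =>
      rw [mPart, ih, List.length_cons (as := z' :: L), Nat.add_sub_cancel,
        List.length_cons, Nat.add_sub_cancel, Finset.sum_range_succ', sub_eq_add_neg,
        ← Finset.sum_neg_distrib, add_comm]
      simp [pow_succ]

/-- Under the twist, the cut product becomes the sum of the `m ∘ (p, p)` in the differential of the
operations `p`. -/
theorem cut_twist {τ : List (Option X) → X} (h0 : τ [] = 0) (L : List (Option X)) :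
    cut D.mul (D.sbar τ) τ (twist D L) = ∑ i ∈ Finset.range (L.length - 1), (-1 : k) ^ (i + 1) •
      D.mul (τ (twist D ((L.take (i + 1)).map (oepsZ D (1 - ((L.drop (i + 1)).length : ℤ))))))
        (τ (twist D (L.drop (i + 1)))) := by
  have key : ∀ i, i + 1 ≤ L.length →
      D.mul (D.sbar τ ((twist D L).take (i + 1))) (τ ((twist D L).drop (i + 1))) =
      (-1 : k) ^ (i + 1) • D.mul
        (τ (twist D ((L.take (i + 1)).map (oepsZ D (1 - ((L.drop (i + 1)).length : ℤ))))))
        (τ (twist D (L.drop (i + 1)))) := by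
    intro i hi
    obtain ⟨A, B, rfl, hA⟩ := exists_append hi
    have h1 : ((twist D A).map (oepsZ D B.length)).length = i + 1 := by simpa
    rw [twist_append, ← h1, List.take_left, List.drop_left, h1, ← hA, List.take_left,
      List.drop_left, ParityDga.sbar, map_smul, LinearMap.smul_apply, List.length_map, length_twist,
      map_oeps, map_oepsZ_oepsZ, twist_map,
      map_oepsZ_congr (b := 1 - (B.length : ℤ)) (by simp [Int.even_sub])]
  rw [cut_eq_sum, length_twist]
  cases hL : L.length with
  | zero => rfl
  | succ n =>
    rw [Finset.sum_range_succ, List.drop_eq_nil_of_le (by simp [hL]), h0, map_zero, add_zero,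
      Nat.add_sub_cancel]
    refine Finset.sum_congr rfl fun i hi => key i ?_
    have := Finset.mem_range.mp hi
    omega

/-- The word in `true`, `false` that records which letters are formal units. -/
def shape (L : List (Option X)) : List Bool := L.map Option.isNone

/-- The letters that are not formal units. -/
def inputs : List (Option X) → List X
  | [] => []
  | none :: L => inputs L
  | some x :: L => x :: inputs L

@[simp] theorem length_shape (L : List (Option X)) : (shape L).length = L.length :=
  List.length_map _

theorem inputs_append (L₁ L₂ : List (Option X)) :
    inputs (L₁ ++ L₂) = inputs L₁ ++ inputs L₂ := by
  induction L₁ with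
  | nil => rfl
  | cons z L ih => cases z <;> simp [inputs, ih]

@[simp] theorem length_inputs (L : List (Option X)) :
    (inputs L).length = (shape L).count false := by
  induction L with
  | nil => rfl
  | cons z L ih => cases z <;> simp [inputs, shape, ih]

theorem fill_shape_inputs (L : List (Option X)) : fill (shape L) (inputs L) = L := by
  induction L with
  | nil => rfl
  | cons z L ih => cases z <;> simpa [inputs, shape, fill] using ih

theorem shape_fill (w : List Bool) (L : List X) (h : L.length = w.count false) :
    shape (fill w L) = w ∧ inputs (fill w L) = L := by
  induction w generalizing L with
  | nil => simpa [fill, shape, inputs] using h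
  | cons c w ih =>
    cases c with
    | true => simpa [fill, shape, inputs] using ih L (by simpa using h)
    | false =>
      cases L with
      | nil => simp at h
      | cons x L => simpa [fill, shape, inputs] using ih L (by simpa using h)

theorem dSum_fill (P : List (Option X) → X) (L : List (Option X)) :
    dSum D (fun L' => P (fill (shape L) L')) (inputs L) = dPart D P L := by
  induction L generalizing P with
  | nil => rfl
  | cons z L ih =>
    cases z with
    | none =>
      rw [dPart, dTerm_none, zero_add, ← ih]
      rfl
    | some x =>
      rw [dPart, ← ih, inputs, dSum_cons]
      simp only [shape, List.map_cons, Option.isNone_some, fill, dTerm_some, oeps_some]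
      rw [show L.map Option.isNone = shape L from rfl, fill_shape_inputs]

variable {j : X} {P : List (Option X) → X}

theorem eval_sum {n : ℕ} {a : ℤ} (T : List (Term k n a)) (L : List X) :
    eval D j P (Term.sum T) L = (T.map fun t => eval D j P t L).sum := by
  induction T with
  | nil => rfl
  | cons t T ih => simpa [Term.sum, eval] using ih

theorem eval_cut {u v : List Bool} (hu : 1 ≤ u.length) (hv : 1 ≤ v.length) {n : ℕ} {a : ℤ}
    (hn : n = u.count false + v.count false) (ha : a = 2 - ((u.length : ℤ) + (v.length : ℤ)))
    {L₁ L₂ : List (Option X)} (h₁ : u = shape L₁) (h₂ : v = shape L₂) :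
    eval D j P (Term.cut k u v hu hv hn ha) (inputs L₁ ++ inputs L₂) =
      D.mul (P (L₁.map (oepsZ D (1 - (L₂.length : ℤ))))) (P L₂) := by
  subst h₁ h₂ hn ha
  have h3 : fill (shape L₂) (inputs L₂) = L₂ := fill_shape_inputs L₂
  have h4 : fill (shape L₁) ((inputs L₁).map (epsZ D (1 - (L₂.length : ℤ)))) =
      L₁.map (oepsZ D (1 - (L₂.length : ℤ))) := by
    rw [fill_map, fill_shape_inputs]
    rfl
  rw [Term.cut, ← List.append_nil (inputs L₂), eval_comp_append _ _ _ _ _ _ []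
    (length_inputs L₁) (length_inputs L₂)]
  have := eval_comp_append (D := D) (j := j) (P := P) 0 Nat.zero_lt_two
    (N := (shape L₁).count false + 1) (e := 1 - ((shape L₁).length : ℤ)) (by omega)
    (by omega) Term.m (.p (shape L₁) hu rfl rfl) (L₁ := [])
    (L₂ := (inputs L₁).map (epsZ D (1 - ((shape L₂).length : ℤ))))
    [eval D j P (.p (shape L₂) hv rfl rfl) (inputs L₂)] rfl (by simp)
  rw [List.nil_append] at this
  rw [this]
  simp [eval, h3, h4]

theorem eval_merge {u v : List Bool} {x y : Bool} {n : ℕ} {a : ℤ}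
    (hn : n = (u ++ x :: y :: v).count false) (ha : a = 2 - ((u ++ x :: y :: v).length : ℤ))
    {L₁ L₂ : List (Option X)} {z z' : Option X} (h₁ : u = shape L₁) (h₂ : v = shape L₂)
    (hx : x = z.isNone) (hy : y = z'.isNone) :
    eval D j P (Term.merge k u v x y hn ha) (inputs (L₁ ++ z :: z' :: L₂)) =
      P (L₁ ++ D.omul z z' :: L₂) := by
  subst h₁ h₂ hx hy hn ha
  have key : ∀ z, fill (shape L₁ ++ z.isNone :: shape L₂) (inputs L₁ ++ inputs (z :: L₂)) =
      L₁ ++ z :: L₂ := fun z => by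
    have := fill_shape_inputs (L₁ ++ z :: L₂)
    rwa [inputs_append, shape, List.map_append] at this
  have k1 := congrArg P (key none)
  have k2 := fun x => congrArg P (key (some x))
  rw [inputs_append]
  cases z with
  | none =>
    cases z' with
    | none => simpa [Term.merge, eval, inputs] using k1
    | some y => simpa [Term.merge, eval, inputs] using k2 y
  | some x =>
    cases z' with
    | none => simpa [Term.merge, eval, inputs] using k2 x
    | some y =>
      simp only [Option.isNone_some, Term.merge, inputs]
      rw [show inputs L₁ ++ x :: y :: inputs L₂ = inputs L₁ ++ ([x, y] ++ inputs L₂) from rfl,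
        eval_comp_append (m := 2) _ _ _ _ _ _ (L₂ := [x, y]) _ (length_inputs L₁) rfl,
        (List.map_congr_left fun v _ => epsZ_zero v).trans (List.map_id (inputs L₁))]
      exact k2 (D.mul x y)

/-- The value of the right-hand side of the formula for `d p`, in closed form. -/
theorem eval_dp (L : List (Option X)) {n : ℕ} {a : ℤ}
    (hn : n = (shape L).count false) (ha : a = 2 - ((shape L).length : ℤ)) :
    eval D j P (Term.dp k (shape L) hn ha) (inputs L) =
      (∑ i ∈ Finset.range (L.length - 1), (-1 : k) ^ (i + 1) •
        D.mul (P ((L.take (i + 1)).map (oepsZ D (1 - ((L.drop (i + 1)).length : ℤ)))))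
          (P (L.drop (i + 1)))) + mPart D P L := by
  have hl : (shape L).length - 1 = L.length - 1 := by simp
  rw [Term.dp, eval, eval_sum, eval_sum, List.map_map, List.map_map, ← Fin.sum_univ_def,
    ← Fin.sum_univ_def, mPart_eq_sum, ← hl, ← Fin.sum_univ_eq_sum_range
      fun i => (-1 : k) ^ (i + 1) •
        D.mul (P ((L.take (i + 1)).map (oepsZ D (1 - ((L.drop (i + 1)).length : ℤ)))))
          (P (L.drop (i + 1))), ← Fin.sum_univ_eq_sum_range fun i => (-1 : k) ^ i •
      P (L.take i ++ D.omul (L.getD i none) (L.getD (i + 1) none) :: L.drop (i + 2))]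
  congr 1
  · refine Finset.sum_congr rfl fun i _ => ?_
    have h := eval_cut (D := D) (j := j) (P := P) (u := (shape L).take (i + 1)) (n := n)
      (a := a) (v := (shape L).drop (i + 1))
      (by have := i.2; simp only [List.length_take]; omega)
      (by have := i.2; simp only [List.length_drop]; omega)
      (by rw [← List.count_append, List.take_append_drop, hn])
      (by have := i.2; simp only [List.length_take, List.length_drop]; omega)
      (L₁ := L.take (i + 1)) (L₂ := L.drop (i + 1))
      List.map_take.symm List.map_drop.symm
    have hL : inputs L = inputs (L.take (i + 1)) ++ inputs (L.drop (i + 1)) := by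
      rw [← inputs_append, List.take_append_drop]
    simp only [Function.comp_apply, eval]
    exact congrArg _ ((congrArg _ hL).trans h)
  · refine Finset.sum_congr rfl fun i _ => ?_
    have hi : (i : ℕ) + 1 < L.length := by have := i.2; omega
    have hL : L = L.take i ++ L.getD i none :: L.getD (i + 1) none :: L.drop (i + 2) := by
      rw [List.getD_eq_getElem _ _ hi, List.getD_eq_getElem _ _ (by omega),
        List.getElem_cons_drop, List.getElem_cons_drop, List.take_append_drop]
    have h := eval_merge (D := D) (j := j) (P := P) (u := (shape L).take i)
      (v := (shape L).drop (i + 2)) (n := n) (a := a) (x := (shape L)[(i : ℕ)]'(by omega))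
      (y := (shape L)[(i : ℕ) + 1]'(by omega))
      (by rw [Term.split_eq _ _ (by omega), hn]) (by rw [Term.split_eq _ _ (by omega), ha])
      (L₁ := L.take i) (L₂ := L.drop (i + 2)) (z := L.getD i none) (z' := L.getD (i + 1) none)
      List.map_take.symm List.map_drop.symm
      (by rw [List.getD_eq_getElem _ _ (by omega)]; simp [shape])
      (by rw [List.getD_eq_getElem _ _ hi]; simp [shape])
    simp only [Function.comp_apply, eval]
    exact congrArg _ ((congrArg (fun L => eval D j P _ (inputs L)) hL).trans h)

/-- The formula for the differential of the operations `p` is the Maurer-Cartan equation for the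
twisted operation `τ`. -/
theorem eval_dp_add_dPart {τ : List (Option X) → X} (hτ : IsMulti k τ) (h0 : τ [] = 0)
    (L : List (Option X)) {n : ℕ} {a : ℤ}
    (hn : n = (shape L).count false) (ha : a = 2 - ((shape L).length : ℤ)) :
    eval D j (fun L => τ (twist D L)) (Term.dp k (shape L) hn ha) (inputs L) +
      koszulSign k (1 - (L.length : ℤ)) • dPart D (fun L => τ (twist D L)) L =
    D.bar 0 τ (twist D L) + cut D.mul (D.sbar τ) τ (twist D L) := by
  rw [eval_dp, bar_twist hτ, cut_twist h0]
  abel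

end Twist
end WeaklyUnital

namespace WeaklyUnital

/-! ### The total space of a dg operad -/

/-- The direct sum of the spaces of operations of all arities and degrees. Plugging operations into
operations makes it the free algebra on one generator, the identity operation. -/
abbrev Tot {k : Type u} [Field k] (Q : DgOperad k) : Type u :=
  DirectSum (ℕ × ℤ) fun p => Q.obj p.1 p.2

namespace Tot

variable {k : Type u} [Field k] (Q : DgOperad k)

/-- The inclusion of the operations of arity `n` and degree `a`. -/
def inc (n : ℕ) (a : ℤ) : Q.obj n a →ₗ[k] Tot Q :=
  DirectSum.lof k (ℕ × ℤ) (fun p => Q.obj p.1 p.2) (n, a)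

/-- The parity operator. -/
def eps : Tot Q →ₗ[k] Tot Q :=
  DirectSum.toModule k (ℕ × ℤ) (Tot Q) fun p => koszulSign k p.2 • inc Q p.1 p.2

/-- The differential. -/
def d : Tot Q →ₗ[k] Tot Q :=
  DirectSum.toModule k (ℕ × ℤ) (Tot Q) fun p => inc Q p.1 (p.2 + 1) ∘ₗ Q.d rfl

/-- Insertion into the input which has `q` inputs to its right. It is zero on operations that have
at most `q` inputs. -/
def ins (q : ℕ) : Tot Q →ₗ[k] Tot Q →ₗ[k] Tot Q :=
  DirectSum.toModule k (ℕ × ℤ) _ fun p => LinearMap.flip <|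
    DirectSum.toModule k (ℕ × ℤ) _ fun r => LinearMap.flip <|
      if h : q < p.1 then
        (Q.comp (N := p.1 - 1 + r.1) (p.1 - 1 - q) (by omega) (by omega) rfl).compr₂
          (inc Q (p.1 - 1 + r.1) (p.2 + r.2))
      else 0

variable {Q}

theorem ext_inc {M : Type*} [AddCommGroup M] [Module k M] {f g : Tot Q →ₗ[k] M}
    (h : ∀ n a x, f (inc Q n a x) = g (inc Q n a x)) (x : Tot Q) : f x = g x :=
  LinearMap.congr_fun (DirectSum.linearMap_ext k fun p => LinearMap.ext fun y => h p.1 p.2 y) x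

@[simp] theorem eps_inc {n : ℕ} {a : ℤ} (x : Q.obj n a) :
    eps Q (inc Q n a x) = koszulSign k a • inc Q n a x := by
  rw [eps, inc, DirectSum.toModule_lof]
  rfl

theorem d_inc {n : ℕ} {a b : ℤ} (h : a + 1 = b) (x : Q.obj n a) :
    d Q (inc Q n a x) = inc Q n b (Q.d h x) := by
  subst h
  rw [d, inc, DirectSum.toModule_lof]
  rfl

theorem ins_inc {n m N : ℕ} {a b e : ℤ} {q i : ℕ} (hq : i + q + 1 = n) (hi : i < n)
    (hN : N + 1 = n + m) (he : e = a + b) (x : Q.obj n a) (y : Q.obj m b) :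
    ins Q q (inc Q n a x) (inc Q m b y) = inc Q N e (Q.comp i hi hN he x y) := by
  obtain rfl : i = n - 1 - q := by omega
  obtain rfl : N = n - 1 + m := by omega
  subst he
  have h : q < n := by omega
  simp [ins, inc, DirectSum.toModule_lof, h]

theorem ins_inc_of_le {n : ℕ} {a : ℤ} {q : ℕ} (hq : n ≤ q) (x : Q.obj n a) (y : Tot Q) :
    ins Q q (inc Q n a x) y = 0 := by
  refine ext_inc (f := ins Q q (inc Q n a x)) (g := 0) (fun m b y => ?_) y
  simp [ins, inc, DirectSum.toModule_lof, hq.not_gt]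

theorem eps_eps (x : Tot Q) : eps Q (eps Q x) = x := by
  refine ext_inc (f := eps Q ∘ₗ eps Q) (g := LinearMap.id) (fun n a x => ?_) x
  simp [smul_smul, koszulSign_mul_self]

theorem d_d (x : Tot Q) : d Q (d Q x) = 0 := by
  refine ext_inc (f := d Q ∘ₗ d Q) (g := 0) (fun n a x => ?_) x
  simp [d_inc rfl, Q.d_d]

theorem d_eps (x : Tot Q) : d Q (eps Q x) = -eps Q (d Q x) := by
  refine ext_inc (f := d Q ∘ₗ eps Q) (g := -(eps Q ∘ₗ d Q)) (fun n a x => ?_) x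
  simp [d_inc rfl, koszulSign_add, koszulSign_odd k (a := 1) (by decide)]

/-- Two bilinear maps agree if they agree on homogeneous elements. -/
theorem ext_inc₂ {M : Type*} [AddCommGroup M] [Module k M] {f g : Tot Q →ₗ[k] Tot Q →ₗ[k] M}
    (h : ∀ n a x m b y, f (inc Q n a x) (inc Q m b y) = g (inc Q n a x) (inc Q m b y))
    (x y : Tot Q) : f x y = g x y :=
  LinearMap.congr_fun (ext_inc (fun n a x => LinearMap.ext (ext_inc (h n a x))) x) y

theorem eps_ins (q : ℕ) (x y : Tot Q) : eps Q (ins Q q x y) = ins Q q (eps Q x) (eps Q y) := by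
  refine ext_inc₂ (f := (ins Q q).compr₂ (eps Q)) (g := (ins Q q).compl₁₂ (eps Q) (eps Q))
    (fun n a x m b y => ?_) x y
  by_cases h : q < n
  · simp [ins_inc (N := n - 1 + m) (i := n - 1 - q) (q := q) (by omega) (by omega) (by omega) rfl
      x y, smul_smul, koszulSign_add, mul_comm]
  · simp [ins_inc_of_le (not_lt.mp h)]

theorem d_ins (q : ℕ) (x y : Tot Q) :
    d Q (ins Q q x y) = ins Q q (d Q x) y + ins Q q (eps Q x) (d Q y) := by
  refine ext_inc₂ (f := (ins Q q).compr₂ (d Q))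
    (g := (ins Q q).compl₁₂ (d Q) .id + (ins Q q).compl₁₂ (eps Q) (d Q))
    (fun n a x m b y => ?_) x y
  by_cases h : q < n
  · have h1 := ins_inc (N := n - 1 + m) (i := n - 1 - q) (q := q) (by omega) (by omega) (by omega)
      (e := a + b) rfl x y
    have h2 := ins_inc (N := n - 1 + m) (i := n - 1 - q) (q := q) (by omega) (by omega) (by omega)
      (e := a + b + 1) (by ring) (Q.d rfl x) y
    have h3 := ins_inc (N := n - 1 + m) (i := n - 1 - q) (q := q) (by omega) (by omega) (by omega)
      (e := a + b + 1) (by ring) x (Q.d rfl y)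
    simp only [LinearMap.compr₂_apply, LinearMap.add_apply, LinearMap.compl₁₂_apply, eps_inc,
      LinearMap.id_apply, d_inc rfl, h1, h2, map_smul, LinearMap.smul_apply, h3]
    rw [Q.d_comp _ _ _ _ rfl rfl rfl (by ring) (by ring), map_add, map_smul]
  · simp [ins_inc_of_le (not_lt.mp h), d_inc rfl]

variable (Q) in
/-- The span of the operations with at least `r` inputs. -/
def minArity (r : ℕ) : Submodule k (Tot Q) :=
  Submodule.span k {x | ∃ n a y, r ≤ n ∧ x = inc Q n a y}

theorem inc_mem_minArity {n r : ℕ} (h : r ≤ n) {a : ℤ} (x : Q.obj n a) :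
    inc Q n a x ∈ minArity Q r :=
  Submodule.subset_span ⟨n, a, x, h, rfl⟩

theorem ins_mem_minArity {r : ℕ} {x : Tot Q} (hx : x ∈ minArity Q (r + 1)) (y : Tot Q) :
    ins Q r x y ∈ minArity Q r := by
  induction hx using Submodule.span_induction with
  | mem x hx =>
    obtain ⟨n, a, x, hn, rfl⟩ := hx
    have := ext_inc (f := (minArity Q r).mkQ ∘ₗ ins Q r (inc Q n a x)) (g := 0) (fun m b y => ?_) y
    · simpa using this
    · rw [LinearMap.comp_apply, ins_inc (N := n - 1 + m) (i := n - 1 - r) (by omega) (by omega)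
        (by omega) rfl]
      simpa using inc_mem_minArity (by omega) _
  | zero => simp
  | add x x' _ _ h h' => simpa using add_mem h h'
  | smul c x _ h => simpa using Submodule.smul_mem _ c h

/-- Sequential composition. The hypothesis on `y` ensures that the slot with `r` inputs of `y` to
its right exists. -/
theorem ins_ins {r : ℕ} {y : Tot Q} (hy : y ∈ minArity Q (r + 1)) (q : ℕ) (x z : Tot Q) :
    ins Q (r + q) (ins Q q x y) z = ins Q q x (ins Q r y z) := by
  induction hy using Submodule.span_induction with
  | mem y hy =>
    obtain ⟨m, b, y, hm, rfl⟩ := hy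
    refine ext_inc₂ (f := (ins Q (r + q)).comp ((ins Q q).flip (inc Q m b y)))
      (g := (ins Q q).compl₂ (ins Q r (inc Q m b y))) (fun n a x l c z => ?_) x z
    simp only [LinearMap.comp_apply, LinearMap.flip_apply, LinearMap.compl₂_apply]
    by_cases h : q < n
    · rw [ins_inc (N := n - 1 + m) (i := n - 1 - q) (q := q) (by omega) (by omega) (by omega) rfl,
        ins_inc (N := n - 1 + (m - 1 + l)) (i := n - 1 - q + (m - 1 - r)) (q := r + q) (by omega)
          (by omega) (by omega) rfl,
        ins_inc (N := m - 1 + l) (i := m - 1 - r) (q := r) (by omega) (by omega) (by omega) rfl,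
        ins_inc (N := n - 1 + (m - 1 + l)) (i := n - 1 - q) (q := q) (by omega) (by omega)
          (by omega) (e := a + b + c) (by ring)]
      rw [Q.comp_assoc]
    · simp [ins_inc_of_le (not_lt.mp h)]
  | zero => simp
  | add y y' _ _ h h' => simp [h, h']
  | smul c y _ h => simp [h]

variable (Q) in
/-- The operator `ε ^ a`. -/
def epsPow (a : ℤ) : Tot Q →ₗ[k] Tot Q := if Even a then LinearMap.id else eps Q

theorem epsPow_inc (b : ℤ) {n : ℕ} {a : ℤ} (x : Q.obj n a) :
    epsPow Q b (inc Q n a x) = koszulSign k (b * a) • inc Q n a x := by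
  by_cases hb : Even b
  · simp [epsPow, hb, koszulSign_even k (hb.mul_right a)]
  · by_cases ha : Even a
    · simp [epsPow, hb, koszulSign_even k (ha.mul_left b), koszulSign_even k ha]
    · simp [epsPow, hb, koszulSign_odd k (a := b * a) (by simp [Int.even_mul, ha, hb]),
        koszulSign_odd k ha]

/-- Parallel composition, with slots counted from the right: inserting `y` first moves the slot of
`z`, which is to the left of `y`, by `m - 1`. -/
theorem ins_ins_comm {m : ℕ} {b : ℤ} (y : Q.obj m b) (q s : ℕ) (x z : Tot Q) :
    ins Q (s + m + q) (ins Q q x (inc Q m b y)) z =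
      ins Q q (ins Q (s + 1 + q) x (epsPow Q b z)) (inc Q m b y) := by
  refine ext_inc₂ (f := (ins Q (s + m + q)).comp ((ins Q q).flip (inc Q m b y)))
    (g := ((ins Q (s + 1 + q)).compl₂ (epsPow Q b)).compr₂ ((ins Q q).flip (inc Q m b y)))
    (fun n a x l c z => ?_) x z
  simp only [LinearMap.comp_apply, LinearMap.flip_apply, LinearMap.compl₂_apply,
    LinearMap.compr₂_apply, epsPow_inc]
  rcases lt_or_ge (s + 1 + q) n with h | h
  · have h1 := ins_inc (N := n - 1 + m) (i := n - 1 - q) (q := q) (by omega) (by omega) (by omega)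
      rfl x y
    have h2 := ins_inc (N := n - 1 + l) (i := n - 1 - (s + 1 + q)) (q := s + 1 + q) (by omega)
      (by omega) (by omega) rfl x z
    rw [h1, ins_inc (N := n - 1 + m - 1 + l) (i := n - 1 - (s + 1 + q)) (q := s + m + q)
      (by omega) (by omega) (by omega) (e := a + c + b) (by ring), map_smul, h2, map_smul,
      LinearMap.smul_apply, ins_inc (N := n - 1 + m - 1 + l) (i := n - 1 + l - 1 - q) (q := q)
        (by omega) (by omega) (by omega) rfl,
      Q.comp_comm (M₁ := n - 1 + m) (n - 1 - (s + 1 + q)) (n - 1 - q) (n - 1 + l - 1 - q)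
        (by omega) (by omega) (by omega) (by omega) (by omega) (by omega) (by omega)
        (by omega) (by omega)
        (by omega) rfl rfl rfl (by ring), map_smul, smul_smul, mul_comm b c, koszulSign_mul_self,
      one_smul]
  · rw [ins_inc_of_le h]
    rcases lt_or_ge q n with h' | h'
    · rw [ins_inc (N := n - 1 + m) (i := n - 1 - q) (q := q) (by omega) (by omega) (by omega)
        rfl, ins_inc_of_le (by omega)]
      simp
    · simp [ins_inc_of_le h']

/-! ### Plugging lists of elements into an operation -/

variable (Q) in
/-- The result of plugging all the entries of a list into the last inputs of an operation. -/
def plug : Tot Q → List (Tot Q) → Tot Q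
  | x, [] => x
  | x, a :: L => plug (ins Q L.length x a) L

@[simp] theorem plug_nil (x : Tot Q) : plug Q x [] = x := rfl

theorem plug_cons (x a : Tot Q) (L) : plug Q x (a :: L) = plug Q (ins Q L.length x a) L := rfl

variable (Q) in
/-- Plugging a fixed list, as a linear map. -/
def plugLin (L : List (Tot Q)) : Tot Q →ₗ[k] Tot Q where
  toFun x := plug Q x L
  map_add' x y := by
    induction L generalizing x y with
    | nil => rfl
    | cons a L ih => simp [plug_cons, ih]
  map_smul' c x := by
    induction L generalizing x with
    | nil => rfl
    | cons a L ih => simpa [plug_cons] using ih _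

theorem plug_add (x y : Tot Q) (L) : plug Q (x + y) L = plug Q x L + plug Q y L :=
  map_add (plugLin Q L) x y

theorem plug_smul (c : k) (x : Tot Q) (L) : plug Q (c • x) L = c • plug Q x L :=
  map_smul (plugLin Q L) c x

theorem plug_zero (L) : plug Q 0 L = 0 := map_zero (plugLin Q L)

theorem plug_append_cons_add (x y z : Tot Q) (L₁ L₂ : List (Tot Q)) :
    plug Q x (L₁ ++ (y + z) :: L₂) = plug Q x (L₁ ++ y :: L₂) + plug Q x (L₁ ++ z :: L₂) := by
  induction L₁ generalizing x with
  | nil => simp [plug_cons, plug_add]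
  | cons a L ih => simp [plug_cons, ih]

theorem plug_append_cons_smul (c : k) (x y : Tot Q) (L₁ L₂ : List (Tot Q)) :
    plug Q x (L₁ ++ (c • y) :: L₂) = c • plug Q x (L₁ ++ y :: L₂) := by
  induction L₁ generalizing x with
  | nil => simp [plug_cons, plug_smul]
  | cons a L ih => simp [plug_cons, ih]

theorem eps_plug (x : Tot Q) (L) : eps Q (plug Q x L) = plug Q (eps Q x) (L.map (eps Q)) := by
  induction L generalizing x with
  | nil => rfl
  | cons a L ih => simp [plug_cons, ih, eps_ins]

theorem plug_ins_append {y : Tot Q} (L₂ L₃ : List (Tot Q)) (hy : y ∈ minArity Q L₂.length)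
    (x : Tot Q) :
    plug Q (ins Q L₃.length x y) (L₂ ++ L₃) = plug Q x (plug Q y L₂ :: L₃) := by
  induction L₂ generalizing y with
  | nil => rfl
  | cons a L ih =>
    rw [List.cons_append, plug_cons, List.length_append, ins_ins hy,
      ih (ins_mem_minArity hy a), plug_cons y]

/-- Plugging into a composite operation is plugging in two steps. -/
theorem plug_ins {m : ℕ} {b : ℤ} (y : Q.obj m b) (L₁ L₂ L₃ : List (Tot Q)) (h : L₂.length = m)
    (x : Tot Q) :
    plug Q (ins Q L₃.length x (inc Q m b y)) (L₁ ++ (L₂ ++ L₃)) =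
      plug Q x (L₁.map (epsPow Q b) ++ plug Q (inc Q m b y) L₂ :: L₃) := by
  induction L₁ generalizing x with
  | nil => exact plug_ins_append L₂ L₃ (inc_mem_minArity h.le y) x
  | cons a L ih =>
    rw [List.cons_append, plug_cons, List.length_append, List.length_append, ← add_assoc, h,
      ins_ins_comm, ih, List.map_cons, List.cons_append, plug_cons]
    simp [add_assoc, add_comm 1]

/-- The free algebra recovers an operation as its value on copies of the generator. -/
theorem plug_replicate_one (n : ℕ) (a : ℤ) (x : Q.obj n a) :
    plug Q (inc Q n a x) (List.replicate n (inc Q 1 0 Q.one)) = inc Q n a x := by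
  have h : ∀ r ≤ n, plug Q (inc Q n a x) (List.replicate r (inc Q 1 0 Q.one)) = inc Q n a x := by
    intro r hr
    induction r with
    | zero => rfl
    | succ r ih =>
      rw [List.replicate_succ, plug_cons, List.length_replicate,
        ins_inc (N := n) (i := n - 1 - r) (by omega) (by omega) rfl (add_zero a).symm, Q.comp_one,
        ih (by omega)]
  exact h n le_rfl

end Tot
end WeaklyUnital

namespace WeaklyUnital

/-! ### The free algebra over the operad -/

open Tot

variable {k : Type u} [Field k]

/-- The operation given by a formal expression. -/
def Term.toObj {n : ℕ} {a : ℤ} (t : Term k n a) : (operadO k).obj n a := Quot.mk _ t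

/-- The operation given by a formal expression, in the total space of the operad. -/
def Term.toTot {n : ℕ} {a : ℤ} (t : Term k n a) : Tot (operadO k) :=
  inc (operadO k) n a t.toObj

theorem Rel.toTot_eq {n : ℕ} {a : ℤ} {t t' : Term k n a} (h : Rel k t t') : t.toTot = t'.toTot :=
  congrArg (inc (operadO k) n a) (Quot.sound h)

namespace Term

theorem toTot_comp {n m N : ℕ} {a b e : ℤ} {i q : ℕ} (hq : i + q + 1 = n) (hi : i < n)
    (hN : N + 1 = n + m) (he : e = a + b) (x : Term k n a) (y : Term k m b) :
    (Term.comp i hi hN he x y).toTot = ins (operadO k) q x.toTot y.toTot :=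
  (ins_inc hq hi hN he x.toObj y.toObj).symm

theorem toTot_d {n : ℕ} {a b : ℤ} (h : a + 1 = b) (x : Term k n a) :
    (Term.d h x).toTot = Tot.d (operadO k) x.toTot :=
  (d_inc h x.toObj).symm

theorem toTot_zero (n : ℕ) (a : ℤ) : (Term.zero : Term k n a).toTot = 0 :=
  map_zero (inc (operadO k) n a)

theorem toTot_add {n : ℕ} {a : ℤ} (x y : Term k n a) : (Term.add x y).toTot = x.toTot + y.toTot :=
  map_add (inc (operadO k) n a) x.toObj y.toObj

theorem toTot_smul {n : ℕ} {a : ℤ} (c : k) (x : Term k n a) :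
    (Term.smul c x).toTot = c • x.toTot :=
  map_smul (inc (operadO k) n a) c x.toObj

theorem eps_toTot {n : ℕ} {a : ℤ} (x : Term k n a) :
    Tot.eps (operadO k) x.toTot = koszulSign k a • x.toTot :=
  eps_inc _

end Term

/-- The product `a b = m (a, b)`. -/
def totMul : Tot (operadO k) →ₗ[k] Tot (operadO k) →ₗ[k] Tot (operadO k) :=
  ins (operadO k) 0 ∘ₗ ins (operadO k) 1 (Term.m (k := k)).toTot

theorem totMul_apply (a b : Tot (operadO k)) :
    totMul a b = plug (operadO k) (Term.m (k := k)).toTot [a, b] := rfl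

theorem totMul_assoc (a b c : Tot (operadO k)) :
    totMul (totMul a b) c = totMul a (totMul b c) := by
  have h1 := plug_ins (Term.m (k := k)).toObj [] [a, b] [c] rfl (Term.m (k := k)).toTot
  have h2 := plug_ins (Term.m (k := k)).toObj [a] [b, c] [] rfl (Term.m (k := k)).toTot
  have h3 := (Rel.m_assoc (k := k) (by omega) (by omega) rfl rfl).toTot_eq
  rw [Term.toTot_comp (q := 1) rfl, Term.toTot_comp (q := 0) rfl] at h3
  have h4 : epsPow (operadO k) 0 a = a := by simp [epsPow]
  simp only [List.map_cons, List.map_nil, h4] at h2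
  rw [totMul_apply, totMul_apply, totMul_apply, totMul_apply]
  refine h1.symm.trans (Eq.trans ?_ h2)
  exact congrArg (fun x => plug (operadO k) x [a, b, c]) h3

variable (k) in
/-- The free algebra over the operad on one generator, as a graded dg algebra. -/
def totDga : ParityDga k (Tot (operadO k)) where
  eps := Tot.eps _
  d := Tot.d _
  mul := totMul
  eps_eps := Tot.eps_eps
  d_d := Tot.d_d
  d_eps := Tot.d_eps
  eps_mul a b := by
    simp only [totMul, LinearMap.comp_apply, eps_ins, Term.eps_toTot, koszulSign_zero, one_smul]
  mul_assoc := totMul_assoc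
  d_mul a b := by
    have h : Tot.d (operadO k) (Term.m (k := k)).toTot = 0 := by
      rw [← Term.toTot_d rfl, (Rel.d_m rfl).toTot_eq, Term.toTot_zero]
    simp only [totMul, LinearMap.comp_apply, eps_ins, d_ins, Term.eps_toTot, koszulSign_zero,
      one_smul, h, map_zero, LinearMap.zero_apply, zero_add]

theorem d_plug (x : Tot (operadO k)) (L) : Tot.d (operadO k) (plug (operadO k) x L) =
    plug (operadO k) (Tot.d _ x) L +
      dSum (totDga k) (plug (operadO k) (Tot.eps _ x)) L := by
  induction L generalizing x with
  | nil => simp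
  | cons a L ih =>
    rw [plug_cons, ih, d_ins, plug_add, dSum_cons, plug_cons, plug_cons, add_assoc]
    congr 2
    refine dSum_congr L fun L' hL' => ?_
    rw [plug_cons, eps_ins, hL']
    rfl

/-- The action of the operations `p` on the free algebra. -/
def totP (L : List (Option (Tot (operadO k)))) : Tot (operadO k) :=
  if h : 1 ≤ (shape L).length then
    plug (operadO k) (Term.p (k := k) (shape L) h rfl rfl).toTot (inputs L)
  else 0

theorem totP_eq {L : List (Option (Tot (operadO k)))} {w : List Bool} (hL : shape L = w)
    (hw : 1 ≤ w.length) {n : ℕ} {a : ℤ} (hn : n = w.count false) (ha : a = 1 - (w.length : ℤ)) :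
    totP L = plug (operadO k) (Term.p w hw hn ha).toTot (inputs L) := by
  subst hL hn ha
  exact dif_pos hw

theorem totP_nil : totP ([] : List (Option (Tot (operadO k)))) = 0 := rfl

theorem totP_fill {w : List Bool} (hw : 1 ≤ w.length) {n : ℕ} {a : ℤ} (hn : n = w.count false)
    (ha : a = 1 - (w.length : ℤ)) (L : List (Tot (operadO k))) (hL : L.length = n) :
    totP (fill w L) = plug (operadO k) (Term.p w hw hn ha).toTot L := by
  obtain ⟨h1, h2⟩ := shape_fill w L (hL.trans hn)
  rw [totP_eq h1 hw hn ha, h2]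

theorem isMulti_totP : IsMulti k (totP (k := k)) := by
  have hs : ∀ (L₁ L₂ : List (Option (Tot (operadO k)))) x y,
      shape (L₁ ++ some x :: L₂) = shape (L₁ ++ some y :: L₂) := by simp [shape]
  have hl : ∀ (L₁ L₂ : List (Option (Tot (operadO k)))) x,
      1 ≤ (shape (L₁ ++ some x :: L₂)).length := by simp; omega
  constructor
  · intro L₁ L₂ x y
    rw [totP_eq (hs L₁ L₂ (x + y) 0) (hl _ _ _) rfl rfl, totP_eq (hs L₁ L₂ x 0) (hl _ _ _) rfl rfl,
      totP_eq (hs L₁ L₂ y 0) (hl _ _ _) rfl rfl]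
    simp only [inputs_append, inputs]
    exact plug_append_cons_add _ _ _ _ _
  · intro L₁ L₂ c x
    rw [totP_eq (hs L₁ L₂ (c • x) 0) (hl _ _ _) rfl rfl, totP_eq (hs L₁ L₂ x 0) (hl _ _ _) rfl rfl]
    simp only [inputs_append, inputs]
    exact plug_append_cons_smul _ _ _ _ _

theorem totP_eq_zero {L : List (Option (Tot (operadO k)))} (c : Bool) (l : ℕ) (hl : 2 ≤ l)
    (hL : shape L = List.replicate l c) : totP L = 0 := by
  rw [totP_eq hL (by simp; omega) rfl rfl, (Rel.p_const c l hl _ _ _).toTot_eq, Term.toTot_zero,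
    plug_zero]

theorem totP_some (x : Tot (operadO k)) : totP [some x] = x := by
  rw [totP_eq (w := [false]) rfl (by simp) rfl rfl]
  have h := (Rel.p_false (k := k) (by simp) rfl rfl).toTot_eq
  refine (congrArg (fun y => plug (operadO k) y [x]) h).trans ?_
  refine ext_inc (f := ins (operadO k) 0 (Term.one (k := k)).toTot) (g := LinearMap.id)
    (fun n a y => ?_) x
  rw [Term.toTot, ins_inc (N := n) (i := 0) rfl (by omega) (by omega) (zero_add a).symm]
  exact congrArg _ ((operadO k).one_comp _ _ _ y)

theorem totP_none : totP [none] = (Term.j (k := k)).toTot := by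
  rw [totP_eq (w := [true]) rfl (by simp) rfl rfl]
  exact (Rel.p_true (k := k) (by simp) rfl rfl).toTot_eq

theorem shape_map_oeps (L : List (Option (Tot (operadO k)))) :
    shape (L.map (totDga k).oeps) = shape L := by
  rw [shape, List.map_map]
  exact List.map_congr_left fun z _ => by cases z <;> rfl

theorem inputs_map_oeps (L : List (Option (Tot (operadO k)))) :
    inputs (L.map (totDga k).oeps) = (inputs L).map (Tot.eps _) := by
  induction L with
  | nil => rfl
  | cons z L ih => cases z <;> simp [inputs, ih]; rfl

theorem totP_map_oeps (L : List (Option (Tot (operadO k)))) :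
    totP (L.map (totDga k).oeps) =
      koszulSign k (1 - (L.length : ℤ)) • Tot.eps (operadO k) (totP L) := by
  by_cases h : 1 ≤ (shape L).length
  · rw [← length_shape L, totP_eq (shape_map_oeps L) h rfl rfl, totP_eq rfl h rfl rfl, eps_plug,
      inputs_map_oeps, Term.eps_toTot, plug_smul, smul_smul, koszulSign_mul_self, one_smul]
  · obtain rfl : L = [] := by simpa using h
    simp [totP_nil]

/-- In the free algebra, a formal expression acts by plugging its arguments into its class. -/
theorem eval_totDga {n : ℕ} {a : ℤ} (t : Term k n a) (L : List (Tot (operadO k)))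
    (hL : L.length = n) :
    eval (totDga k) (Term.j (k := k)).toTot totP t L = plug (operadO k) t.toTot L := by
  induction t generalizing L with
  | one =>
    obtain ⟨x, rfl⟩ := List.length_eq_one_iff.mp hL
    have h := totP_some x
    rw [totP_eq (w := [false]) rfl (by simp) rfl rfl] at h
    refine h.symm.trans ?_
    exact congrArg (fun y => plug (operadO k) y [x])
      (Rel.p_false (k := k) (by simp) rfl rfl).toTot_eq
  | m =>
    obtain ⟨x, y, rfl⟩ := List.length_eq_two.mp hL
    rfl
  | j =>
    obtain rfl := List.length_eq_zero_iff.mp hL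
    rfl
  | p w hw hn ha => exact totP_fill hw hn ha L hL
  | comp i hi hN he x y ihx ihy =>
    rename_i n m N a b e
    obtain ⟨L₁, L, rfl, k1⟩ := exists_append (L := L) (n := i) (by omega)
    simp only [List.length_append] at hL
    obtain ⟨L₂, L₃, rfl, k2⟩ := exists_append (L := L) (n := m) (by omega)
    simp only [List.length_append] at hL
    rw [eval_comp_append i hi hN he x y L₃ k1 k2, ihy L₂ k2, ihx _ (by simp; omega),
      Term.toTot_comp (q := L₃.length) (by omega)]
    exact (plug_ins _ L₁ L₂ L₃ k2 _).symm
  | d h x ih =>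
    rename_i n a b
    rw [eval, ih L hL, dSum_congr L fun L' hL' => ih L' (hL'.trans hL), Term.toTot_d]
    refine sub_eq_iff_eq_add.mpr ((d_plug _ L).trans ?_)
    rw [Term.eps_toTot, ← dSum_smul]
    congr 2
    funext L'
    exact plug_smul _ _ _
  | zero => rw [Term.toTot_zero, plug_zero]; rfl
  | add x y ihx ihy => rw [eval, ihx L hL, ihy L hL, Term.toTot_add, plug_add]
  | smul c x ih => rw [eval, ih L hL, Term.toTot_smul, plug_smul]

/-- The Maurer-Cartan equation of the free algebra is the relation for the differential of the
operations `p`. -/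
theorem d_totP (L : List (Option (Tot (operadO k)))) : Tot.d (operadO k) (totP L) =
    (totDga k).bar 0 (fun L => totP (twist (totDga k) L)) (twist (totDga k) L) +
      cut (totDga k).mul ((totDga k).sbar fun L => totP (twist (totDga k) L))
        (fun L => totP (twist (totDga k) L)) (twist (totDga k) L) := by
  by_cases h : 1 ≤ (shape L).length
  · have h1 := eval_dp_add_dPart (D := totDga k) (j := (Term.j (k := k)).toTot)
      (isMulti_twist (D := totDga k) (isMulti_totP (k := k))) totP_nil L
      (n := (shape L).count false) (a := 2 - ((shape L).length : ℤ)) rfl rfl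
    simp only [twist_twist] at h1
    rw [← length_shape L] at h1
    rw [← h1, eval_totDga _ _ (length_inputs L), totP_eq rfl h rfl rfl, d_plug,
      ← (Rel.d_p (shape L) h rfl rfl (by ring) rfl).toTot_eq, Term.toTot_d, ← dSum_fill,
      Term.eps_toTot, ← dSum_smul]
    congr 1
    refine dSum_congr _ fun L' hL' => ?_
    rw [plug_smul, totP_fill h rfl rfl L' (hL'.trans (length_inputs L))]
  · obtain rfl : L = [] := by simpa using h
    simp [totP_nil, twist]

variable (k) in
/-- The free algebra on one generator over the operad of weakly unital dg categories. -/
def totAlg : WeakAlg k (Tot (operadO k)) where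
  toParityDga := totDga k
  j := Term.j.toTot
  τ L := totP (twist (totDga k) L)
  multi := isMulti_twist isMulti_totP
  τ_nil := rfl
  τ_some x := by simpa [twist, oepsZ, epsZ_even] using totP_some x
  τ_none := totP_none
  τ_replicate_none n hn := by
    rw [twist_replicate_none]
    exact totP_eq_zero true n hn (by simp [shape])
  τ_map_some L hL := by
    obtain ⟨L', h, h'⟩ := twist_map_some (D := totDga k) L
    rw [h']
    exact totP_eq_zero false L.length hL (by simp [shape, h, Function.comp_def])
  eps_τ z := by
    have h := totP_map_oeps (twist (totDga k) z)
    rw [length_twist, map_oeps, ← twist_map, ← map_oeps] at h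
    rw [ParityDga.sbar, h, smul_smul, ← koszulSign_natCast, ← koszulSign_add,
      koszulSign_odd k (by simp)]
    simp
    rfl
  d_τ z := by
    have h := d_totP (twist (totDga k) z)
    rwa [twist_twist] at h

end WeaklyUnital

namespace WeaklyUnital

/-! ### Formal expressions in weakly unital algebras -/

section

open ParityDga

variable {k : Type u} [Field k] {X Y : Type*} [AddCommGroup X] [Module k X] [AddCommGroup Y]
  [Module k Y] {D : ParityDga k X} {D' : ParityDga k Y}

/-- The value of a formal expression in a weakly unital algebra. -/
def WeakAlg.eval (W : WeakAlg k X) {n : ℕ} {a : ℤ} (t : Term k n a) (L : List X) : X :=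
  WeaklyUnital.eval W.toParityDga W.j (fun L => W.τ (twist W.toParityDga L)) t L

theorem WeakAlg.eval_eq_of_rel (W : WeakAlg k X) {n : ℕ} {a : ℤ} {t t' : Term k n a}
    (h : Rel k t t') (L : List X) (hL : L.length = n) : W.eval t L = W.eval t' L := by
  refine WeaklyUnital.eval_eq_of_rel (isMulti_twist W.multi) W.eps_j W.d_j W.mul_j_j (fun z => ?_)
    (fun l hl => ?_) (fun L hL => ?_) ?_ (fun x => ?_) (fun w hw L hL => ?_) h L hL
  · have h := W.eps_τ (twist W.toParityDga z)
    rw [sbar, length_twist, map_oeps, ← twist_map, ← map_oeps, ← koszulSign_natCast] at h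
    rw [h, smul_neg, smul_smul, ← koszulSign_add, koszulSign_odd k (by simp), neg_smul, one_smul,
      neg_neg]
  · rw [twist_replicate_none, W.τ_replicate_none l hl]
  · obtain ⟨L', h, h'⟩ := twist_map_some (D := W.toParityDga) L
    rw [h', W.τ_map_some L' (by omega)]
  · exact W.τ_none
  · simpa [twist, oepsZ, epsZ_even] using W.τ_some x
  · obtain ⟨h1, h2⟩ := shape_fill w L hL
    have h := eval_dp_add_dPart (D := W.toParityDga) (j := W.j) W.multi W.τ_nil (fill w L)
      (n := w.count false) (a := 2 - (w.length : ℤ)) (by rw [h1]) (by rw [h1])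
    rw [← W.d_τ, ← dSum_fill, h2, length_fill] at h
    simp only [h1] at h
    rw [← h, add_sub_cancel_right]

/-- Formal expressions commute with homomorphisms. -/
theorem map_eval (φ : X →ₗ[k] Y) (hε : ∀ x, φ (D.eps x) = D'.eps (φ x))
    (hd : ∀ x, φ (D.d x) = D'.d (φ x)) (hm : ∀ x y, φ (D.mul x y) = D'.mul (φ x) (φ y))
    {j : X} {j' : Y} (hj : φ j = j') {P : List (Option X) → X} {P' : List (Option Y) → Y}
    (hP : ∀ L, φ (P L) = P' (L.map (Option.map φ))) {n : ℕ} {a : ℤ} (t : Term k n a) (L : List X)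
    (hL : L.length = n) : φ (eval D j P t L) = eval D' j' P' t (L.map φ) := by
  induction t generalizing L with
  | one =>
    obtain ⟨x, rfl⟩ := List.length_eq_one_iff.mp hL
    rfl
  | m =>
    obtain ⟨x, y, rfl⟩ := List.length_eq_two.mp hL
    exact hm x y
  | j => exact hj
  | p w hw hn ha =>
    rw [eval, eval, hP, fill_map]
  | comp i hi hN he x y ihx ihy =>
    rename_i n m N a b e
    obtain ⟨L₁, L, rfl, k1⟩ := exists_append (L := L) (n := i) (by omega)
    simp only [List.length_append] at hL
    obtain ⟨L₂, L₃, rfl, k2⟩ := exists_append (L := L) (n := m) (by omega)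
    simp only [List.length_append] at hL
    have hb : (L₁.map (epsZ D b)).map φ = (L₁.map φ).map (epsZ D' b) := by
      rw [List.map_map, List.map_map]
      refine List.map_congr_left fun x _ => ?_
      by_cases h : Even b <;> simp [epsZ, h, hε]
    rw [List.map_append, List.map_append, eval_comp_append i hi hN he x y L₃ k1 k2,
      eval_comp_append i hi hN he x y (L₃.map φ) (by simpa) (by simpa),
      ihx _ (by simp; omega), List.map_append, List.map_cons, ihy L₂ k2, hb]
  | d h x ih =>
    rename_i n a b
    have key : ∀ (f : List X → X) (g : List Y → Y) (L : List X),
        (∀ L' : List X, L'.length = L.length → φ (f L') = g (L'.map φ)) →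
        φ (dSum D f L) = dSum D' g (L.map φ) := by
      intro f g L h
      induction L generalizing f g with
      | nil => simp
      | cons x L ih =>
        rw [dSum_cons, List.map_cons, dSum_cons, map_add, h _ (by simp), List.map_cons, hd, ← hε]
        congr 1
        exact ih _ _ fun L' hL' => by rw [h _ (by simpa using hL'), List.map_cons]
    rw [eval, eval, map_sub, map_smul, hd, ih L hL,
      key _ _ L fun L' hL' => ih L' (hL'.trans hL)]
  | zero => exact map_zero φ
  | add x y ihx ihy => rw [eval, eval, map_add, ihx L hL, ihy L hL]
  | smul c x ih => rw [eval, eval, map_smul, ih L hL]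

theorem dSum_eq_zero {n : ℕ} {f : List X → X} (h : SlotLinear k n f) (L : List X)
    (hL : L.length = n) (hd : ∀ x ∈ L, D.d x = 0) : dSum D f L = 0 := by
  induction L generalizing n f with
  | nil => rfl
  | cons x L ih =>
    obtain ⟨n, rfl⟩ : ∃ m, n = m + 1 := ⟨n - 1, by simp at hL; omega⟩
    have h0 := h.zero_slot [] L (by simpa using hL)
    rw [List.nil_append] at h0
    rw [dSum_cons, hd x (by simp), h0, zero_add,
      ih (h.cons _) (by simpa using hL) fun y hy => hd y (by simp [hy])]

/-- On closed arguments, formal expressions commute with the differential. -/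
theorem WeakAlg.eval_d (W : WeakAlg k X) {n : ℕ} {a b : ℤ} (h : a + 1 = b) (t : Term k n a)
    (L : List X) (hL : L.length = n) (hd : ∀ x ∈ L, W.d x = 0) :
    W.eval (.d h t) L = W.d (W.eval t L) := by
  have := dSum_eq_zero (D := W.toParityDga)
    (slotLinear_eval (D := W.toParityDga) (j := W.j)
      (isMulti_twist (D := W.toParityDga) W.multi) t) L hL hd
  rw [WeakAlg.eval, WeaklyUnital.eval, this, smul_zero, sub_zero]
  rfl

/-! ### The augmentation -/

/-- The augmentation of formal expressions: their value in the operad of strictly unital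
algebras. -/
def Term.aug : ∀ {n : ℕ} {a : ℤ}, Term k n a → k
  | _, _, .one => 1
  | _, _, .m => 1
  | _, _, .j => 1
  | _, _, .p w _ _ _ => if w.length = 1 then 1 else 0
  | _, _, .comp _ _ _ _ x y => x.aug * y.aug
  | _, _, .d _ _ => 0
  | _, _, .zero => 0
  | _, _, .add x y => x.aug + y.aug
  | _, _, .smul c x => c * x.aug

theorem Term.aug_eq_zero {n : ℕ} {a : ℤ} (t : Term k n a) (ha : a ≠ 0) : t.aug = 0 := by
  induction t with
  | one => exact absurd rfl ha
  | m => exact absurd rfl ha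
  | j => exact absurd rfl ha
  | p w hw hn ha' => exact if_neg fun h => ha (by omega)
  | comp i hi hN he x y ihx ihy =>
    rename_i n m N a b e
    by_cases h : a = 0
    · rw [Term.aug, ihy (by omega), mul_zero]
    · rw [Term.aug, ihx h, zero_mul]
  | d h x ih => rfl
  | zero => rfl
  | add x y ihx ihy => rw [Term.aug, ihx ha, ihy ha, add_zero]
  | smul c x ih => rw [Term.aug, ih ha, mul_zero]

variable (k) (S : Type*) [CommRing S] [Algebra k S]

/-- A commutative algebra, placed in degree zero. -/
def commDga : ParityDga k S where
  eps := LinearMap.id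
  d := 0
  mul := LinearMap.mul k S
  eps_eps _ := rfl
  d_d _ := rfl
  d_eps _ := by simp
  eps_mul _ _ := rfl
  mul_assoc x y z := by simp [_root_.mul_assoc]
  d_mul _ _ := by simp

/-- The operations `p` of a strictly unital algebra. -/
def strictP : List (Option S) → S
  | [none] => 1
  | [some x] => x
  | _ => 0

variable {k S}

/-- In a strictly unital commutative algebra, every formal expression acts as a multiple of the
product of its arguments. -/
theorem eval_commDga {n : ℕ} {a : ℤ} (t : Term k n a) (L : List S) (hL : L.length = n) :
    eval (commDga k S) 1 (strictP S) t L = t.aug • L.prod := by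
  induction t generalizing L with
  | one =>
    obtain ⟨x, rfl⟩ := List.length_eq_one_iff.mp hL
    simp [eval, Term.aug]
  | m =>
    obtain ⟨x, y, rfl⟩ := List.length_eq_two.mp hL
    simp [eval, Term.aug, commDga]
  | j =>
    obtain rfl := List.length_eq_zero_iff.mp hL
    simp [eval, Term.aug]
  | p w hw hn ha =>
    rw [eval, Term.aug]
    match w, hn with
    | [true], hn =>
      obtain rfl := List.length_eq_zero_iff.mp (hL.trans hn)
      simp [fill, strictP]
    | [false], hn =>
      obtain ⟨x, rfl⟩ := List.length_eq_one_iff.mp (hL.trans hn)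
      simp [fill, strictP]
    | c :: c' :: w, hn =>
      have h : (fill (c :: c' :: w) L).length = w.length + 2 := length_fill _ _
      match fill (c :: c' :: w) L, h with
      | z :: z' :: L', _ => cases z <;> simp [strictP]
  | comp i hi hN he x y ihx ihy =>
    rename_i n m N a b e
    obtain ⟨L₁, L, rfl, k1⟩ := exists_append (L := L) (n := i) (by omega)
    simp only [List.length_append] at hL
    obtain ⟨L₂, L₃, rfl, k2⟩ := exists_append (L := L) (n := m) (by omega)
    simp only [List.length_append] at hL
    have hb : L₁.map (epsZ (commDga k S) b) = L₁ := by
      refine (List.map_congr_left fun x _ => ?_).trans (List.map_id L₁)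
      by_cases h : Even b
      · rw [epsZ_even h]; rfl
      · rw [epsZ_odd h]; rfl
    rw [eval_comp_append i hi hN he x y L₃ k1 k2, hb, ihy L₂ k2, ihx _ (by simp; omega),
      List.prod_append, List.prod_append, List.prod_cons, List.prod_append, Term.aug,
      smul_mul_assoc, mul_smul_comm, smul_smul]
  | d h x ih =>
    rename_i n a b
    have h0 : SlotLinear k n fun L : List S => x.aug • L.prod := by
      intro L₁ L₂ c v w _
      simp only [List.prod_append, List.prod_cons, add_mul, mul_add, smul_add, smul_mul_assoc,
        mul_smul_comm, smul_comm c]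
    rw [eval, dSum_congr L fun L' hL' => ih L' (hL'.trans hL),
      dSum_eq_zero h0 L hL (fun _ _ => rfl)]
    simp [commDga, Term.aug]
  | zero => simp [eval, Term.aug]
  | add x y ihx ihy => rw [eval, ihx L hL, ihy L hL, Term.aug, add_smul]
  | smul c x ih => rw [eval, ih L hL, Term.aug, mul_smul]

end

end WeaklyUnital

namespace WeaklyUnital

/-! ### The base points and the contraction -/

open Tot Polynomial

section

variable {k : Type u} [Field k] {A : Type*} [AddCommGroup A] [Module k A]

/-- The elements `j, j v j, j v j v j, …`, where the products are bracketed to the right. -/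
def WeakAlg.power (W : WeakAlg k A) (v : A) : ℕ → A
  | 0 => W.j
  | n + 1 => W.mul W.j (W.mul v (W.power v n))

/-- The base points `Xⁿ ↦ j v j v ⋯ v j` that belong to an even closed element `v`. -/
noncomputable def WeakAlg.basePoint (W : WeakAlg k A) (v : A) (hd : W.d v = 0) (hε : W.eps v = v) :
    BasePoint W k[X] :=
  have hι : ∀ n, (basisMonomials k).constr k (W.power v) (basisMonomials k n) = W.power v n :=
    (basisMonomials k).constr_basis k _
  { ι := (basisMonomials k).constr k (W.power v)
    d_ι := fun x => LinearMap.congr_fun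
      (f := W.d ∘ₗ (basisMonomials k).constr k (W.power v)) (g := 0)
      ((basisMonomials k).ext fun n => by
        rw [LinearMap.comp_apply, hι, LinearMap.zero_apply]
        induction n with
        | zero => exact W.d_j
        | succ n ih => simp [WeakAlg.power, W.d_mul, W.d_j, hd, ih]) x
    eps_ι := fun x => LinearMap.congr_fun
      (f := W.eps ∘ₗ (basisMonomials k).constr k (W.power v))
      ((basisMonomials k).ext fun n => by
        rw [LinearMap.comp_apply, hι]
        induction n with
        | zero => exact W.eps_j
        | succ n ih => simp [WeakAlg.power, W.eps_mul, W.eps_j, hε, ih]) x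
    j_ι := fun x => LinearMap.congr_fun
      (f := W.mul W.j ∘ₗ (basisMonomials k).constr k (W.power v))
      ((basisMonomials k).ext fun n => by
        rw [LinearMap.comp_apply, hι]
        cases n with
        | zero => exact W.mul_j_j
        | succ n => simp [WeakAlg.power, ← W.mul_assoc, W.mul_j_j]) x }

variable (W : WeakAlg k A) (v : A) (hd : W.d v = 0) (hε : W.eps v = v)

theorem basePoint_pow (n : ℕ) : (W.basePoint v hd hε).ι (X ^ n) = W.power v n := by
  have := (basisMonomials k).constr_basis k (W.power v) n
  simp only [coe_basisMonomials, monomial_one_right_eq_X_pow] at this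
  exact this

theorem basePoint_X_mul (x : k[X]) :
    (W.basePoint v hd hε).ι (X * x) = W.mul W.j (W.mul v ((W.basePoint v hd hε).ι x)) := by
  refine LinearMap.congr_fun (f := (W.basePoint v hd hε).ι ∘ₗ LinearMap.mul k k[X] X)
    (g := W.mul W.j ∘ₗ W.mul v ∘ₗ (W.basePoint v hd hε).ι) ((basisMonomials k).ext fun n => ?_) x
  simp only [coe_basisMonomials, monomial_one_right_eq_X_pow, LinearMap.comp_apply,
    LinearMap.mul_apply', ← pow_succ', basePoint_pow, WeakAlg.power]

/-- The lift of `v` to the path algebra: `v` acts on the base points, up to homotopy, as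
multiplication by `X`. -/
noncomputable def liftGen : Path k A k[X] :=
  (v, X, unitHomotopy W ∘ₗ W.mul v ∘ₗ (W.basePoint v hd hε).ι)

/-- The lift is closed because `v y` and `j v y` are homologous through `unitHomotopy`. -/
theorem d_liftGen : (pathAlg (W.basePoint v hd hε)).d (liftGen W v hd hε) = 0 := by
  refine Prod.ext hd (Prod.ext rfl (LinearMap.ext fun x => ?_))
  have h1 := d_unitHomotopy (W := W) (W.mul v ((W.basePoint v hd hε).ι x))
  rw [W.d_mul, hd, (W.basePoint v hd hε).d_ι, map_zero, map_zero, LinearMap.zero_apply, add_zero,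
    map_zero, sub_zero, ← basePoint_X_mul] at h1
  have h2 : W.mul v ((W.basePoint v hd hε).ι x) - (W.basePoint v hd hε).ι (X * x) -
      W.d (unitHomotopy W (W.mul v ((W.basePoint v hd hε).ι x))) = 0 := by
    rw [h1, sub_self]
  exact h2

theorem fst_eval_pathAlg {S : Type*} [CommRing S] [Algebra k S] (b : BasePoint W S)
    {n : ℕ} {a : ℤ} (t : Term k n a) (L : List (Path k A S)) (hL : L.length = n) :
    ((pathAlg b).eval t L).1 = W.eval t (L.map Prod.fst) := by
  refine map_eval (D := pathDga b) (D' := W.toParityDga) (LinearMap.fst k A (S × (S →ₗ[k] A)))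
    (fun _ => rfl) (fun _ => rfl) (fun _ _ => rfl) rfl (fun L => ?_) t L hL
  have : ∀ L : List (Option (Path k A S)),
      toBase (twist (pathDga b) L) = twist W.toParityDga (toBase L) := by
    intro L
    induction L with
    | nil => rfl
    | cons z L ih =>
      rw [twist, toBase_cons, ih, toBase_cons, twist]
      congr 1
      cases z with
      | none => rfl
      | some e =>
        by_cases h : Even (L.length : ℤ) <;> simp [oepsZ, epsZ, h, toBase]
  exact congrArg W.τ (this L)

theorem snd_eval_pathAlg {S : Type*} [CommRing S] [Algebra k S] (b : BasePoint W S)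
    {n : ℕ} {a : ℤ} (t : Term k n a) (L : List (Path k A S)) (hL : L.length = n) :
    ((pathAlg b).eval t L).2.1 = t.aug • (L.map fun e => e.2.1).prod := by
  rw [← eval_commDga t (L.map fun e => e.2.1) (by simpa)]
  refine map_eval (D := pathDga b) (D' := commDga k S)
    (LinearMap.fst k S (S →ₗ[k] A) ∘ₗ LinearMap.snd k A (S × (S →ₗ[k] A)))
    (fun _ => rfl) (fun _ => rfl) (fun _ _ => rfl) rfl (fun L => ?_) t L hL
  match L with
  | [] => rfl
  | [none] => rfl
  | [some e] =>
    simp [twist, oepsZ, pathAlg, pathτ, strictP, epsZ_even]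
  | z :: z' :: L =>
    simp only [twist, pathAlg, pathτ, LinearMap.comp_apply, LinearMap.snd_apply,
      LinearMap.fst_apply, strictτ_cons_cons, List.map_cons]
    cases z <;> simp [strictP]

/-- Every closed element `x` is homologous to `x j`. -/
theorem d_tau_some_none (x : A) (hx : W.d x = 0) :
    W.d (W.τ [some (W.eps x), none]) = x - W.mul x W.j := by
  have h : W.τ [some 0, none] = 0 := by simpa using W.multi.zero_slot [] [none]
  simp [W.d_τ, ParityDga.bar_cons, cut_cons, W.τ_some, W.τ_none, W.τ_nil, ParityDga.sbar, W.d_eps,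
    hx, W.eps_eps, h, sub_eq_add_neg]

end

variable {k : Type u} [Field k]

variable (k) in
/-- The generator of the free algebra, that is the identity operation. -/
def gen : Tot (operadO k) := Term.one.toTot

theorem d_gen : (totAlg k).d (gen k) = 0 :=
  (Term.toTot_d rfl Term.one).symm.trans
    ((Rel.d_one rfl).toTot_eq.trans (Term.toTot_zero 1 (0 + 1)))

theorem eps_gen : (totAlg k).eps (gen k) = gen k :=
  (Term.eps_toTot Term.one).trans (by rw [koszulSign_zero, one_smul]; rfl)

variable (k) in
/-- The base points of the free algebra. -/
noncomputable def totBase : BasePoint (totAlg k) k[X] := (totAlg k).basePoint (gen k) d_gen eps_gen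

variable (k) in
/-- The lift of the generator to the path algebra. -/
noncomputable def totLift : Path k (Tot (operadO k)) k[X] :=
  liftGen (totAlg k) (gen k) d_gen eps_gen

theorem aug_eval {n : ℕ} {a : ℤ} (t : Term k n a) :
    ((pathAlg (totBase k)).eval t (List.replicate n (totLift k))).2.1 = t.aug • X ^ n := by
  rw [snd_eval_pathAlg _ _ _ _ (List.length_replicate), List.map_replicate, List.prod_replicate]
  rfl

theorem fst_eval {n : ℕ} {a : ℤ} (t : Term k n a) :
    ((pathAlg (totBase k)).eval t (List.replicate n (totLift k))).1 = t.toTot := by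
  have h : (fun L => (totAlg k).τ (twist (totAlg k).toParityDga L)) = totP := by
    funext L
    exact congrArg totP (twist_twist (D := totDga k) L)
  rw [fst_eval_pathAlg _ _ _ _ (List.length_replicate), List.map_replicate, WeakAlg.eval, h]
  refine (eval_totDga t _ List.length_replicate).trans ?_
  exact plug_replicate_one n a t.toObj

/-- The augmentation respects the relations, because it can be read off from the second component of
the value in the path algebra. -/
theorem aug_eq_of_rel {n : ℕ} {a : ℤ} {t t' : Term k n a} (h : Rel k t t') : t.aug = t'.aug := by
  have h1 := (pathAlg (totBase k)).eval_eq_of_rel h (List.replicate n (totLift k))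
    List.length_replicate
  have h2 := congrArg (fun e : Path k (Tot (operadO k)) k[X] => e.2.1.coeff n) h1
  simpa [aug_eval] using h2

variable {Q : DgOperad k}

variable (Q) in
/-- The component of arity `n` and degree `a`. -/
def Tot.proj (n : ℕ) (a : ℤ) : Tot Q →ₗ[k] Q.obj n a :=
  DirectSum.component k (ℕ × ℤ) (fun p => Q.obj p.1 p.2) (n, a)

theorem Tot.proj_inc {n : ℕ} {a : ℤ} (x : Q.obj n a) : proj Q n a (inc Q n a x) = x :=
  DirectSum.component.lof_self (M := fun p : ℕ × ℤ => Q.obj p.1 p.2) k (n, a) x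

theorem Tot.proj_inc_of_ne {n m : ℕ} {a b : ℤ} (h : (m, b) ≠ (n, a)) (x : Q.obj m b) :
    proj Q n a (inc Q m b x) = 0 := by
  rw [proj, inc, DirectSum.component.of, dif_neg h]

theorem Tot.proj_d {n : ℕ} {a b : ℤ} (h : a + 1 = b) (x : Tot Q) :
    proj Q n b (Tot.d Q x) = Q.d h (proj Q n a x) := by
  refine ext_inc (f := proj Q n b ∘ₗ Tot.d Q) (g := Q.d h ∘ₗ proj Q n a) (fun m c x => ?_) x
  rw [LinearMap.comp_apply, LinearMap.comp_apply]
  by_cases hm : (m, c) = (n, a)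
  · obtain ⟨rfl, rfl⟩ := Prod.mk.inj hm
    rw [d_inc h, proj_inc, proj_inc]
  · rw [d_inc rfl, proj_inc_of_ne hm, map_zero, proj_inc_of_ne]
    intro h'
    obtain ⟨h1, h2⟩ := Prod.mk.inj h'
    exact hm (by rw [h1, show c = a by omega])

/-- The kernel of the augmentation is acyclic: a closed operation `x` of augmentation zero is
homologous to `x j`, and `x j` is the boundary of the homotopy contained in the value at the lifted
generator. -/
theorem exists_d_eq {n : ℕ} {a b c : ℤ} (hc : c + 1 = a) (hb : a + 1 = b) (t : Term k n a)
    (ht : (operadO k).d hb t.toObj = 0) (h0 : t.aug = 0) :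
    ∃ y : (operadO k).obj n c, (operadO k).d hc y = t.toObj := by
  let L := List.replicate n (totLift k)
  have hL : L.length = n := List.length_replicate
  set e := (pathAlg (totBase k)).eval t L with he
  have hd : (pathAlg (totBase k)).d e = 0 := by
    have hq : (Quot.mk _ (Term.d hb t) : Obj k n b) = Quot.mk _ Term.zero := ht
    have h1 := congrArg (Quot.lift (fun t => (pathAlg (totBase k)).eval t L)
      fun _ _ h => (pathAlg (totBase k)).eval_eq_of_rel h L hL) hq
    rw [he, ← (pathAlg (totBase k)).eval_d hb t L hL fun x hx => ?_]
    · exact h1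
    · rw [List.eq_of_mem_replicate hx]
      exact d_liftGen (totAlg k) (gen k) d_gen eps_gen
  have h1 : e.1 = t.toTot := fst_eval t
  have h2 : e.2.1 = 0 := by rw [he, aug_eval, h0, zero_smul]
  have hι : (totBase k).ι 1 = (totAlg k).j := by
    have := basePoint_pow (totAlg k) (gen k) d_gen eps_gen 0
    rwa [pow_zero] at this
  -- the third component of `d e = 0`, evaluated at `1 : k[X]`
  have h3 : (totAlg k).mul t.toTot (totAlg k).j = (totAlg k).d (e.2.2 1) := by
    have := congrArg (fun e : Path k (Tot (operadO k)) k[X] => e.2.2 1) hd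
    simp only [pathAlg, pathDga_d, h1, h2, map_zero, sub_zero, LinearMap.sub_apply, lmul_apply,
      hι] at this
    exact sub_eq_zero.mp this
  have h4 : (totAlg k).d t.toTot = 0 := by
    refine (Term.toTot_d hb t).symm.trans ?_
    exact (congrArg (inc (operadO k) n b) ht).trans (map_zero _)
  have h5 := d_tau_some_none (totAlg k) t.toTot h4
  rw [h3, eq_sub_iff_add_eq, ← map_add] at h5
  refine ⟨proj (operadO k) n c _, (Tot.proj_d hc _).symm.trans
    ((congrArg (proj (operadO k) n a) h5).trans (Tot.proj_inc _))⟩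

end WeaklyUnital

namespace WeaklyUnital

/-! ### The projection to the operad of strictly unital algebras -/

variable {k : Type u} [Field k]

variable (k) in
/-- The morphism of dg operads given by the augmentation. -/
def projection : DgOperad.Hom (operadO k) (AssocPlus k) where
  map n a :=
    { toFun := Quot.lift (fun t => (⟨t.aug, fun ha => t.aug_eq_zero ha⟩ : assocObj k a))
        fun _ _ h => Subtype.ext (aug_eq_of_rel h)
      map_add' := by rintro ⟨x⟩ ⟨y⟩; rfl
      map_smul' := by rintro c ⟨x⟩; rfl }
  map_one := rfl
  map_comp := by rintro n m N a b e i hi hN he ⟨x⟩ ⟨y⟩; rfl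
  map_d := by rintro n a b h ⟨x⟩; rfl

theorem isProjection_projection : IsProjection (projection k) :=
  ⟨rfl, rfl, fun _ _ h => Subtype.ext (if_neg (by omega))⟩

/-- The values of a morphism on the generators determine it on all formal expressions. -/
theorem map_toObj_eq {F : DgOperad.Hom (operadO k) (AssocPlus k)} (hF : IsProjection F)
    {n : ℕ} {a : ℤ} (t : Term k n a) : (F.map n a t.toObj : assocObj k a).1 = t.aug := by
  have h1 : ∀ (n : ℕ) (a : ℤ) (t t' : Term k n a), Rel k t t' →
      F.map n a t.toObj = F.map n a t'.toObj := fun n a t t' h => congrArg _ (Quot.sound h)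
  have h_one : (F.map 1 0 Term.one.toObj : assocObj k 0).1 = 1 := congrArg Subtype.val F.map_one
  have h_j : (F.map 0 0 Term.j.toObj : assocObj k 0).1 = 1 := congrArg Subtype.val hF.2.1
  induction t with
  | one => exact h_one
  | m => exact congrArg Subtype.val hF.1
  | j => exact h_j
  | p w hw hn ha =>
    rename_i n a
    match w, hw, hn, ha with
    | [true], hw, hn, ha =>
      obtain rfl : n = 0 := hn
      obtain rfl : a = 0 := by simpa using ha
      rw [h1 _ _ _ _ (Rel.p_true hw rfl rfl), h_j]
      rfl
    | [false], hw, hn, ha =>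
      obtain rfl : n = 1 := hn
      obtain rfl : a = 0 := by simpa using ha
      rw [h1 _ _ _ _ (Rel.p_false hw rfl rfl), h_one]
      rfl
    | c :: c' :: w, hw, hn, ha =>
      subst hn ha
      refine (congrArg Subtype.val (hF.2.2 (c :: c' :: w) hw (by simp))).trans ?_
      exact (if_neg (by simp)).symm
  | comp i hi hN he x y ihx ihy =>
    exact (congrArg Subtype.val (F.map_comp i hi hN he x.toObj y.toObj)).trans
      (congrArg₂ (· * ·) ihx ihy)
  | d h x ih => exact congrArg Subtype.val (F.map_d h x.toObj)
  | zero => exact congrArg Subtype.val (map_zero (F.map _ _))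
  | add x y ihx ihy =>
    exact (congrArg Subtype.val (map_add (F.map _ _) x.toObj y.toObj)).trans
      (congrArg₂ (· + ·) ihx ihy)
  | smul c x ih =>
    exact (congrArg Subtype.val (map_smul (F.map _ _) c x.toObj)).trans (congrArg (c * ·) ih)

theorem eq_projection (F : DgOperad.Hom (operadO k) (AssocPlus k)) (hF : IsProjection F) :
    F = projection k := by
  have h : F.map = (projection k).map := by
    funext n a
    refine LinearMap.ext ?_
    rintro ⟨t⟩
    exact Subtype.ext (map_toObj_eq hF t)
  cases F
  cases hp : projection k
  rw [hp] at h
  subst h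
  rfl

variable (k) in
/-- The iterated product `m (m (… m (j, -) …, -), -)`, of arity `n`. -/
def Term.iter : ∀ n : ℕ, Term k n 0
  | 0 => .j
  | n + 1 => .comp 0 Nat.zero_lt_two (by omega) rfl .m (Term.iter n)

theorem Term.aug_iter (n : ℕ) : (Term.iter k n).aug = 1 := by
  induction n with
  | zero => rfl
  | succ n ih => simp [Term.iter, Term.aug, ih]

theorem d_iter (n : ℕ) {b : ℤ} (h : 0 + 1 = b) : (operadO k).d h (Term.iter k n).toObj = 0 := by
  subst h
  induction n with
  | zero => exact Quot.sound (Rel.d_j rfl)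
  | succ n ih =>
    refine ((operadO k).d_comp (a := 0) (b := 0) 0 Nat.zero_lt_two _ rfl rfl rfl rfl rfl rfl
      Term.m.toObj (Term.iter k n).toObj).trans ?_
    have hm : (operadO k).d rfl (Term.m (k := k)).toObj = 0 := Quot.sound (Rel.d_m rfl)
    rw [ih, hm]
    simp

theorem isQuasiIso_projection : (projection k).IsQuasiIso := by
  intro n
  rw [quasiIso_iff]
  intro a
  rw [quasiIsoAt_iff_isIso_homologyMap]
  have hd₁ : ((operadO k).complex n).d (a - 1) a =
      ModuleCat.ofHom ((operadO k).d (sub_add_cancel a 1)) := dif_pos (sub_add_cancel a 1)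
  have hd₂ : ((operadO k).complex n).d a (a + 1) = ModuleCat.ofHom ((operadO k).d rfl) :=
    dif_pos rfl
  have hd₃ : ((AssocPlus k).complex n).d (a - 1) a = 0 := dif_pos (sub_add_cancel a 1)
  have hp : (ComplexShape.up ℤ).prev a = a - 1 := by simp
  have hn : (ComplexShape.up ℤ).next a = a + 1 := by simp
  have hmono : Mono (HomologicalComplex.homologyMap ((projection k).mapComplex n) a) := by
    rw [HomologicalComplex.mono_homologyMap_iff_up_to_refinements _ (a - 1) a (a + 1) hp hn]
    intro A x hx y hxy
    rw [hd₂] at hx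
    rw [hd₃, Limits.comp_zero] at hxy
    let δ := (operadO k).d (n := n) (sub_add_cancel a 1)
    have hr : ∀ v : A, x.hom v ∈ LinearMap.range δ := by
      intro v
      have h1 : (operadO k).d (n := n) rfl (x.hom v) = 0 :=
        LinearMap.congr_fun (congrArg ModuleCat.Hom.hom hx) v
      have h2 : (projection k).map n a (x.hom v) = 0 :=
        LinearMap.congr_fun (congrArg ModuleCat.Hom.hom hxy) v
      obtain ⟨t, ht⟩ := Quot.exists_rep (x.hom v : Obj k n a)
      replace ht : x.hom v = t.toObj := ht.symm
      rw [ht] at h1 h2 ⊢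
      obtain ⟨z, hz⟩ := exists_d_eq (sub_add_cancel a 1) rfl t h1 (congrArg Subtype.val h2)
      exact ⟨z, hz⟩
    -- over a field, a family of boundaries has a linear family of primitives
    obtain ⟨s, hs⟩ := LinearMap.exists_rightInverse_of_surjective δ.rangeRestrict
      (LinearMap.range_rangeRestrict δ)
    refine ⟨A, 𝟙 A, inferInstance,
      ModuleCat.ofHom (s ∘ₗ x.hom.codRestrict (LinearMap.range δ) hr), ?_⟩
    rw [hd₁]
    ext v
    have := congrArg Subtype.val (LinearMap.congr_fun hs ⟨x.hom v, hr v⟩)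
    exact this.symm
  have hepi : Epi (HomologicalComplex.homologyMap ((projection k).mapComplex n) a) := by
    rw [HomologicalComplex.epi_homologyMap_iff_up_to_refinements _ (a - 1) a (a + 1) hp hn]
    intro A y _
    refine ⟨A, 𝟙 A, inferInstance, ?_⟩
    by_cases ha : a = 0
    · subst ha
      refine ⟨ModuleCat.ofHom (LinearMap.toSpanSingleton k ((operadO k).obj n 0)
        (Term.iter k n).toObj ∘ₗ (assocObj k 0).subtype ∘ₗ y.hom), ?_, 0, ?_⟩
      · rw [hd₂]
        ext v
        change (operadO k).d rfl ((y.hom v : assocObj k 0).1 • (Term.iter k n).toObj) = 0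
        rw [map_smul, d_iter, smul_zero]
      · rw [Limits.zero_comp, add_zero]
        ext v
        refine Subtype.ext ?_
        change (y.hom v : assocObj k 0).1 = (y.hom v : assocObj k 0).1 * (Term.iter k n).aug
        rw [Term.aug_iter, mul_one]
    · refine ⟨0, Limits.zero_comp, 0, ?_⟩
      rw [Limits.zero_comp, Limits.zero_comp, add_zero, Category.id_comp]
      ext v
      exact Subtype.ext ((y.hom v : assocObj k a).2 ha)
  exact isIso_of_mono_of_epi _

end WeaklyUnital

theorem mainTheorem3 (k : Type u) [Field k] :
    ∃ π : DgOperad.Hom (WeaklyUnital.operadO k) (AssocPlus k),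
      WeaklyUnital.IsProjection π ∧
      (∀ F : DgOperad.Hom (WeaklyUnital.operadO k) (AssocPlus k),
        WeaklyUnital.IsProjection F → F = π) ∧
      π.IsQuasiIso :=
  ⟨WeaklyUnital.projection k, WeaklyUnital.isProjection_projection, WeaklyUnital.eq_projection,
    WeaklyUnital.isQuasiIso_projection⟩
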